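/- Let $\hbar\in\mathbb{C}$ with $\operatorname{Im}\hbar>0$, put $q=e^{\sqrt{-1}\hbar}$ (so $0<|q|<1$) and $q^A=\exp(\sqrt{-1}\hbar A)$ for numbers and operators $A$, and let $\tau\in\mathbb{C}\setminus\{0\}$. Let $\psi_n,\psi^*_n$ ($n\in\mathbb{Z}$) be free fermions with $\psi_m\psi^*_n+\psi^*_n\psi_m=\delta_{m+n,0}$, $\psi_m\psi_n+\psi_n\psi_m=\psi^*_m\psi^*_n+\psi^*_n\psi^*_m=0$, acting on the Fock space with orthonormal basis $$|\mu,s\rangle=\psi_{-\mu_1-s}\psi_{-\mu_2+1-s}\cdots\psi_{-\mu_i+i-1-s}\cdots|-\infty\rangle\qquad(\mu\text{ a partition},\ s\in\mathbb{Z}),$$ and write $|s\rangle=|\emptyset,s\rangle$, $|\mu\rangle=|\mu,0\rangle$. With normal ordering ${:}\psi_{-m}\psi^*_n{:}=\psi_{-m}\psi^*_n-\langle 0|\psi_{-m}\psi^*_n|0\rangle$ put $$L_0=\sum_{n}n{:}\psi_{-n}\psi^*_n{:},\quad K=\sum_{n}(n-\tfrac12)^2{:}\psi_{-n}\psi^*_n{:},\quad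 J_m=\sum_{n}{:}\psi_{-n}\psi^*_{n+m}{:},$$ $$\Gamma_\pm(q^{-\rho})=\exp\Big(\sum_{k\ge1}\frac{1}{k}\sum_{i\ge1}q^{(i-1/2)k}J_{\pm k}\Big),\qquad h=q^{(\tau+1)K/2}\,\Gamma_-(q^{-\rho})\Gamma_+(q^{-\rho})\,q^{(\tau^{-1}+1)K/2}.$$ Let $S_m(\boldsymbol p)$ be given by $\sum_{m\ge0}S_m(\boldsymbol p)z^m=\exp(\sum_{k\ge1}p_kz^k/k)$, $S_m=0$ for $m<0$, and put $S_\nu(\boldsymbol p)=\det(S_{\nu_i-i+j}(\boldsymbol p))_{1\le i,j\le l(\nu)}$ and $\kappa(\nu)=\sum_i\nu_i(\nu_i-2i+1)$ for a partition $\nu$. For $s\in\mathbb{C}$ let $\mathcal{T}(s,\boldsymbol t,\bar{\boldsymbol t})$ be the formal power series in $\boldsymbol t=(t_k)_{k\ge1}$, $\bar{\boldsymbol t}=(\bar t_k)_{k\ge1}$ $$\mathcal{T}(s,\boldsymbol t,\bar{\boldsymbol t})=\sum_{\nu,\bar\nu}q^{(\tau+1)(\kappa(\nu)/2+s|\nu|+(4s^3-s)/24)}\,q^{(\tau^{-1}+1)(\kappa(\bar\nu)/2+s|\bar\nu|+(4s^3-s)/24)}\,\langle\nu|\Gamma_-(q^{-\rho})\Gamma_+(q^{-\rho})|\bar\nu\rangle\,S_\nu(\boldsymbol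 p)\,S_{\bar\nu}(\bar{\boldsymbol p}),\quad p_k=kt_k,\ \bar p_k=-k\bar t_k,$$ the sum being over all pairs of partitions. Then for every constant $c\in\mathbb{C}$ the following hold. (a) For all $s\in\mathbb{Z}$, $$\mathcal{T}(s,\boldsymbol t,\bar{\boldsymbol t})=\langle s|\exp\Big(\sum_{k\ge1}t_kJ_k\Big)\,h\,\exp\Big(-\sum_{k\ge1}\bar t_kJ_{-k}\Big)|s\rangle,$$ $$\mathcal{T}(s+c,\boldsymbol t,\bar{\boldsymbol t})=\langle s|\exp\Big(\sum_{k\ge1}t_kJ_k\Big)\,h(c)\,\exp\Big(-\sum_{k\ge1}\bar t_kJ_{-k}\Big)|s\rangle,$$ where $$h(c)=q^{(\tau+\tau^{-1}+2)(4c^3-c)/24}\,q^{(\tau+1)(K/2+cL_0+(c^2-c)J_0/2)}\,\Gamma_-(q^{-\rho})\Gamma_+(q^{-\rho})\,q^{(\tau^{-1}+1)(K/2+cL_0+(c^2-c)J_0/2)}.$$ (b) The function $T(s)=\mathcal{T}(s+c,\boldsymbol t,\bar{\boldsymbol t})$, $s\in\mathbb{Z}$, is a tau function of the 2D Toda hierarchy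 in the following sense. Every $T(s)$ is an invertible power series. Let $\Lambda=e^{\partial_s}$, $[z]=(z,z^2/2,\dots,z^k/k,\dots)$, and let $W=1+\sum_{n\ge1}w_n\Lambda^{-n}$, $\bar W=\sum_{n\ge0}\bar w_n\Lambda^n$ be given by $$\frac{T(s-1,\boldsymbol t-[z^{-1}],\bar{\boldsymbol t})}{T(s-1,\boldsymbol t,\bar{\boldsymbol t})}=1+\sum_{n\ge1}w_nz^{-n},\qquad\frac{T(s,\boldsymbol t,\bar{\boldsymbol t}-[z])}{T(s-1,\boldsymbol t,\bar{\boldsymbol t})}=\sum_{n\ge0}\bar w_nz^n.$$ Then $W$ and $\bar W$ are invertible (with inverses in non-positive, respectively non-negative, powers of $\Lambda$), and with $L=W\Lambda W^{-1}$, $\bar L=\bar W\Lambda\bar W^{-1}$, $B_k=(L^k)_{\ge0}$, $\bar B_k=(\bar L^{-k})_{<0}$ (projections to the non-negative and the negative powers of $\Lambda$) one has, for all $k\ge1$, $$\frac{\partial W}{\partial t_k}=B_kW-W\Lambda^k,\quad\frac{\partial W}{\partial\bar t_k}=\bar B_kW,\quad\frac{\partial\bar W}{\partial t_k}=B_k\bar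 W,\quad\frac{\partial\bar W}{\partial\bar t_k}=\bar B_k\bar W-\bar W\Lambda^{-k},$$ and $L=\Lambda+\sum_{n\ge1}u_n\Lambda^{1-n}$, $\bar L^{-1}=\sum_{n\ge0}\bar u_n\Lambda^{n-1}$ satisfy the Lax equations $$\frac{\partial L}{\partial t_k}=[B_k,L],\quad\frac{\partial L}{\partial\bar t_k}=[\bar B_k,L],\quad\frac{\partial\bar L}{\partial t_k}=[B_k,\bar L],\quad\frac{\partial\bar L}{\partial\bar t_k}=[\bar B_k,\bar L].$$ -/

import Mathlib

open scoped MvPowerSeries.WithPiTopology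

noncomputable section

namespace CubicHodge

/-! ### Maya diagrams and operators on the fermionic Fock space -/

/-- A set of integers is a Maya diagram if it contains finitely many positive integers and misses
finitely many non-positive ones. -/
def IsMaya (S : Set ℤ) : Prop := {n | n ∈ S ∧ 0 < n}.Finite ∧ {n | n ∉ S ∧ n ≤ 0}.Finite

/-- The Maya diagrams `S = {a₁ > a₂ > ⋯}` label the orthonormal basis
`ψ_{-a₁} ψ_{-a₂} ⋯ |-∞⟩` of the fermionic Fock space (all charges together). -/
def Maya : Type := {S : Set ℤ // IsMaya S}

theorem isMaya_state (μ : YoungDiagram) (s : ℤ) :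
    IsMaya (Set.range fun i : ℕ => (μ.rowLen i : ℤ) - i + s) := by
  constructor
  · refine ((Set.finite_Iio (μ.rowLen 0 + s.toNat + 1)).image
      fun i : ℕ => (μ.rowLen i : ℤ) - i + s).subset ?_
    rintro n ⟨⟨i, rfl⟩, hn⟩
    refine ⟨i, ?_, rfl⟩
    have h := μ.rowLen_anti 0 i (Nat.zero_le i)
    have hn1 : 0 < (μ.rowLen i : ℤ) - i + s := hn
    simp only [Set.mem_Iio]
    omega
  · refine (Set.finite_Icc (s - (μ.colLen 0 : ℤ)) 0).subset ?_
    rintro n ⟨hn, h0⟩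
    refine ⟨?_, h0⟩
    by_contra hlt
    push Not at hlt
    refine hn ⟨(s - n).toNat, ?_⟩
    have hz : μ.rowLen (s - n).toNat = 0 := by
      by_contra hne
      have h1 : ((s - n).toNat, 0) ∈ μ := YoungDiagram.mem_iff_lt_rowLen.2 (Nat.pos_of_ne_zero hne)
      have h2 := YoungDiagram.mem_iff_lt_colLen.1 h1
      omega
    simp only [hz]
    omega

/-- The state `|μ, s⟩ = ψ_{-μ₁-s} ψ_{-μ₂+1-s} ⋯ |-∞⟩` of charge `s`
(`μ.rowLen i` is `μ_{i+1}`). -/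
def state (μ : YoungDiagram) (s : ℤ) : Maya :=
  ⟨Set.range fun i : ℕ => (μ.rowLen i : ℤ) - i + s, isMaya_state μ s⟩

/-- The ground state `|s⟩`. -/
def ground (s : ℤ) : Maya := state ⊥ s

/-- Operators on the Fock space with coefficients in `R`, given by their matrix elements
`A S S' = ⟨S|A|S'⟩` in the orthonormal basis of Maya diagrams. -/
abbrev Op (R : Type) : Type := Maya → Maya → R

section Operators

variable {R : Type} [CommRing R] [Algebra ℂ R] [TopologicalSpace R]

open Classical in
/-- The identity operator. -/
def opOne : Op R := fun S S' => if S = S' then 1 else 0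

/-- The product of operators: insert the partition of unity `∑ P, |P⟩⟨P|`. -/
def opMul (A B : Op R) : Op R := fun S S' => ∑' P : Maya, A S P * B P S'

/-- Powers of an operator. -/
def opPow (A : Op R) : ℕ → Op R
  | 0 => opOne
  | n + 1 => opMul (opPow A n) A

/-- The exponential of an operator, by its power series. -/
def opExp (A : Op R) : Op R := fun S S' => ∑' n : ℕ, ((n.factorial : ℂ)⁻¹) • opPow A n S S'

end Operators

/-- The sign `(-1)^{#{m ∈ S : m > n}}`. -/
def fermiSign (S : Set ℤ) (n : ℤ) : ℂ := (-1) ^ {m | m ∈ S ∧ n < m}.ncard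

open Classical in
/-- The creation operator `ψ_n`: left multiplication of `ψ_{-a₁} ψ_{-a₂} ⋯ |-∞⟩` by `ψ_n`. -/
def psi (n : ℤ) : Op ℂ := fun S S' =>
  if -n ∉ S'.1 ∧ S.1 = insert (-n) S'.1 then fermiSign S'.1 (-n) else 0

open Classical in
/-- The annihilation operator `ψ*_n`, which removes `ψ_{-n}`. -/
def psiStar (n : ℤ) : Op ℂ := fun S S' =>
  if n ∈ S'.1 ∧ S.1 = S'.1 \ {n} then fermiSign S'.1 n else 0

/-- The normal ordered product `:ψ_{-m} ψ*_n:`. -/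
def normalOrd (m n : ℤ) : Op ℂ :=
  opMul (psi (-m)) (psiStar n) - (if m = n ∧ n ≤ 0 then (1 : ℂ) else 0) • opOne

/-- The fermion bilinear `∑ n ∈ ℤ, a n :ψ_{-n} ψ*_{n+m}:`
(each matrix element is a finite sum). -/
def bilinear (a : ℤ → ℂ) (m : ℤ) : Op ℂ := fun S S' => ∑' n : ℤ, a n * normalOrd n (n + m) S S'

/-- `L₀ = ∑ n :ψ_{-n} ψ*_n:`. -/
def opL0 : Op ℂ := bilinear (fun n => (n : ℂ)) 0

/-- `K = ∑ (n - 1/2)² :ψ_{-n} ψ*_n:`. -/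
def opK : Op ℂ := bilinear (fun n => ((n : ℂ) - 1 / 2) ^ 2) 0

/-- `J_m = ∑ :ψ_{-n} ψ*_{n+m}:`. -/
def opJ (m : ℤ) : Op ℂ := bilinear (fun _ => 1) m

section Currents

variable {R : Type} [CommRing R] [Algebra ℂ R] [TopologicalSpace R]

/-- `∑_{k ≥ 1} a_k J_k`. -/
def currentPos (a : ℕ+ → R) : Op R := fun S S' => ∑' k : ℕ+, opJ (k : ℤ) S S' • a k

/-- `∑_{k ≥ 1} a_k J_{-k}`. -/
def currentNeg (a : ℕ+ → R) : Op R := fun S S' => ∑' k : ℕ+, opJ (-(k : ℤ)) S S' • a k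

end Currents

/-- `p_k(x)/k`, where `p_k` is the `k`-th power sum of the variables `x₀, x₁, …`. -/
def powerSumDiv (x : ℕ → ℂ) (k : ℕ+) : ℂ := (∑' i : ℕ, x i ^ (k : ℕ)) / ((k : ℕ) : ℂ)

/-- `Γ₊(x) = ∏ᵢ Γ₊(xᵢ) = exp (∑_{k ≥ 1} ∑ᵢ (xᵢ^k / k) J_k)`. -/
def GammaPos (x : ℕ → ℂ) : Op ℂ := opExp (currentPos (powerSumDiv x))

/-- `Γ₋(x) = ∏ᵢ Γ₋(xᵢ) = exp (∑_{k ≥ 1} ∑ᵢ (xᵢ^k / k) J_{-k})`. -/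
def GammaNeg (x : ℕ → ℂ) : Op ℂ := opExp (currentNeg (powerSumDiv x))

/-! ### The parameter `q = exp (i ħ)` -/

/-- `q^a = exp (a log q)` with `log q = i ħ`. -/
def qpow (ħ a : ℂ) : ℂ := Complex.exp (a * (Complex.I * ħ))

/-- `q^A = exp (A log q)` for an operator `A`. -/
def opQpow (ħ : ℂ) (A : Op ℂ) : Op ℂ := opExp ((Complex.I * ħ) • A)

/-- The specialization `q^{-ρ} = (q^{1/2}, q^{3/2}, q^{5/2}, …)`. -/
def qNegRho (ħ : ℂ) (i : ℕ) : ℂ := qpow ħ ((i : ℂ) + 1 / 2)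

/-- `Γ₋(q^{-ρ}) Γ₊(q^{-ρ})`. -/
def GammaGamma (ħ : ℂ) : Op ℂ := opMul (GammaNeg (qNegRho ħ)) (GammaPos (qNegRho ħ))

/-- `h = q^{(τ+1)K/2} Γ₋(q^{-ρ}) Γ₊(q^{-ρ}) q^{(τ⁻¹+1)K/2}`. -/
def opH (ħ τ : ℂ) : Op ℂ :=
  opMul (opMul (opQpow ħ (((τ + 1) / 2) • opK)) (GammaGamma ħ)) (opQpow ħ (((τ⁻¹ + 1) / 2) • opK))

/-- `K/2 + c L₀ + (c² - c) J₀ / 2`. -/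
def shiftedK (c : ℂ) : Op ℂ := (1 / 2 : ℂ) • opK + c • opL0 + ((c ^ 2 - c) / 2) • opJ 0

/-- `h(c) = q^{(τ+τ⁻¹+2)(4c³-c)/24} q^{(τ+1)(K/2+cL₀+(c²-c)J₀/2)} Γ₋(q^{-ρ}) Γ₊(q^{-ρ})
q^{(τ⁻¹+1)(K/2+cL₀+(c²-c)J₀/2)}`. -/
def opHc (ħ τ c : ℂ) : Op ℂ :=
  qpow ħ ((τ + τ⁻¹ + 2) * (4 * c ^ 3 - c) / 24) •
    opMul (opMul (opQpow ħ ((τ + 1) • shiftedK c)) (GammaGamma ħ))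
      (opQpow ħ ((τ⁻¹ + 1) • shiftedK c))

/-! ### Formal power series in the time variables -/

/-- Labels of the time variables: `Sum.inl k` for `t_k` and `Sum.inr k` for `t̄_k`, `k ≥ 1`. -/
abbrev Time : Type := ℕ+ ⊕ ℕ+

/-- Formal power series in `t` and `t̄`, with the topology of coefficientwise convergence. -/
abbrev TSeries : Type := MvPowerSeries Time ℂ

/-- The variable `t_k`. -/
def tvar (k : ℕ+) : TSeries := MvPowerSeries.X (Sum.inl k)

/-- The variable `t̄_k`. -/
def tbar (k : ℕ+) : TSeries := MvPowerSeries.X (Sum.inr k)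

/-- The function `⟨s| exp (∑ t_k J_k) g exp (-∑ t̄_k J_{-k}) |s⟩` of `s ∈ ℤ` attached to an
operator `g`. -/
def fermionicTau (g : Op ℂ) (s : ℤ) : TSeries :=
  opMul (opMul (opExp (currentPos tvar)) (fun S S' => MvPowerSeries.C (g S S')))
    (opExp (currentNeg fun k => -tbar k)) (ground s) (ground s)

/-! ### Schur functions and the function `𝒯(s, t, t̄)` of a continuous variable `s` -/

/-- `S_m(p)`, where `∑_{m ≥ 0} S_m(p) z^m = exp (∑_{k ≥ 1} p_k z^k / k)` and `S_m = 0` for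
`m < 0`. -/
def schurRow (p : ℕ+ → TSeries) (m : ℤ) : TSeries :=
  if 0 ≤ m then
    PowerSeries.coeff m.toNat ((PowerSeries.exp ℂ).subst
      (PowerSeries.mk fun n : ℕ =>
        if h : 0 < n then ((n : ℂ)⁻¹) • p ⟨n, h⟩ else (0 : TSeries)))
  else 0

/-- `S_ν(p) = det (S_{ν_i - i + j}(p))_{1 ≤ i, j ≤ l(ν)}`. -/
def schur (ν : YoungDiagram) (p : ℕ+ → TSeries) : TSeries :=
  Matrix.det (Matrix.of fun i j : Fin (ν.colLen 0) =>
    schurRow p ((ν.rowLen i : ℤ) - (i : ℕ) + (j : ℕ)))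

/-- `κ(ν) = ∑_{i ≥ 1} ν_i (ν_i - 2 i + 1)`. -/
def kappa (ν : YoungDiagram) : ℤ :=
  ∑ i ∈ Finset.range (ν.colLen 0), (ν.rowLen i : ℤ) * ((ν.rowLen i : ℤ) - 2 * (i + 1) + 1)

/-- `κ(ν)/2 + s|ν| + (4s³ - s)/24`. -/
def sExponent (ν : YoungDiagram) (s : ℂ) : ℂ :=
  (kappa ν : ℂ) / 2 + s * (ν.card : ℂ) + (4 * s ^ 3 - s) / 24

/-- The function `𝒯(s, t, t̄)` of `s ∈ ℂ`: the double sum over partitions `ν, ν̄` of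
`q^{(τ+1)(κ(ν)/2+s|ν|+(4s³-s)/24)} q^{(τ⁻¹+1)(κ(ν̄)/2+s|ν̄|+(4s³-s)/24)}
⟨ν|Γ₋(q^{-ρ})Γ₊(q^{-ρ})|ν̄⟩ S_ν(p) S_ν̄(p̄)` with `p_k = k t_k` and `p̄_k = -k t̄_k`
(each coefficient is a finite sum). -/
def tau (ħ τ s : ℂ) : TSeries :=
  ∑' ν : YoungDiagram × YoungDiagram,
    (qpow ħ ((τ + 1) * sExponent ν.1 s) * qpow ħ ((τ⁻¹ + 1) * sExponent ν.2 s) *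
        GammaGamma ħ (state ν.1 0) (state ν.2 0)) •
      (schur ν.1 (fun k => ((k : ℕ) : ℂ) • tvar k) *
        schur ν.2 (fun k => -(((k : ℕ) : ℂ) • tbar k)))

/-! ### The 2D Toda hierarchy -/

/-- Formal difference operators `∑_{n ∈ ℤ} a_n(s) Λ^n`, `Λ = e^{∂_s}`, `s ∈ ℤ`: `a n s` is the
coefficient `a_n(s)`. -/
abbrev DiffOp : Type := ℤ → ℤ → TSeries

/-- The product of difference operators, by `Λ^k b(s) = b(s+k) Λ^k`. It is only used where the sum
is finite. -/
def dmul (a b : DiffOp) : DiffOp := fun n s => ∑ᶠ k : ℤ, a k s * b (n - k) (s + k)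

/-- `Λ^m`. -/
def dLambda (m : ℤ) : DiffOp := fun n _ => if n = m then 1 else 0

/-- Powers of a difference operator. -/
def dpow (a : DiffOp) : ℕ → DiffOp
  | 0 => dLambda 0
  | n + 1 => dmul (dpow a n) a

/-- The commutator of difference operators. -/
def dcomm (a b : DiffOp) : DiffOp := dmul a b - dmul b a

/-- The part of non-negative powers of `Λ`. -/
def dNonneg (a : DiffOp) : DiffOp := fun n s => if 0 ≤ n then a n s else 0

/-- The part of negative powers of `Λ`. -/
def dNeg (a : DiffOp) : DiffOp := fun n s => if n < 0 then a n s else 0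

/-- The partial derivative of a difference operator in a time variable. -/
def dderiv (i : Time) (a : DiffOp) : DiffOp := fun n s => MvPowerSeries.pderiv ℂ i (a n s)

/-- `B_k = (L^k)_{≥ 0}`. -/
def opB (L : DiffOp) (k : ℕ+) : DiffOp := dNonneg (dpow L k)

/-- `B̄_k = (L̄^{-k})_{< 0}`, in terms of `L̄⁻¹`. -/
def opBbar (LbarInv : DiffOp) (k : ℕ+) : DiffOp := dNeg (dpow LbarInv k)

/-- The operators `L = Λ + ∑_{n ≥ 1} u_n Λ^{1-n}` and `L̄`, with inverse
`L̄⁻¹ = ∑_{n ≥ 0} ū_n Λ^{n-1}`, satisfy the Lax equations of the 2D Toda hierarchy. -/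
structure IsTodaLax (L Lbar LbarInv : DiffOp) : Prop where
  L_lead : ∀ s, L 1 s = 1
  L_zero : ∀ n s, 1 < n → L n s = 0
  Lbar_zero : ∀ n s, n < 1 → Lbar n s = 0
  LbarInv_zero : ∀ n s, n < -1 → LbarInv n s = 0
  Lbar_mul_inv : dmul Lbar LbarInv = dLambda 0
  inv_mul_Lbar : dmul LbarInv Lbar = dLambda 0
  L_t : ∀ k, dderiv (Sum.inl k) L = dcomm (opB L k) L
  L_tbar : ∀ k, dderiv (Sum.inr k) L = dcomm (opBbar LbarInv k) L
  Lbar_t : ∀ k, dderiv (Sum.inl k) Lbar = dcomm (opB L k) Lbar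
  Lbar_tbar : ∀ k, dderiv (Sum.inr k) Lbar = dcomm (opBbar LbarInv k) Lbar

/-- `f(t - [w], t̄)`, `[w] = (w, w²/2, …, w^k/k, …)`, as a power series in `t`, `t̄` and the
extra variable `w` (labelled by `none`). -/
def shiftT (f : TSeries) : MvPowerSeries (Option Time) ℂ :=
  MvPowerSeries.subst (fun i : Time => match i with
    | Sum.inl k => (MvPowerSeries.X (some (Sum.inl k)) : MvPowerSeries (Option Time) ℂ) -
        (((k : ℕ) : ℂ)⁻¹) • MvPowerSeries.X none ^ (k : ℕ)
    | Sum.inr k => MvPowerSeries.X (some (Sum.inr k))) f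

/-- `f(t, t̄ - [w])` as a power series in `t`, `t̄` and the extra variable `w`. -/
def shiftTbar (f : TSeries) : MvPowerSeries (Option Time) ℂ :=
  MvPowerSeries.subst (fun i : Time => match i with
    | Sum.inl k => (MvPowerSeries.X (some (Sum.inl k)) : MvPowerSeries (Option Time) ℂ)
    | Sum.inr k => MvPowerSeries.X (some (Sum.inr k)) -
        (((k : ℕ) : ℂ)⁻¹) • MvPowerSeries.X none ^ (k : ℕ)) f

/-- The coefficient of `w^n`, a power series in `t` and `t̄`. -/
def wCoeff (n : ℕ) (g : MvPowerSeries (Option Time) ℂ) : TSeries := fun d =>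
  MvPowerSeries.coeff (d.embDomain Function.Embedding.some + Finsupp.single none n) g

/-- The dressing operator `W = 1 + ∑_{n ≥ 1} w_n Λ^{-n}` given by
`T(s-1, t-[z⁻¹], t̄) / T(s-1, t, t̄) = 1 + ∑_{n ≥ 1} w_n z^{-n}`. -/
def dressW (T : ℤ → TSeries) : DiffOp := fun n s =>
  if n ≤ 0 then wCoeff (-n).toNat (shiftT (T (s - 1))) * (T (s - 1))⁻¹ else 0

/-- The dressing operator `W̄ = ∑_{n ≥ 0} w̄_n Λ^n` given by
`T(s, t, t̄-[z]) / T(s-1, t, t̄) = ∑_{n ≥ 0} w̄_n z^n`. -/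
def dressWbar (T : ℤ → TSeries) : DiffOp := fun n s =>
  if 0 ≤ n then wCoeff n.toNat (shiftTbar (T s)) * (T (s - 1))⁻¹ else 0

/-- `T` is a tau function of the 2D Toda hierarchy: the dressing operators `W`, `W̄` read off from
quotients of shifts of `T` (all of whose values have to be invertible power series) are invertible,
they satisfy the evolution equations of the 2D Toda hierarchy, and the operators `L = W Λ W⁻¹`,
`L̄ = W̄ Λ W̄⁻¹` satisfy its Lax equations. -/
def IsTodaTau (T : ℤ → TSeries) : Prop :=
  (∀ s, IsUnit (T s)) ∧
  ∃ Winv WbarInv : DiffOp,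
    (∀ n s, 0 < n → Winv n s = 0) ∧ (∀ n s, n < 0 → WbarInv n s = 0) ∧
    dmul (dressW T) Winv = dLambda 0 ∧ dmul Winv (dressW T) = dLambda 0 ∧
    dmul (dressWbar T) WbarInv = dLambda 0 ∧ dmul WbarInv (dressWbar T) = dLambda 0 ∧
    let L := dmul (dmul (dressW T) (dLambda 1)) Winv
    let Lbar := dmul (dmul (dressWbar T) (dLambda 1)) WbarInv
    let LbarInv := dmul (dmul (dressWbar T) (dLambda (-1))) WbarInv
    (∀ k : ℕ+,
      dderiv (Sum.inl k) (dressW T) =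
        dmul (opB L k) (dressW T) - dmul (dressW T) (dLambda k) ∧
      dderiv (Sum.inr k) (dressW T) = dmul (opBbar LbarInv k) (dressW T) ∧
      dderiv (Sum.inl k) (dressWbar T) = dmul (opB L k) (dressWbar T) ∧
      dderiv (Sum.inr k) (dressWbar T) =
        dmul (opBbar LbarInv k) (dressWbar T) - dmul (dressWbar T) (dLambda (-(k : ℤ)))) ∧
    IsTodaLax L Lbar LbarInv

end CubicHodge

end

/-!
The fermions act on finite combinations of Maya diagrams, where filling or emptying a site is a
toggle with a sign. A combination `∑ p_k J_k` of the currents with `k ≥ 1` is locally nilpotent,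
and its exponential multiplies the fermion fields `∑ ψ_{-j} z^j` and `∑ ψ*_j z^{-j}` by the mutually
inverse power series `exp (± ∑ p_k z^k)` (`currentExp_create`, `currentExp_annih`).

This has two consequences. First, by Wick's theorem the matrix element of the exponential between
`⟨s|` and `|ν, s⟩` is the determinant defining the Schur function `S_ν` (`schur_eq_expOp`). The states
`|ν, s⟩` are eigenvectors of `K`, `L₀`, `J₀`, and the eigenvalue of `K/2 + c L₀ + (c² - c) J₀ / 2` is
that of `K/2` with `s` replaced by `s + c`, up to a constant (`shiftedKWeight_state`). As `Γ₋ Γ₊`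
commutes with translations of Maya diagrams, the sum over pairs of partitions is the expectation
value with `h(c)` expanded over intermediate states (`tau_eq_fermionicTau`).

Second, the exponentials satisfy the bilinear identity `∑ ψ_{-j} A ⊗ ψ*_j A = ∑ A ψ_{-j} ⊗ A ψ*_j`
(`IsGroupLike`), which is stable under products, transposition and suitable diagonal factors. It
therefore holds for the kernel `G = exp (∑ t_k J_k) h(c) exp (-∑ t̄_k J_{-k})`
(`isTodaKernel_todaMatrix`); the derivatives of `G` in the times insert currents.

The shift by `[z⁻¹]` is characterized by Newton's recursion in the derivatives
(`IsTimeShift.wCoeff_eq`), and the states `ψ*_{s-m}|s⟩` obey the same recursion in the currents. So the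
coefficients of `W` and `W̄` are matrix elements of `G` between ground states with one more fermion
(`IsTodaKernel.dressW_apply`, `IsTodaKernel.dressWbar_apply`). Defining `V` and `V̄` by the other two
factors of the bilinear identity, that identity reads
`W V = W̄ V̄`, `(∂_k W + W Λ^k) V = ∂_k W̄ V̄`, `∂̄_k W V = (∂̄_k W̄ + W̄ Λ^{-k}) V̄`.
In the first equation the left side has powers of `Λ` at most `0` and the right side at least `0`, so
both are the leading term `1`, and `V`, `V̄` are the inverses. Taking the non-negative part of the
second and the negative part of the third identifies both sides with `B_k` and `B̄_k`, which are the
evolution equations of the dressing operators (`IsTodaKernel.evolution`). The Lax equations follow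
by conjugation (`deriv_conj`).
-/

noncomputable section

namespace CubicHodge

open Filter

/-! ### Toggling a site of a Maya diagram -/

theorem isMaya_toggle (S : Maya) (j : ℤ) : IsMaya (symmDiff S.1 {j}) := by
  refine ⟨(S.2.1.union (Set.finite_singleton j)).subset ?_,
    (S.2.2.union (Set.finite_singleton j)).subset ?_⟩
  · rintro n ⟨hn, h0⟩
    rcases hn with hn | hn
    · exact Or.inl ⟨hn.1, h0⟩
    · exact Or.inr hn.1
  · rintro n ⟨hn, h0⟩
    by_cases hj : n = j
    · exact Or.inr hj
    · refine Or.inl ⟨fun h => hn (Or.inl ⟨h, hj⟩), h0⟩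

/-- Fill the site `j` of a Maya diagram if it is empty, and empty it if it is filled. -/
def toggle (S : Maya) (j : ℤ) : Maya := ⟨symmDiff S.1 {j}, isMaya_toggle S j⟩

theorem mem_toggle {S : Maya} {j n : ℤ} :
    n ∈ (toggle S j).1 ↔ (n ∈ S.1 ∧ n ≠ j) ∨ (n = j ∧ n ∉ S.1) := Iff.rfl

theorem mem_toggle_self {S : Maya} {j : ℤ} : j ∈ (toggle S j).1 ↔ j ∉ S.1 := by
  simp [mem_toggle]

theorem mem_toggle_of_ne {S : Maya} {j n : ℤ} (h : n ≠ j) : n ∈ (toggle S j).1 ↔ n ∈ S.1 := by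
  simp [mem_toggle, h]

theorem Maya.ext_mem {S T : Maya} (h : ∀ n, n ∈ S.1 ↔ n ∈ T.1) : S = T :=
  Subtype.ext (Set.ext h)

@[simp] theorem toggle_toggle (S : Maya) (j : ℤ) : toggle (toggle S j) j = S :=
  Subtype.ext (symmDiff_symmDiff_cancel_right _ _)

theorem toggle_comm (S : Maya) (i j : ℤ) : toggle (toggle S i) j = toggle (toggle S j) i :=
  Subtype.ext (symmDiff_right_comm _ _ _)

theorem Maya.bddAbove (S : Maya) : ∃ N : ℤ, ∀ n ∈ S.1, n ≤ N := by
  obtain ⟨N, hN⟩ := S.2.1.bddAbove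
  refine ⟨max N 0, fun n hn => ?_⟩
  by_cases h : 0 < n
  · exact le_max_of_le_left (hN ⟨hn, h⟩)
  · exact le_max_of_le_right (not_lt.1 h)

theorem Maya.exists_Iic_subset (S : Maya) : ∃ N : ℤ, ∀ n ≤ N, n ∈ S.1 := by
  obtain ⟨N, hN⟩ := S.2.2.bddBelow
  refine ⟨min (N - 1) 0, fun n hn => ?_⟩
  by_contra h
  have := hN ⟨h, hn.trans (min_le_right _ _)⟩
  have := hn.trans (min_le_left _ _)
  omega

theorem Maya.finite_gt (S : Maya) (j : ℤ) : {m | m ∈ S.1 ∧ j < m}.Finite := by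
  obtain ⟨N, hN⟩ := S.bddAbove
  exact (Set.finite_Ioc j N).subset fun m hm => ⟨hm.2, hN m hm.1⟩

/-- The integer version of `fermiSign`. -/
def fsign (S : Maya) (j : ℤ) : ℤ := (-1) ^ {m | m ∈ S.1 ∧ j < m}.ncard

theorem fsign_mul_self (S : Maya) (j : ℤ) : fsign S j * fsign S j = 1 := by
  rw [fsign, ← mul_pow]; simp

theorem fsign_toggle_of_le {S : Maya} {i j : ℤ} (h : i ≤ j) : fsign (toggle S i) j = fsign S j := by
  unfold fsign
  congr 2
  ext m
  simp only [Set.mem_ofPred_eq, and_congr_left_iff]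
  intro hm
  exact mem_toggle_of_ne (by omega)

theorem fsign_toggle_of_lt {S : Maya} {i j : ℤ} (h : j < i) :
    fsign (toggle S i) j = -fsign S j := by
  unfold fsign
  have key : ∀ T : Maya, i ∉ T.1 → {m | m ∈ (toggle T i).1 ∧ j < m}.ncard =
      {m | m ∈ T.1 ∧ j < m}.ncard + 1 := by
    intro T hi
    rw [← Set.ncard_insert_of_notMem (a := i) (fun h => hi h.1) (T.finite_gt j)]
    congr 1
    ext m
    by_cases hm : m = i
    · simp [hm, mem_toggle_self, hi, h]
    · simp [mem_toggle_of_ne hm, hm]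
  by_cases hi : i ∈ S.1
  · have := key (toggle S i) (by simpa [mem_toggle_self] using hi)
    rw [toggle_toggle] at this
    rw [this, pow_succ]; ring
  · rw [key S hi, pow_succ]; ring

/-! ### The fermions as operators on finite combinations of basis states -/

open Classical in
/-- The coefficient of `ψ` creating the site `j` in the state `S`. -/
def createCoeff (S : Maya) (j : ℤ) : ℤ := if j ∈ S.1 then 0 else fsign S j

open Classical in
/-- The coefficient of `ψ*` annihilating the site `j` in the state `S`. -/
def annihCoeff (S : Maya) (j : ℤ) : ℤ := if j ∈ S.1 then fsign S j else 0

theorem createCoeff_toggle_self (S : Maya) (j : ℤ) :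
    createCoeff (toggle S j) j = annihCoeff S j := by
  unfold createCoeff annihCoeff
  rw [fsign_toggle_of_le le_rfl]
  by_cases h : j ∈ S.1 <;> simp [mem_toggle_self, h]

theorem annihCoeff_toggle_self (S : Maya) (j : ℤ) :
    annihCoeff (toggle S j) j = createCoeff S j := by
  rw [← createCoeff_toggle_self, toggle_toggle]

theorem createCoeff_toggle_of_lt {S : Maya} {i j : ℤ} (h : j < i) :
    createCoeff (toggle S i) j = -createCoeff S j := by
  unfold createCoeff
  rw [fsign_toggle_of_lt h]
  by_cases hj : j ∈ S.1 <;> simp [mem_toggle_of_ne h.ne, hj]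

theorem createCoeff_toggle_of_gt {S : Maya} {i j : ℤ} (h : i < j) :
    createCoeff (toggle S i) j = createCoeff S j := by
  unfold createCoeff
  rw [fsign_toggle_of_le h.le]
  by_cases hj : j ∈ S.1 <;> simp [mem_toggle_of_ne h.ne', hj]

theorem annihCoeff_toggle_of_lt {S : Maya} {i j : ℤ} (h : j < i) :
    annihCoeff (toggle S i) j = -annihCoeff S j := by
  rw [← createCoeff_toggle_self, ← createCoeff_toggle_self, toggle_comm,
    createCoeff_toggle_of_lt h]

theorem annihCoeff_toggle_of_gt {S : Maya} {i j : ℤ} (h : i < j) :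
    annihCoeff (toggle S i) j = annihCoeff S j := by
  rw [← createCoeff_toggle_self, ← createCoeff_toggle_self, toggle_comm,
    createCoeff_toggle_of_gt h]

theorem createCoeff_of_mem {S : Maya} {j : ℤ} (h : j ∈ S.1) : createCoeff S j = 0 := by
  simp [createCoeff, h]

theorem createCoeff_of_notMem {S : Maya} {j : ℤ} (h : j ∉ S.1) :
    createCoeff S j = fsign S j := by
  simp [createCoeff, h]

theorem annihCoeff_of_mem {S : Maya} {j : ℤ} (h : j ∈ S.1) : annihCoeff S j = fsign S j := by
  simp [annihCoeff, h]

theorem annihCoeff_of_notMem {S : Maya} {j : ℤ} (h : j ∉ S.1) : annihCoeff S j = 0 := by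
  simp [annihCoeff, h]

/-- Finite combinations of basis states with coefficients in `R`. -/
abbrev Fock (R : Type) [CommRing R] : Type := Maya →₀ R

section Fermions

variable (R : Type) [CommRing R]

/-- The basis state labelled by a Maya diagram. -/
abbrev ket (S : Maya) : Fock R := Finsupp.single S 1

/-- The fermion that fills the site `j`, i.e. `ψ_{-j}`. -/
def create (j : ℤ) : Fock R →ₗ[R] Fock R :=
  Finsupp.linearCombination R fun S => Finsupp.single (toggle S j) ((createCoeff S j : ℤ) : R)

/-- The fermion that empties the site `j`, i.e. `ψ*_j`. -/
def annih (j : ℤ) : Fock R →ₗ[R] Fock R :=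
  Finsupp.linearCombination R fun S => Finsupp.single (toggle S j) ((annihCoeff S j : ℤ) : R)

variable {R}

theorem create_single (j : ℤ) (S : Maya) (r : R) :
    create R j (Finsupp.single S r) = Finsupp.single (toggle S j) (r * (createCoeff S j : ℤ)) := by
  simp [create, Finsupp.linearCombination_single]

theorem annih_single (j : ℤ) (S : Maya) (r : R) :
    annih R j (Finsupp.single S r) = Finsupp.single (toggle S j) (r * (annihCoeff S j : ℤ)) := by
  simp [annih, Finsupp.linearCombination_single]

theorem create_apply (j : ℤ) (v : Fock R) (S : Maya) :
    create R j v S = (annihCoeff S j : ℤ) * v (toggle S j) := by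
  induction v using Finsupp.induction_linear with
  | zero => simp
  | add v w hv hw => simp [hv, hw, mul_add]
  | single T r =>
    classical
    rw [create_single, Finsupp.single_apply, Finsupp.single_apply]
    by_cases h : T = toggle S j
    · subst h; simp [createCoeff_toggle_self, mul_comm]
    · rw [if_neg h, if_neg, mul_zero]
      rintro rfl; simp at h

theorem annih_apply (j : ℤ) (v : Fock R) (S : Maya) :
    annih R j v S = (createCoeff S j : ℤ) * v (toggle S j) := by
  induction v using Finsupp.induction_linear with
  | zero => simp
  | add v w hv hw => simp [hv, hw, mul_add]
  | single T r =>
    classical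
    rw [annih_single, Finsupp.single_apply, Finsupp.single_apply]
    by_cases h : T = toggle S j
    · subst h; simp [annihCoeff_toggle_self, mul_comm]
    · rw [if_neg h, if_neg, mul_zero]
      rintro rfl; simp at h

theorem Fock.hom_ext {M : Type*} [AddCommGroup M] [Module R M] {f g : Fock R →ₗ[R] M}
    (h : ∀ S, f (ket R S) = g (ket R S)) : f = g :=
  Finsupp.lhom_ext' fun S => LinearMap.ext_ring (h S)

theorem create_create (i j : ℤ) (v : Fock R) :
    create R i (create R j v) = -create R j (create R i v) := by
  suffices h : create R i ∘ₗ create R j = -(create R j ∘ₗ create R i) from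
    LinearMap.congr_fun h v
  refine Fock.hom_ext fun S => ?_
  simp only [LinearMap.comp_apply, LinearMap.neg_apply, create_single, one_mul,
    toggle_comm S j i, ← Finsupp.single_neg]
  congr 1
  rcases lt_trichotomy i j with h | rfl | h
  · rw [createCoeff_toggle_of_lt h, createCoeff_toggle_of_gt h]; push_cast; ring
  · rw [createCoeff_toggle_self]
    by_cases hi : i ∈ S.1 <;> simp [createCoeff, annihCoeff, hi]
  · rw [createCoeff_toggle_of_lt h, createCoeff_toggle_of_gt h]; push_cast; ring

theorem annih_annih (i j : ℤ) (v : Fock R) :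
    annih R i (annih R j v) = -annih R j (annih R i v) := by
  suffices h : annih R i ∘ₗ annih R j = -(annih R j ∘ₗ annih R i) from
    LinearMap.congr_fun h v
  refine Fock.hom_ext fun S => ?_
  simp only [LinearMap.comp_apply, LinearMap.neg_apply, annih_single, one_mul,
    toggle_comm S j i, ← Finsupp.single_neg]
  congr 1
  rcases lt_trichotomy i j with h | rfl | h
  · rw [annihCoeff_toggle_of_lt h, annihCoeff_toggle_of_gt h]; push_cast; ring
  · rw [annihCoeff_toggle_self]
    by_cases hi : i ∈ S.1 <;> simp [createCoeff, annihCoeff, hi]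
  · rw [annihCoeff_toggle_of_lt h, annihCoeff_toggle_of_gt h]; push_cast; ring

theorem annih_create (i j : ℤ) (v : Fock R) :
    annih R i (create R j v) = (if i = j then v else 0) - create R j (annih R i v) := by
  suffices h : annih R i ∘ₗ create R j =
      (if i = j then LinearMap.id else 0) - (create R j ∘ₗ annih R i) by
    have := LinearMap.congr_fun h v
    simp only [LinearMap.comp_apply, LinearMap.sub_apply] at this
    rw [this]; split_ifs <;> rfl
  refine Fock.hom_ext fun S => ?_
  simp only [LinearMap.comp_apply, LinearMap.sub_apply, annih_single, create_single, one_mul,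
    toggle_comm S j i]
  rcases lt_trichotomy i j with h | rfl | h
  · rw [annihCoeff_toggle_of_lt h, createCoeff_toggle_of_gt h, if_neg h.ne, LinearMap.zero_apply,
      zero_sub, ← Finsupp.single_neg]
    congr 1; push_cast; ring
  · rw [annihCoeff_toggle_self, createCoeff_toggle_self, if_pos rfl, toggle_toggle,
      LinearMap.id_apply, ← Finsupp.single_sub]
    congr 1
    have := congrArg (Int.cast (R := R)) (fsign_mul_self S i)
    by_cases hi : i ∈ S.1 <;> simp_all [createCoeff, annihCoeff]
  · rw [annihCoeff_toggle_of_gt h, createCoeff_toggle_of_lt h, if_neg h.ne', LinearMap.zero_apply,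
      zero_sub, ← Finsupp.single_neg]
    congr 1; push_cast; ring

theorem create_annih (i j : ℤ) (v : Fock R) :
    create R i (annih R j v) = (if j = i then v else 0) - annih R j (create R i v) := by
  rw [annih_create]; abel

theorem create_eq_zero_of_small (v : Fock R) : ∃ M : ℤ, ∀ j < M, create R j v = 0 := by
  induction v using Finsupp.induction_linear with
  | zero => exact ⟨0, by simp⟩
  | add v w hv hw =>
    obtain ⟨M, hM⟩ := hv
    obtain ⟨N, hN⟩ := hw
    refine ⟨min M N, fun j hj => ?_⟩
    rw [map_add, hM j (hj.trans_le (min_le_left _ _)), hN j (hj.trans_le (min_le_right _ _)),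
      add_zero]
  | single S r =>
    obtain ⟨M, hM⟩ := S.exists_Iic_subset
    exact ⟨M, fun j hj => by simp [create_single, createCoeff_of_mem (hM j hj.le)]⟩

theorem annih_eq_zero_of_large (v : Fock R) : ∃ M : ℤ, ∀ j > M, annih R j v = 0 := by
  induction v using Finsupp.induction_linear with
  | zero => exact ⟨0, by simp⟩
  | add v w hv hw =>
    obtain ⟨M, hM⟩ := hv
    obtain ⟨N, hN⟩ := hw
    refine ⟨max M N, fun j hj => ?_⟩
    rw [map_add, hM j ((le_max_left _ _).trans_lt hj), hN j ((le_max_right _ _).trans_lt hj),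
      add_zero]
  | single S r =>
    obtain ⟨M, hM⟩ := S.bddAbove
    refine ⟨M, fun j hj => ?_⟩
    rw [annih_single, annihCoeff_of_notMem fun h => absurd (hM j h) (not_le.2 hj)]
    simp

end Fermions

/-! ### Additive statistics of Maya diagrams -/

section Weight

variable {M : Type*} [AddCommGroup M]

open Classical in
/-- The normal ordered occupation number of the site `n`: the eigenvalue of `:ψ_{-n} ψ*_n:`. -/
def occ (S : Maya) (n : ℤ) : ℤ := if n ∈ S.1 then (if 0 < n then 1 else 0) else
  (if 0 < n then 0 else -1)

theorem finite_occ (S : Maya) : (Function.support (occ S)).Finite := by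
  refine (S.2.1.union S.2.2).subset fun n hn => ?_
  rw [Function.mem_support] at hn
  unfold occ at hn
  by_cases h : n ∈ S.1 <;> by_cases h0 : 0 < n <;> simp [h, h0] at hn ⊢
  omega

/-- The eigenvalue `∑ a_n` over particles minus `∑ a_n` over holes of the operator
`∑ a_n :ψ_{-n} ψ*_n:` on the state `S`. -/
def weight (a : ℤ → M) (S : Maya) : M := ∑ᶠ n, occ S n • a n

theorem weight_toggle (a : ℤ → M) (S : Maya) (j : ℤ) :
    weight a (toggle S j) = weight a S + (fsign S j * (createCoeff S j - annihCoeff S j)) • a j := by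
  classical
  have h1 : ∀ T : Maya, ∀ B : Finset ℤ, (finite_occ T).toFinset ⊆ B →
      weight a T = ∑ n ∈ B, occ T n • a n := by
    intro T B hB
    refine finsum_eq_sum_of_support_subset _ fun n hn => ?_
    refine hB ?_
    simp only [Set.Finite.mem_toFinset, Function.mem_support] at hn ⊢
    exact fun h => hn (by simp [h])
  have hs := fsign_mul_self S j
  set B := insert j ((finite_occ S).toFinset ∪ (finite_occ (toggle S j)).toFinset) with hB
  rw [h1 S B (by intro x hx; simp only [hB, Finset.mem_insert, Finset.mem_union]; tauto),
    h1 (toggle S j) B (by intro x hx; simp only [hB, Finset.mem_insert, Finset.mem_union]; tauto)]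
  have hj : j ∈ B := Finset.mem_insert_self _ _
  rw [← Finset.add_sum_erase _ _ hj, ← Finset.add_sum_erase B (fun n => occ S n • a n) hj]
  rw [Finset.sum_congr rfl (g := fun n => occ S n • a n), add_right_comm, ← add_smul]
  · congr 2
    unfold occ createCoeff annihCoeff
    by_cases h : j ∈ S.1 <;> by_cases h0 : 0 < j <;> simp [mem_toggle_self, h, h0, hs]
  · intro n hn
    have hne := Finset.ne_of_mem_erase hn
    simp [occ, mem_toggle_of_ne hne]

theorem weight_toggle_of_notMem (a : ℤ → M) {S : Maya} {j : ℤ} (h : j ∉ S.1) :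
    weight a (toggle S j) = weight a S + a j := by
  rw [weight_toggle, createCoeff_of_notMem h, annihCoeff_of_notMem h, sub_zero, fsign_mul_self,
    one_smul]

theorem weight_toggle_of_mem (a : ℤ → M) {S : Maya} {j : ℤ} (h : j ∈ S.1) :
    weight a (toggle S j) = weight a S - a j := by
  rw [weight_toggle, createCoeff_of_mem h, annihCoeff_of_mem h, zero_sub, mul_neg, fsign_mul_self,
    neg_one_smul, sub_eq_add_neg]

end Weight

/-- The energy of a state, the eigenvalue of `L₀`. -/
def energy (S : Maya) : ℤ := weight (fun n => n) S

/-- The charge of a state. -/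
def charge (S : Maya) : ℤ := weight (fun _ => (1 : ℤ)) S

theorem energy_nonneg (S : Maya) : 0 ≤ energy S := by
  refine finsum_nonneg fun n => ?_
  unfold occ
  by_cases h : n ∈ S.1 <;> by_cases h0 : 0 < n <;> simp [h, h0]
  · omega
  · omega

/-! ### Currents -/

section Current

variable (R : Type) [CommRing R]

theorem finite_hop (S : Maya) {k : ℤ} (hk : k ≠ 0) :
    (Function.support fun n => create R n (annih R (n + k) (ket R S))).Finite := by
  obtain ⟨N, hN⟩ := S.bddAbove
  obtain ⟨M, hM⟩ := S.exists_Iic_subset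
  refine (Set.finite_Icc M (N - k)).subset fun n hn => ?_
  rw [Function.mem_support] at hn
  by_contra h
  apply hn
  rw [Set.mem_Icc, not_and_or, not_le, not_le] at h
  rw [annih_single, create_single]
  rcases h with h | h
  · rw [createCoeff_of_mem]; · simp
    rw [mem_toggle_of_ne (by omega)]
    exact hM n h.le
  · rw [annihCoeff_of_notMem]; · simp
    intro hmem
    have := hN _ hmem
    omega

/-- The current `J_k = ∑ ψ_{-n} ψ*_{n+k}`, `k ≠ 0`, as an operator on finite combinations of basis
states. -/
def current (k : ℤ) : Fock R →ₗ[R] Fock R :=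
  Finsupp.linearCombination R fun S => ∑ᶠ n, create R n (annih R (n + k) (ket R S))

variable {R}

theorem current_eventually {k : ℤ} (hk : k ≠ 0) (v : Fock R) :
    ∀ᶠ B : Finset ℤ in atTop, current R k v = ∑ n ∈ B, create R n (annih R (n + k) v) := by
  induction v using Finsupp.induction_linear with
  | zero => simp
  | add v w hv hw =>
    filter_upwards [hv, hw] with B h1 h2
    simp [h1, h2, Finset.sum_add_distrib]
  | single S r =>
    filter_upwards [eventually_ge_atTop (finite_hop R S hk).toFinset] with B hB
    have hr : (Finsupp.single S r : Fock R) = r • ket R S := by simp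
    rw [hr, map_smul]
    simp only [map_smul]
    rw [← Finset.smul_sum]
    congr 1
    simp only [current, Finsupp.linearCombination_single, one_smul]
    refine finsum_eq_sum_of_support_subset _ fun n hn => ?_
    exact hB (by simpa using hn)

/-- The commutator of `J_k` with `ψ_{-j}` is `ψ_{-(j-k)}`. The exchange of the currents and the
fermions is exact because all sums act on a given vector as sums over one large finite set. -/
theorem current_create {k : ℤ} (hk : k ≠ 0) (j : ℤ) (v : Fock R) :
    current R k (create R j v) = create R j (current R k v) + create R (j - k) v := by
  obtain ⟨B, h1, h2, hB⟩ := ((current_eventually hk (create R j v)).and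
    ((current_eventually hk v).and (eventually_ge_atTop {j - k}))).exists
  rw [h1, h2, map_sum]
  have hj : j - k ∈ B := hB (by simp)
  have : create R (j - k) v = ∑ n ∈ B, if n = j - k then create R n v else 0 := by
    rw [Finset.sum_ite_eq' B, if_pos hj]
  rw [this, ← Finset.sum_add_distrib]
  refine Finset.sum_congr rfl fun n _ => ?_
  rw [annih_create, map_sub, create_create j n]
  by_cases h : n = j - k
  · rw [if_pos h, if_pos (by omega)]; abel
  · rw [if_neg h, if_neg (by omega), map_zero]; abel

/-- The commutator of `J_k` with `ψ*_j` is `-ψ*_{j+k}`. -/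
theorem current_annih {k : ℤ} (hk : k ≠ 0) (j : ℤ) (v : Fock R) :
    current R k (annih R j v) = annih R j (current R k v) - annih R (j + k) v := by
  obtain ⟨B, h1, h2, hB⟩ := ((current_eventually hk (annih R j v)).and
    ((current_eventually hk v).and (eventually_ge_atTop {j}))).exists
  rw [h1, h2, map_sum]
  have hj : j ∈ B := hB (by simp)
  have : annih R (j + k) v = ∑ n ∈ B, if n = j then annih R (n + k) v else 0 := by
    rw [Finset.sum_ite_eq' B, if_pos hj]
  rw [this, ← Finset.sum_sub_distrib]
  refine Finset.sum_congr rfl fun n _ => ?_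
  rw [annih_create j n, annih_annih]
  by_cases h : n = j
  · rw [if_pos h, if_pos h.symm, map_neg]; abel
  · rw [if_neg h, if_neg (Ne.symm h), map_neg]; abel

theorem create_annih_apply_ket (i j : ℤ) (S T : Maya) :
    create R i (annih R j (ket R S)) T = create R j (annih R i (ket R T)) S := by
  classical
  rw [annih_single, annih_single, create_single, create_single, one_mul, one_mul]
  rw [Finsupp.single_apply, Finsupp.single_apply]
  by_cases h : toggle (toggle S j) i = T
  · rw [if_pos h, if_pos, ← h, toggle_toggle, createCoeff_toggle_self, annihCoeff_toggle_self]
    · ring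
    · rw [← h, toggle_toggle, toggle_toggle]
  · rw [if_neg h, if_neg]
    rintro rfl
    simp at h

theorem current_transpose {k : ℤ} (hk : k ≠ 0) (S T : Maya) :
    current R k (ket R S) T = current R (-k) (ket R T) S := by
  simp only [current, Finsupp.linearCombination_single, one_smul]
  rw [finsum_eq_sum _ (finite_hop R S hk), finsum_eq_sum _ (finite_hop R T (neg_ne_zero.2 hk)),
    Finsupp.finsetSum_apply, Finsupp.finsetSum_apply]
  have e1 : ∀ n, n ∉ (finite_hop R S hk).toFinset →
      create R n (annih R (n + k) (ket R S)) T = 0 := by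
    intro n hn
    simp only [Set.Finite.mem_toFinset, Function.mem_support, not_not] at hn
    rw [hn]; rfl
  have e2 : ∀ n, n ∉ (finite_hop R T (neg_ne_zero.2 hk)).toFinset →
      create R n (annih R (n + -k) (ket R T)) S = 0 := by
    intro n hn
    simp only [Set.Finite.mem_toFinset, Function.mem_support, not_not] at hn
    rw [hn]; rfl
  rw [← finsum_eq_sum_of_support_subset (f := fun n => create R n (annih R (n + k) (ket R S)) T),
    ← finsum_eq_sum_of_support_subset (f := fun n => create R n (annih R (n + -k) (ket R T)) S)]
  · rw [← finsum_comp_equiv (Equiv.addRight k)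
      (f := fun n => create R n (annih R (n + -k) (ket R T)) S)]
    refine finsum_congr fun n => ?_
    rw [create_annih_apply_ket]
    simp
  · intro n hn; by_contra h; exact hn (e2 n h)
  · intro n hn; by_contra h; exact hn (e1 n h)

/-- The current `J_k` lowers the energy by `k` and preserves the charge. -/
theorem weight_of_current_ne_zero {k : ℤ} {S T : Maya}
    (h : current R k (ket R S) T ≠ 0) : energy T = energy S - k ∧ charge T = charge S := by
  classical
  simp only [current, Finsupp.linearCombination_single, one_smul] at h
  by_cases hf : (Function.support fun n => create R n (annih R (n + k) (ket R S))).Finite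
  · rw [finsum_eq_sum _ hf, Finsupp.finsetSum_apply] at h
    obtain ⟨n, -, hn⟩ := Finset.exists_ne_zero_of_sum_ne_zero h
    rw [annih_single, create_single, Finsupp.single_apply] at hn
    have hT : toggle (toggle S (n + k)) n = T := by
      by_contra h'
      exact hn (if_neg h')
    rw [if_pos hT] at hn
    have h1 : n + k ∈ S.1 := by
      by_contra h'; rw [annihCoeff_of_notMem h'] at hn; simp at hn
    have h2 : n ∉ (toggle S (n + k)).1 := by
      intro h'; rw [createCoeff_of_mem h'] at hn; simp at hn
    unfold energy charge
    rw [← hT, weight_toggle_of_notMem _ h2, weight_toggle_of_mem _ h1, weight_toggle_of_notMem _ h2,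
      weight_toggle_of_mem _ h1]
    constructor <;> ring
  · rw [finsum_of_infinite_support hf] at h
    exact absurd rfl h

end Current

/-! ### Ground states generate the Fock space -/

theorem rowLen_bot (i : ℕ) : (⊥ : YoungDiagram).rowLen i = 0 := by
  by_contra h
  exact YoungDiagram.notMem_bot _ (YoungDiagram.mem_iff_lt_rowLen.2 (Nat.pos_of_ne_zero h))

theorem mem_ground {s n : ℤ} : n ∈ (ground s).1 ↔ n ≤ s := by
  change n ∈ Set.range (fun i : ℕ => ((⊥ : YoungDiagram).rowLen i : ℤ) - i + s) ↔ _
  simp only [rowLen_bot, Set.mem_range]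
  constructor
  · rintro ⟨i, rfl⟩; push_cast; omega
  · intro h; exact ⟨(s - n).toNat, by omega⟩

/-- Every Maya diagram arises from a ground state by filling sites from below. -/
theorem Maya.induction_top {p : Maya → Prop} (h0 : ∀ N, p (ground N))
    (h1 : ∀ S j, (∀ n ∈ S.1, n < j) → p S → p (toggle S j)) (S : Maya) : p S := by
  obtain ⟨N, hN⟩ := S.exists_Iic_subset
  induction hc : {m | m ∈ S.1 ∧ N < m}.ncard generalizing S with
  | zero =>
    rw [Set.ncard_eq_zero (S.finite_gt N)] at hc
    have : S = ground N := Maya.ext_mem fun n => by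
      rw [mem_ground]
      refine ⟨fun h => ?_, hN n⟩
      by_contra hlt
      exact (Set.eq_empty_iff_forall_notMem.1 hc n) ⟨h, not_le.1 hlt⟩
    rw [this]; exact h0 N
  | succ c ih =>
    have hne : {m | m ∈ S.1 ∧ N < m}.Nonempty := by
      rw [← Set.ncard_pos (S.finite_gt N)]; omega
    obtain ⟨j, ⟨hj, hNj⟩, hmax⟩ := Set.exists_max_image _ id (S.finite_gt N) hne
    have hlt : ∀ n ∈ (toggle S j).1, n < j := by
      intro n hn
      rcases mem_toggle.1 hn with ⟨h, hnj⟩ | ⟨rfl, h⟩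
      · by_cases hNn : N < n
        · exact lt_of_le_of_ne (hmax n ⟨h, hNn⟩) hnj
        · omega
      · exact absurd hj h
    have hS := h1 (toggle S j) j hlt
    rw [toggle_toggle] at hS
    refine hS (ih _ (fun n hn => ?_) ?_)
    · rw [mem_toggle_of_ne (by omega)]; exact hN n hn
    · have : {m | m ∈ (toggle S j).1 ∧ N < m} = {m | m ∈ S.1 ∧ N < m} \ {j} := by
        ext m
        by_cases hm : m = j
        · simp [hm, mem_toggle_self, hj]
        · simp [mem_toggle_of_ne hm, hm]
      rw [this, Set.ncard_sdiff_singleton_of_mem (by exact ⟨hj, hNj⟩), hc]; rfl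

theorem fsign_of_top {S : Maya} {j : ℤ} (h : ∀ n ∈ S.1, n ≤ j) : fsign S j = 1 := by
  have : {m | m ∈ S.1 ∧ j < m} = ∅ := by
    ext m
    simp only [Set.mem_ofPred_eq, Set.mem_empty_iff_false, iff_false, not_and, not_lt]
    exact h m
  rw [fsign, this]; simp

section

variable (R : Type) [CommRing R]

theorem ket_toggle_top {S : Maya} {j : ℤ} (h : ∀ n ∈ S.1, n < j) :
    ket R (toggle S j) = create R j (ket R S) := by
  rw [create_single, createCoeff_of_notMem fun hj => lt_irrefl _ (h j hj),
    fsign_of_top fun n hn => (h n hn).le]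
  simp

variable {R}

/-- A linear map on the Fock space is determined by its values on the ground states and its
behaviour under the creation operators. This reduces the commutativity of the currents to
`current_create`. -/
theorem Fock.hom_ext_of_create {f g : Fock R →ₗ[R] Fock R}
    (h0 : ∀ N, f (ket R (ground N)) = g (ket R (ground N)))
    (h1 : ∀ j v, f v = g v → f (create R j v) = g (create R j v)) : f = g := by
  refine Fock.hom_ext fun S => ?_
  induction S using Maya.induction_top with
  | h0 N => exact h0 N
  | h1 S j hj ih => rw [ket_toggle_top R hj]; exact h1 j _ ih

theorem current_ground {k : ℤ} (hk : 0 < k) (N : ℤ) : current R k (ket R (ground N)) = 0 := by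
  simp only [current, Finsupp.linearCombination_single, one_smul]
  refine finsum_eq_zero_of_forall_eq_zero fun n => ?_
  rw [annih_single, create_single]
  by_cases h : n + k ≤ N
  · rw [createCoeff_of_mem]; · simp
    rw [mem_toggle_of_ne (by omega), mem_ground]; omega
  · rw [annihCoeff_of_notMem]; · simp
    rwa [mem_ground]

theorem current_comm {k l : ℤ} (hk : 0 < k) (hl : 0 < l) (v : Fock R) :
    current R k (current R l v) = current R l (current R k v) := by
  suffices h : current R k ∘ₗ current R l = current R l ∘ₗ current R k from
    LinearMap.congr_fun h v
  refine Fock.hom_ext_of_create (fun N => ?_) fun j v hv => ?_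
  · simp [current_ground hk, current_ground hl]
  · simp only [LinearMap.comp_apply] at hv ⊢
    simp only [current_create hl.ne', current_create hk.ne', map_add, hv]
    rw [sub_right_comm]; abel

/-! ### Positive current combinations are locally nilpotent -/

theorem Fock.map_apply {M : Type*} [AddCommGroup M] [Module R M] (f : Fock R →ₗ[R] M)
    (v : Fock R) : f v = v.sum fun P r => r • f (ket R P) := by
  conv_lhs => rw [← Finsupp.sum_single v]
  rw [Finsupp.sum, map_sum, Finsupp.sum]
  refine Finset.sum_congr rfl fun P _ => ?_
  rw [← map_smul]; simp

theorem Fock.exists_of_map_ne_zero {f : Fock R →ₗ[R] Fock R} {v : Fock R} {T : Maya}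
    (h : f v T ≠ 0) : ∃ P, v P ≠ 0 ∧ f (ket R P) T ≠ 0 := by
  rw [Fock.map_apply, Finsupp.sum, Finsupp.finsetSum_apply] at h
  obtain ⟨P, hP, hne⟩ := Finset.exists_ne_zero_of_sum_ne_zero h
  refine ⟨P, Finsupp.mem_support_iff.1 hP, fun h0 => hne ?_⟩
  simp [h0]

theorem current_ket_eq_zero {k : ℤ} {S : Maya} (h : energy S < k) : current R k (ket R S) = 0 := by
  ext T
  by_contra hT
  have := (weight_of_current_ne_zero hT).1
  have := energy_nonneg T
  omega

/-- The operator `∑_{k ≥ 1} p_k J_k`, where `p_k` are the coefficients of a power series without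
constant term. On a state of energy `E` the sum stops at `k = E`, because `J_k` lowers the energy by
`k` and the energy is nonnegative. -/
def currentSum (p : PowerSeries R) : Fock R →ₗ[R] Fock R :=
  Finsupp.linearCombination R fun S =>
    ∑ k ∈ Finset.range ((energy S).toNat + 1), PowerSeries.coeff k p • current R k (ket R S)

theorem currentSum_eventually (p : PowerSeries R) (v : Fock R) : ∀ᶠ K : ℕ in atTop,
    currentSum p v = ∑ k ∈ Finset.range K, PowerSeries.coeff k p • current R k v := by
  induction v using Finsupp.induction_linear with
  | zero => simp
  | add v w hv hw =>
    filter_upwards [hv, hw] with K h1 h2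
    simp [h1, h2, Finset.sum_add_distrib]
  | single S r =>
    filter_upwards [eventually_ge_atTop ((energy S).toNat + 1)] with K hK
    have hr : (Finsupp.single S r : Fock R) = r • ket R S := by simp
    rw [hr, map_smul]
    simp only [map_smul]
    rw [currentSum, Finsupp.linearCombination_single, one_smul, Finset.smul_sum]
    refine (Finset.sum_subset (Finset.range_subset_range.2 hK) fun k _ hk => ?_).trans ?_
    · rw [Finset.mem_range, not_lt] at hk
      rw [current_ket_eq_zero (by omega), smul_zero, smul_zero]
    · exact Finset.sum_congr rfl fun k _ => smul_comm _ _ _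

variable {p : PowerSeries R}

theorem weight_of_currentSum_ne_zero (hp : PowerSeries.coeff 0 p = 0) {S T : Maya}
    (h : currentSum p (ket R S) T ≠ 0) : energy T < energy S ∧ charge T = charge S := by
  rw [currentSum, Finsupp.linearCombination_single, one_smul, Finsupp.finsetSum_apply] at h
  obtain ⟨k, -, hk⟩ := Finset.exists_ne_zero_of_sum_ne_zero h
  have h0 : k ≠ 0 := by
    rintro rfl
    simp [hp] at hk
  have h1 := weight_of_current_ne_zero (R := R) (k := k) (S := S) (T := T) fun h0 => hk (by simp [h0])
  exact ⟨by have := h1.1; omega, h1.2⟩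

theorem weight_of_currentSum_pow_ne_zero (hp : PowerSeries.coeff 0 p = 0) {S T : Maya} {n : ℕ}
    (h : (currentSum p ^ n) (ket R S) T ≠ 0) : energy T + n ≤ energy S ∧ charge T = charge S := by
  induction n generalizing T with
  | zero =>
    have : S = T := by
      by_contra hST
      exact h (by simp [hST])
    subst this; simp
  | succ n ih =>
    rw [pow_succ', Module.End.mul_apply] at h
    obtain ⟨P, hP, hPT⟩ := Fock.exists_of_map_ne_zero h
    have h1 := ih hP
    have h2 := weight_of_currentSum_ne_zero hp hPT
    exact ⟨by push_cast; omega, h2.2.trans h1.2⟩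

theorem currentSum_pow_eq_zero (hp : PowerSeries.coeff 0 p = 0) (v : Fock R) :
    ∀ᶠ n : ℕ in atTop, (currentSum p ^ n) v = 0 := by
  induction v using Finsupp.induction_linear with
  | zero => simp
  | add v w hv hw => filter_upwards [hv, hw] with k h1 h2; simp [h1, h2]
  | single S r =>
    filter_upwards [eventually_gt_atTop (energy S).toNat] with k hk
    have hr : (Finsupp.single S r : Fock R) = r • ket R S := by simp
    rw [hr, map_smul]
    suffices h : (currentSum p ^ k) (ket R S) = 0 by rw [h, smul_zero]
    ext T
    by_contra hT
    have := (weight_of_currentSum_pow_ne_zero hp hT).1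
    have := energy_nonneg T
    omega

theorem currentSum_pow_ket_eq_zero (hp : PowerSeries.coeff 0 p = 0) {S : Maya} {n : ℕ}
    (h : energy S < n) : (currentSum p ^ n) (ket R S) = 0 := by
  ext T
  by_contra hT
  have := (weight_of_currentSum_pow_ne_zero hp hT).1
  have := energy_nonneg T
  omega

theorem currentSum_ground (hp : PowerSeries.coeff 0 p = 0) (N : ℤ) :
    currentSum p (ket R (ground N)) = 0 := by
  obtain ⟨K, hK⟩ := (currentSum_eventually p (ket R (ground N))).exists
  rw [hK]
  refine Finset.sum_eq_zero fun k _ => ?_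
  rcases Nat.eq_zero_or_pos k with rfl | h
  · rw [hp, zero_smul]
  · rw [current_ground (by exact_mod_cast h), smul_zero]

variable [Algebra ℂ R]

/-- The exponential of `∑_{k ≥ 1} p_k J_k` on finite combinations of basis states. On a state of
energy `E` the powers beyond the `E`-th vanish. -/
def currentExp (p : PowerSeries R) : Fock R →ₗ[R] Fock R :=
  Finsupp.linearCombination R fun S =>
    ∑ n ∈ Finset.range ((energy S).toNat + 1),
      ((n.factorial : ℂ)⁻¹) • (currentSum p ^ n) (ket R S)

theorem currentExp_eventually (hp : PowerSeries.coeff 0 p = 0) (v : Fock R) :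
    ∀ᶠ K : ℕ in atTop, currentExp p v =
      ∑ n ∈ Finset.range K, ((n.factorial : ℂ)⁻¹) • (currentSum p ^ n) v := by
  induction v using Finsupp.induction_linear with
  | zero => simp
  | add v w hv hw =>
    filter_upwards [hv, hw] with K h1 h2
    simp only [map_add, h1, h2, smul_add, Finset.sum_add_distrib]
  | single S r =>
    filter_upwards [eventually_ge_atTop ((energy S).toNat + 1)] with K hK
    have hr : (Finsupp.single S r : Fock R) = r • ket R S := by simp
    rw [hr, map_smul]
    simp only [map_smul]
    rw [currentExp, Finsupp.linearCombination_single, one_smul, Finset.smul_sum]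
    refine (Finset.sum_subset (Finset.range_subset_range.2 hK) fun k _ hk => ?_).trans ?_
    · rw [Finset.mem_range, not_lt] at hk
      rw [currentSum_pow_ket_eq_zero hp (by omega), smul_zero, smul_zero]
    · exact Finset.sum_congr rfl fun k _ => smul_comm _ _ _

theorem weight_of_currentExp_ne_zero (hp : PowerSeries.coeff 0 p = 0) {S T : Maya}
    (h : currentExp p (ket R S) T ≠ 0) : energy T ≤ energy S ∧ charge T = charge S := by
  rw [currentExp, Finsupp.linearCombination_single, one_smul, Finsupp.finsetSum_apply] at h
  obtain ⟨k, -, hk⟩ := Finset.exists_ne_zero_of_sum_ne_zero h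
  have h1 := weight_of_currentSum_pow_ne_zero hp (S := S) (T := T) (n := k) fun h0 => hk (by simp [h0])
  exact ⟨by have := h1.1; omega, h1.2⟩

theorem currentExp_ground (hp : PowerSeries.coeff 0 p = 0) (N : ℤ) :
    currentExp p (ket R (ground N)) = ket R (ground N) := by
  obtain ⟨K, hK, h1⟩ := ((currentExp_eventually hp (ket R (ground N))).and
    (eventually_ge_atTop 1)).exists
  obtain ⟨K, rfl⟩ := Nat.exists_eq_add_of_le' h1
  rw [hK, Finset.sum_range_succ', Finset.sum_eq_zero]
  · simp
  · intro n _
    rw [pow_succ, Module.End.mul_apply, currentSum_ground hp, map_zero, smul_zero]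

end

/-! ### Conjugation of the fermions by exponentials of currents -/

section

variable {R : Type} [CommRing R]

/-- Every vector is killed by `φ_j` for small `j`. -/
def LocallyFiniteBelow (φ : ℤ → Fock R →ₗ[R] Fock R) : Prop :=
  ∀ v, ∃ M : ℤ, ∀ j < M, φ j v = 0

/-- The operator `∑_{k ≥ 0} f_k φ_{j-k}`. -/
def fieldComb (φ : ℤ → Fock R →ₗ[R] Fock R) (f : PowerSeries R) (j : ℤ) (v : Fock R) : Fock R :=
  ∑ᶠ k : ℕ, PowerSeries.coeff k f • φ (j - k) v

variable {φ : ℤ → Fock R →ₗ[R] Fock R}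

theorem LocallyFiniteBelow.eventually (hφ : LocallyFiniteBelow φ) (j : ℤ) (v : Fock R) :
    ∀ᶠ K : ℕ in atTop, ∀ k ≥ K, φ (j - k) v = 0 := by
  obtain ⟨M, hM⟩ := hφ v
  filter_upwards [eventually_gt_atTop (j - M).toNat] with K hK k hk
  exact hM _ (by omega)

theorem fieldComb_eq_sum (f : PowerSeries R) {j : ℤ} {v : Fock R} {K : ℕ}
    (hK : ∀ k ≥ K, φ (j - k) v = 0) :
    fieldComb φ f j v = ∑ k ∈ Finset.range K, PowerSeries.coeff k f • φ (j - k) v := by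
  refine finsum_eq_sum_of_support_subset _ fun k hk => ?_
  by_contra h
  rw [Finset.mem_coe, Finset.mem_range, not_lt] at h
  exact hk (by simp [hK k h])

theorem fieldComb_add_right (hφ : LocallyFiniteBelow φ) (f : PowerSeries R) (j : ℤ)
    (v w : Fock R) : fieldComb φ f j (v + w) = fieldComb φ f j v + fieldComb φ f j w := by
  obtain ⟨K, h1, h2⟩ := ((hφ.eventually j v).and (hφ.eventually j w)).exists
  rw [fieldComb_eq_sum f h1, fieldComb_eq_sum f h2,
    fieldComb_eq_sum f (K := K) fun k hk => by rw [map_add, h1 k hk, h2 k hk, add_zero],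
    ← Finset.sum_add_distrib]
  simp

/-- If the commutator with `∑ p_k J_k` acts on the field `∑ φ_j z^j` as multiplication by `q(z)`,
it does so on all the multiples of the field. -/
theorem currentSum_fieldComb {p q : PowerSeries R} (hφ : LocallyFiniteBelow φ)
    (hA : ∀ j v, currentSum p (φ j v) = φ j (currentSum p v) + fieldComb φ q j v)
    (f : PowerSeries R) (j : ℤ) (v : Fock R) :
    currentSum p (fieldComb φ f j v) =
      fieldComb φ f j (currentSum p v) + fieldComb φ (f * q) j v := by
  obtain ⟨K, h1, h2⟩ := ((hφ.eventually j v).and (hφ.eventually j (currentSum p v))).exists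
  rw [fieldComb_eq_sum f h1, fieldComb_eq_sum f h2, fieldComb_eq_sum _ h1, map_sum]
  simp only [map_smul, hA, smul_add]
  rw [Finset.sum_add_distrib]
  congr 1
  have h3 : ∀ k ∈ Finset.range K, PowerSeries.coeff k f • fieldComb φ q (j - k) v =
      ∑ l ∈ Finset.range (K - k),
        (PowerSeries.coeff k f * PowerSeries.coeff l q) • φ (j - ((k + l : ℕ) : ℤ)) v := by
    intro k hk
    have hk' := Finset.mem_range.1 hk
    rw [fieldComb_eq_sum (K := K - k), Finset.smul_sum]
    · refine Finset.sum_congr rfl fun l _ => ?_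
      rw [mul_smul]; push_cast; rw [sub_sub]
    · intro l hl
      rw [sub_sub]
      have := h1 (k + l) (by omega)
      push_cast at this; exact this
  rw [Finset.sum_congr rfl h3, ← Finset.sum_range_diag_flip K
    (fun k l => (PowerSeries.coeff k f * PowerSeries.coeff l q) • φ (j - ((k + l : ℕ) : ℤ)) v)]
  refine Finset.sum_congr rfl fun n _ => ?_
  rw [PowerSeries.coeff_mul, Finset.Nat.sum_antidiagonal_eq_sum_range_succ
    (fun a b => PowerSeries.coeff a f * PowerSeries.coeff b q), Finset.sum_smul]
  refine Finset.sum_congr rfl fun k hk => ?_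
  rw [Nat.add_sub_cancel' (Nat.lt_succ_iff.1 (Finset.mem_range.1 hk))]

/-- The binomial formula for moving a field through the powers of `∑ p_k J_k`. -/
theorem currentSum_pow_field {p q : PowerSeries R} (hφ : LocallyFiniteBelow φ)
    (hA : ∀ j v, currentSum p (φ j v) = φ j (currentSum p v) + fieldComb φ q j v)
    (n : ℕ) (j : ℤ) (v : Fock R) :
    (currentSum p ^ n) (φ j v) = ∑ ij ∈ Finset.HasAntidiagonal.antidiagonal n,
      n.choose ij.1 • fieldComb φ (q ^ ij.1) j ((currentSum p ^ ij.2) v) := by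
  induction n with
  | zero =>
    obtain ⟨K, h1⟩ := (hφ.eventually j v).exists
    simp only [pow_zero, Module.End.one_apply, Finset.Nat.antidiagonal_zero, Finset.sum_singleton,
      Nat.choose_self, one_smul]
    rw [fieldComb_eq_sum 1 (K := K + 1) fun k hk => h1 k (by omega), Finset.sum_range_succ',
      Finset.sum_eq_zero]
    · simp
    · intro k _
      simp [PowerSeries.coeff_one]
  | succ n ih =>
    rw [pow_succ', Module.End.mul_apply, ih, map_sum, Finset.sum_antidiagonal_choose_succ_nsmul
      (fun a b => fieldComb φ (q ^ a) j ((currentSum p ^ b) v)), ← Finset.sum_add_distrib]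
    refine Finset.sum_congr rfl fun ij hij => ?_
    rw [map_nsmul, currentSum_fieldComb hφ hA, smul_add, ← Module.End.mul_apply, ← pow_succ',
      ← pow_succ]
    congr 2
    rw [Finset.HasAntidiagonal.mem_antidiagonal] at hij
    rw [← hij, Nat.choose_symm_add]

theorem coeff_pow_eq_zero_of_lt {q : PowerSeries R} (hq : PowerSeries.coeff 0 q = 0) {k n : ℕ}
    (h : k < n) : PowerSeries.coeff k (q ^ n) = 0 := by
  refine PowerSeries.X_pow_dvd_iff.1 (pow_dvd_pow_of_dvd (PowerSeries.X_dvd_iff.2 ?_) n) k h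
  rwa [← PowerSeries.coeff_zero_eq_constantCoeff_apply]

theorem locallyFiniteBelow_create : LocallyFiniteBelow (create R) := create_eq_zero_of_small

theorem locallyFiniteBelow_annih : LocallyFiniteBelow (fun j => annih R (-j)) := by
  intro v
  obtain ⟨M, hM⟩ := annih_eq_zero_of_large v
  exact ⟨-M, fun j hj => hM _ (by omega)⟩

theorem currentSum_create {p : PowerSeries R} (hp : PowerSeries.coeff 0 p = 0) (j : ℤ)
    (v : Fock R) : currentSum p (create R j v) =
      create R j (currentSum p v) + fieldComb (create R) p j v := by
  obtain ⟨K, h1, h2, h3⟩ := ((currentSum_eventually p (create R j v)).and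
    ((currentSum_eventually p v).and (locallyFiniteBelow_create.eventually j v))).exists
  rw [h1, h2, fieldComb_eq_sum p h3, map_sum, ← Finset.sum_add_distrib]
  refine Finset.sum_congr rfl fun k _ => ?_
  rcases Nat.eq_zero_or_pos k with rfl | hk
  · simp [hp]
  · rw [current_create (by omega), smul_add, map_smul]

theorem currentSum_annih {p : PowerSeries R} (hp : PowerSeries.coeff 0 p = 0) (j : ℤ)
    (v : Fock R) : currentSum p (annih R (-j) v) =
      annih R (-j) (currentSum p v) + fieldComb (fun j => annih R (-j)) (-p) j v := by
  obtain ⟨K, h1, h2, h3⟩ := ((currentSum_eventually p (annih R (-j) v)).and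
    ((currentSum_eventually p v).and (locallyFiniteBelow_annih.eventually j v))).exists
  rw [h1, h2, fieldComb_eq_sum _ h3, map_sum, ← Finset.sum_add_distrib]
  refine Finset.sum_congr rfl fun k _ => ?_
  rcases Nat.eq_zero_or_pos k with rfl | hk
  · rw [map_neg, hp]; simp
  · rw [current_annih (by omega), smul_sub, map_smul, sub_eq_add_neg, map_neg, neg_smul, neg_sub,
      sub_eq_neg_add, add_comm]

variable [Algebra ℂ R]

/-- The power series `exp (q(z))`. -/
def expSeries (q : PowerSeries R) : PowerSeries R := (PowerSeries.exp ℂ).subst q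

theorem coeff_expSeries {q : PowerSeries R} (hq : PowerSeries.coeff 0 q = 0) {k n : ℕ}
    (h : k < n) : PowerSeries.coeff k (expSeries q) =
      ∑ i ∈ Finset.range n, ((i.factorial : ℂ)⁻¹) • PowerSeries.coeff k (q ^ i) := by
  have hs : PowerSeries.HasSubst q := PowerSeries.HasSubst.of_constantCoeff_zero'
    (by rwa [← PowerSeries.coeff_zero_eq_constantCoeff_apply])
  rw [expSeries, PowerSeries.coeff_subst' hs]
  rw [finsum_eq_sum_of_support_subset (s := Finset.range n)]
  · refine Finset.sum_congr rfl fun i _ => ?_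
    rw [PowerSeries.coeff_exp]
    congr 1
    simp
  · intro i hi
    by_contra h'
    rw [Finset.mem_coe, Finset.mem_range, not_lt] at h'
    exact hi (by simp [coeff_pow_eq_zero_of_lt hq (h.trans_le h')])

theorem expSeries_mul_neg {q : PowerSeries R} (hq : PowerSeries.coeff 0 q = 0) :
    expSeries q * expSeries (-q) = 1 := by
  have hs : PowerSeries.HasSubst q := PowerSeries.HasSubst.of_constantCoeff_zero'
    (by rwa [← PowerSeries.coeff_zero_eq_constantCoeff_apply])
  have h := PowerSeries.exp_mul_exp_neg_eq_one (A := ℂ)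
  have h2 := congrArg (PowerSeries.subst q) h
  rw [PowerSeries.subst_mul hs, ← PowerSeries.coe_substAlgHom hs, map_one,
    PowerSeries.coe_substAlgHom hs] at h2
  rw [expSeries, expSeries, ← h2]
  congr 1
  rw [PowerSeries.evalNegHom, PowerSeries.rescale_eq_subst, PowerSeries.subst_comp_subst_apply _ hs]
  · congr 1
    rw [PowerSeries.subst_smul hs, PowerSeries.subst_X hs]
    simp
  · exact PowerSeries.HasSubst.of_constantCoeff_zero' (by simp)

/-- Conjugation of the field `∑ φ_j z^j` by `exp (∑ p_k J_k)` is multiplication by `exp (q(z))` if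
the commutator with `∑ p_k J_k` is multiplication by `q(z)`. -/
theorem currentExp_field {p q : PowerSeries R} (hp : PowerSeries.coeff 0 p = 0)
    (hq : PowerSeries.coeff 0 q = 0) (hφ : LocallyFiniteBelow φ)
    (hA : ∀ j v, currentSum p (φ j v) = φ j (currentSum p v) + fieldComb φ q j v)
    (j : ℤ) (v : Fock R) :
    currentExp p (φ j v) = fieldComb φ (expSeries q) j (currentExp p v) := by
  obtain ⟨M, hM, hM2⟩ := ((eventually_forall_ge_atTop.2 (currentSum_pow_eq_zero hp v)).and
    (eventually_forall_ge_atTop.2 (currentExp_eventually hp v))).exists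
  obtain ⟨K, hK⟩ : ∃ K : ℕ, ∀ m ∈ Finset.range M, ∀ k ≥ K,
      φ (j - k) ((currentSum p ^ m) v) = 0 := by
    have := (Finset.range M).eventually_all (p := fun m K => ∀ k ≥ K,
      φ (j - k) ((currentSum p ^ m) v) = 0) (l := (atTop : Filter ℕ))
    exact (this.2 fun m _ => hφ.eventually j ((currentSum p ^ m) v)).exists
  -- both sides are the sum of these terms over `i < K` and `m < M`
  set g : ℕ → ℕ → Fock R := fun i m =>
    ((i.factorial : ℂ)⁻¹) • ((m.factorial : ℂ)⁻¹) •
      fieldComb φ (q ^ i) j ((currentSum p ^ m) v) with hg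
  have hgM : ∀ i, ∀ m ≥ M, g i m = 0 := by
    intro i m hm
    simp [hg, hM m hm, fieldComb]
  have hgK : ∀ i ≥ K, ∀ m, g i m = 0 := by
    intro i hi m
    by_cases hm : m < M
    · simp only [hg]
      rw [fieldComb_eq_sum _ (hK m (Finset.mem_range.2 hm)), Finset.sum_eq_zero]
      · simp
      · intro k hk
        rw [coeff_pow_eq_zero_of_lt hq ((Finset.mem_range.1 hk).trans_le hi), zero_smul]
    · exact hgM i m (not_lt.1 hm)
  obtain ⟨N, hN, hN2⟩ := ((currentExp_eventually hp (φ j v)).and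
    (eventually_ge_atTop (K + M))).exists
  trans ∑ i ∈ Finset.range K, ∑ m ∈ Finset.range M, g i m
  · rw [hN]
    have h1 : ∀ n ∈ Finset.range N, ((n.factorial : ℂ)⁻¹) • (currentSum p ^ n) (φ j v) =
        ∑ k ∈ Finset.range (n + 1), g k (n - k) := by
      intro n _
      rw [currentSum_pow_field hφ hA, Finset.smul_sum,
        ← Finset.Nat.sum_antidiagonal_eq_sum_range_succ g]
      refine Finset.sum_congr rfl fun ij hij => ?_
      rw [Finset.HasAntidiagonal.mem_antidiagonal] at hij
      simp only [hg]
      rw [← Nat.cast_smul_eq_nsmul ℂ, smul_smul, smul_smul]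
      congr 1
      rw [← hij, Nat.choose_symm_add, Nat.add_choose, Nat.cast_div (Nat.factorial_mul_factorial_dvd_factorial_add _ _)
        (by exact_mod_cast mul_ne_zero (Nat.factorial_ne_zero _) (Nat.factorial_ne_zero _))]
      have := (Nat.cast_ne_zero (R := ℂ)).2 (Nat.factorial_ne_zero (ij.1 + ij.2))
      push_cast
      field_simp
    rw [Finset.sum_congr rfl h1, Finset.sum_range_diag_flip]
    rw [← Finset.sum_subset (Finset.range_subset_range.2 (show K ≤ N by omega))]
    · refine Finset.sum_congr rfl fun i hi => ?_
      rw [Finset.mem_range] at hi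
      refine (Finset.sum_subset (Finset.range_subset_range.2 (by omega)) fun m _ hm => ?_).symm
      exact hgM i m (by simpa using hm)
    · intro i _ hi
      exact Finset.sum_eq_zero fun m _ => hgK i (by simpa using hi) m
  · symm
    have hv := hM2 M le_rfl
    have hK2 : ∀ k ≥ K, φ (j - k) (currentExp p v) = 0 := by
      intro k hk
      rw [hv, map_sum]
      refine Finset.sum_eq_zero fun m hm => ?_
      rw [LinearMap.map_smul_of_tower, hK m hm k hk, smul_zero]
    rw [fieldComb_eq_sum _ hK2]
    have h2 : ∀ k ∈ Finset.range K, PowerSeries.coeff k (expSeries q) • φ (j - k) (currentExp p v) =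
        ∑ i ∈ Finset.range K, ∑ m ∈ Finset.range M, ((i.factorial : ℂ)⁻¹) •
          ((m.factorial : ℂ)⁻¹) • PowerSeries.coeff k (q ^ i) •
            φ (j - k) ((currentSum p ^ m) v) := by
      intro k hk
      rw [coeff_expSeries hq (Finset.mem_range.1 hk), Finset.sum_smul]
      refine Finset.sum_congr rfl fun i _ => ?_
      rw [hv, map_sum, Finset.smul_sum]
      refine Finset.sum_congr rfl fun m _ => ?_
      rw [LinearMap.map_smul_of_tower, smul_assoc, smul_comm (PowerSeries.coeff k (q ^ i))]
    rw [Finset.sum_congr rfl h2, Finset.sum_comm]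
    refine Finset.sum_congr rfl fun i _ => ?_
    rw [Finset.sum_comm (s := Finset.range K)]
    refine Finset.sum_congr rfl fun m hm => ?_
    simp only [hg]
    rw [fieldComb_eq_sum _ (hK m hm), Finset.smul_sum, Finset.smul_sum]

theorem currentExp_create {p : PowerSeries R} (hp : PowerSeries.coeff 0 p = 0) (j : ℤ)
    (v : Fock R) : currentExp p (create R j v) =
      fieldComb (create R) (expSeries p) j (currentExp p v) :=
  currentExp_field hp hp locallyFiniteBelow_create (currentSum_create hp) j v

theorem currentExp_annih {p : PowerSeries R} (hp : PowerSeries.coeff 0 p = 0) (j : ℤ)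
    (v : Fock R) : currentExp p (annih R (-j) v) =
      fieldComb (fun j => annih R (-j)) (expSeries (-p)) j (currentExp p v) :=
  currentExp_field hp (by simpa using hp) locallyFiniteBelow_annih (currentSum_annih hp) j v

end

/-! ### The bilinear identity -/

section Bilinear

variable {R : Type} [CommRing R]

/-- The bilinear identity `∑ ψ_{-j} A ⊗ ψ*_j A = ∑ A ψ_{-j} ⊗ A ψ*_j`, written in matrix elements
between `⟨X| ⊗ ⟨Y|` and `|u⟩ ⊗ |v⟩`. -/
def IsGroupLike (A : Op R) : Prop := ∀ X Y u v : Maya,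
  ∑ᶠ j, ((annihCoeff X j * createCoeff Y j : ℤ) : R) * (A (toggle X j) u * A (toggle Y j) v) =
  ∑ᶠ j, ((createCoeff u j * annihCoeff v j : ℤ) : R) * (A X (toggle u j) * A Y (toggle v j))

theorem finite_annih_create (X Y : Maya) :
    {j | annihCoeff X j * createCoeff Y j ≠ 0}.Finite := by
  obtain ⟨N, hN⟩ := X.bddAbove
  obtain ⟨M, hM⟩ := Y.exists_Iic_subset
  refine (Set.finite_Icc M N).subset fun j hj => ?_
  constructor
  · by_contra h
    exact hj (by rw [createCoeff_of_mem (hM j (not_le.1 h).le), mul_zero])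
  · by_contra h
    exact hj (by rw [annihCoeff_of_notMem fun h' => h (hN j h'), zero_mul])

/-- The coefficient of `z^n`, `n ∈ ℤ`, of a power series in `z`. -/
def coeffInt (f : PowerSeries R) (n : ℤ) : R := if 0 ≤ n then PowerSeries.coeff n.toNat f else 0

theorem sum_coeffInt_mul (f g : PowerSeries R) {a b m m' : ℤ} (ha : a ≤ m) (hb : m' ≤ b) :
    ∑ j ∈ Finset.Icc a b, coeffInt f (j - m) * coeffInt g (m' - j) =
      coeffInt (f * g) (m' - m) := by
  by_cases h : 0 ≤ m' - m
  · obtain ⟨n, hn⟩ := Int.eq_ofNat_of_zero_le h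
    rw [coeffInt, if_pos h, hn, Int.toNat_natCast, PowerSeries.coeff_mul]
    symm
    refine Finset.sum_of_injOn (fun x => m + x.1) ?_ ?_ ?_ ?_
    · intro x hx y hy hxy
      simp only [Finset.mem_coe,
        Finset.HasAntidiagonal.mem_antidiagonal] at hx hy hxy
      ext <;> omega
    · intro x hx
      simp only [Finset.mem_coe, Finset.HasAntidiagonal.mem_antidiagonal] at hx
      simp only [Finset.coe_Icc, Set.mem_Icc]
      omega
    · intro j _ hj
      by_cases h1 : 0 ≤ j - m
      · by_cases h2 : 0 ≤ m' - j
        · exfalso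
          refine hj ⟨((j - m).toNat, (m' - j).toNat), ?_, ?_⟩
          · simp only [Finset.mem_coe, Finset.HasAntidiagonal.mem_antidiagonal]; omega
          · simp only; omega
        · rw [coeffInt, coeffInt, if_neg h2, mul_zero]
      · rw [coeffInt, if_neg h1, zero_mul]
    · intro x hx
      rw [Finset.HasAntidiagonal.mem_antidiagonal] at hx
      rw [coeffInt, coeffInt, if_pos (by omega), if_pos (by omega)]
      congr 3 <;> omega
  · rw [coeffInt, if_neg h]
    refine Finset.sum_eq_zero fun j _ => ?_
    by_cases h1 : 0 ≤ j - m
    · have h2 : ¬ 0 ≤ m' - j := by omega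
      rw [coeffInt, coeffInt, if_neg h2, mul_zero]
    · rw [coeffInt, if_neg h1, zero_mul]

theorem coeffInt_one (n : ℤ) : coeffInt (1 : PowerSeries R) n = if n = 0 then 1 else 0 := by
  unfold coeffInt
  by_cases h : 0 ≤ n
  · rw [if_pos h, PowerSeries.coeff_one]
    congr 1
    simp only [eq_iff_iff]; omega
  · rw [if_neg h, if_neg (by omega)]

variable {φ : ℤ → Fock R →ₗ[R] Fock R}

theorem fieldComb_eq_sum_Icc (f : PowerSeries R) {j a b : ℤ} {v : Fock R}
    (h : ∀ i < a, φ i v = 0) (hb : j ≤ b) :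
    fieldComb φ f j v = ∑ m ∈ Finset.Icc a b, coeffInt f (j - m) • φ m v := by
  rw [fieldComb_eq_sum (K := (j - a + 1).toNat) f fun k hk => h _ (by omega)]
  refine Finset.sum_of_injOn (fun k : ℕ => j - k) ?_ ?_ ?_ ?_
  · intro x _ y _ hxy
    simpa using hxy
  · intro k hk
    simp only [Finset.coe_range, Set.mem_Iio, Finset.coe_Icc, Set.mem_Icc] at hk ⊢
    omega
  · intro m hm hmn
    by_cases h1 : 0 ≤ j - m
    · exfalso
      refine hmn ⟨(j - m).toNat, ?_, ?_⟩
      · simp only [Finset.coe_range, Set.mem_Iio]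
        rw [Finset.mem_Icc] at hm; omega
      · simp only; omega
    · rw [coeffInt, if_neg h1, zero_smul]
  · intro k _
    rw [coeffInt, if_pos (by omega)]
    congr 3; omega

variable [Algebra ℂ R]

/-- The matrix of `exp (∑_{k ≥ 1} p_k J_k)`. -/
def expOp (p : PowerSeries R) : Op R := fun S S' => currentExp p (ket R S') S

theorem createCoeff_mul_expOp {p : PowerSeries R} (hp : PowerSeries.coeff 0 p = 0)
    (X u : Maya) (j : ℤ) : (createCoeff u j : R) * expOp p X (toggle u j) =
      fieldComb (create R) (expSeries p) j (currentExp p (ket R u)) X := by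
  rw [← currentExp_create hp, create_single, one_mul, expOp,
    ← Finsupp.smul_single_one (toggle u j) (createCoeff u j : R), map_smul]
  rfl

theorem annihCoeff_mul_expOp {p : PowerSeries R} (hp : PowerSeries.coeff 0 p = 0)
    (Y v : Maya) (j : ℤ) : (annihCoeff v j : R) * expOp p Y (toggle v j) =
      fieldComb (fun j => annih R (-j)) (expSeries (-p)) (-j) (currentExp p (ket R v)) Y := by
  rw [← currentExp_annih hp, neg_neg, annih_single, one_mul, expOp,
    ← Finsupp.smul_single_one (toggle v j) (annihCoeff v j : R), map_smul]
  rfl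

/-- The exponential of a combination of currents satisfies the bilinear identity: it multiplies the
two fermion fields by inverse power series. -/
theorem isGroupLike_expOp {p : PowerSeries R} (hp : PowerSeries.coeff 0 p = 0) :
    IsGroupLike (expOp p) := by
  intro X Y u v
  set α : ℤ → R := fun m => create R m (currentExp p (ket R u)) X with hα
  set β : ℤ → R := fun m => annih R m (currentExp p (ket R v)) Y with hβ
  obtain ⟨M, hM⟩ := create_eq_zero_of_small (currentExp p (ket R u))
  obtain ⟨N, hN⟩ := annih_eq_zero_of_large (currentExp p (ket R v))
  have hL : ∀ j, ((annihCoeff X j * createCoeff Y j : ℤ) : R) *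
      (expOp p (toggle X j) u * expOp p (toggle Y j) v) = α j * β j := by
    intro j
    simp only [hα, hβ]
    rw [create_apply, annih_apply, expOp, expOp]
    push_cast; ring
  have hαN : ∀ m < M, α m = 0 := fun m hm => by simp [hα, hM m hm]
  have hβN : ∀ m > N, β m = 0 := fun m hm => by simp [hβ, hN m hm]
  have hR : ∀ j ∈ Finset.Icc M N, ((createCoeff u j * annihCoeff v j : ℤ) : R) *
      (expOp p X (toggle u j) * expOp p Y (toggle v j)) =
      ∑ m ∈ Finset.Icc M N, ∑ m' ∈ Finset.Icc M N,
        (coeffInt (expSeries p) (j - m) * coeffInt (expSeries (-p)) (m' - j)) * (α m * β m') := by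
    intro j hj
    rw [Finset.mem_Icc] at hj
    have e1 : (createCoeff u j : R) * expOp p X (toggle u j) =
        ∑ m ∈ Finset.Icc M N, coeffInt (expSeries p) (j - m) * α m := by
      rw [createCoeff_mul_expOp hp, fieldComb_eq_sum_Icc _ hM hj.2, Finsupp.finsetSum_apply]
      rfl
    have e2 : (annihCoeff v j : R) * expOp p Y (toggle v j) =
        ∑ m ∈ Finset.Icc M N, coeffInt (expSeries (-p)) (m - j) * β m := by
      rw [annihCoeff_mul_expOp hp, fieldComb_eq_sum_Icc (a := -N) (b := -M) _
        (fun i hi => hN _ (by omega)) (by omega), Finsupp.finsetSum_apply]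
      refine Finset.sum_nbij' (fun m => -m) (fun m => -m) ?_ ?_ ?_ ?_ ?_
      · intro m hm; rw [Finset.mem_Icc] at hm ⊢; omega
      · intro m hm; rw [Finset.mem_Icc] at hm ⊢; omega
      · intro m _; simp
      · intro m _; simp
      · intro m _
        rw [show -j - m = -m - j by ring]
        rfl
    calc _ = ((createCoeff u j : R) * expOp p X (toggle u j)) *
          ((annihCoeff v j : R) * expOp p Y (toggle v j)) := by push_cast; ring
      _ = _ := by
        rw [e1, e2, Finset.sum_mul_sum]
        refine Finset.sum_congr rfl fun m _ => Finset.sum_congr rfl fun m' _ => ?_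
        ring
  have hR0 : ∀ j ∉ Finset.Icc M N, ((createCoeff u j * annihCoeff v j : ℤ) : R) *
      (expOp p X (toggle u j) * expOp p Y (toggle v j)) = 0 := by
    intro j hj
    have e : ((createCoeff u j * annihCoeff v j : ℤ) : R) *
      (expOp p X (toggle u j) * expOp p Y (toggle v j)) =
        ((createCoeff u j : R) * expOp p X (toggle u j)) *
          ((annihCoeff v j : R) * expOp p Y (toggle v j)) := by push_cast; ring
    rw [Finset.mem_Icc, not_and_or, not_le, not_le] at hj
    rw [e]
    rcases hj with hj | hj
    · rw [createCoeff_mul_expOp hp, fieldComb_eq_sum (K := 0) _ fun k _ => hM _ (by omega)]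
      simp
    · rw [annihCoeff_mul_expOp hp, fieldComb_eq_sum (φ := fun j => annih R (-j)) (K := 0) _
        fun k _ => hN _ (by omega)]
      simp
  rw [finsum_congr hL, finsum_eq_sum_of_support_subset (s := Finset.Icc M N),
    finsum_eq_sum_of_support_subset (s := Finset.Icc M N), Finset.sum_congr rfl hR]
  · rw [Finset.sum_comm]
    refine Finset.sum_congr rfl fun m hm => ?_
    rw [Finset.sum_comm, Finset.sum_eq_single m]
    · rw [← Finset.sum_mul, sum_coeffInt_mul _ _ (Finset.mem_Icc.1 hm).1 (Finset.mem_Icc.1 hm).2,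
        expSeries_mul_neg hp, coeffInt_one, if_pos (by ring), one_mul]
    · intro m' hm' hne
      rw [← Finset.sum_mul, sum_coeffInt_mul _ _ (Finset.mem_Icc.1 hm).1 (Finset.mem_Icc.1 hm').2,
        expSeries_mul_neg hp, coeffInt_one, if_neg (sub_ne_zero.2 hne), zero_mul]
    · exact fun h => absurd hm h
  · intro j hj
    by_contra h
    exact hj (hR0 j h)
  · intro j hj
    simp only [Finset.coe_Icc, Set.mem_Icc]
    by_contra h
    rw [not_and_or, not_le, not_le] at h
    rcases h with h | h
    · exact hj (by simp [hαN j h])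
    · exact hj (by simp [hβN j h])

end Bilinear

/-! ### Matrix elements with the ground state as determinants -/

section Wedge

variable {R : Type} [CommRing R]

/-- Moving `ψ*_m` to the right through a product of operators, a Laplace expansion. -/
theorem annih_prod {l : ℕ} (φ : Fin (l + 1) → Module.End R (Fock R)) (m : ℤ) (c : Fin (l + 1) → R)
    (h : ∀ i v, annih R m (φ i v) = c i • v - φ i (annih R m v)) (v : Fock R)
    (hv : annih R m v = 0) :
    annih R m ((List.ofFn φ).prod v) =
      ∑ i : Fin (l + 1), ((-1) ^ (i : ℕ) * c i) • (List.ofFn fun k => φ (i.succAbove k)).prod v := by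
  induction l with
  | zero => simp [h, hv]
  | succ l ih =>
    rw [List.ofFn_succ, List.prod_cons, Module.End.mul_apply, h,
      ih (fun i => φ i.succ) (fun i => c i.succ) (fun i => h i.succ), map_sum, Fin.sum_univ_succ (n := l + 1),
      sub_eq_add_neg, ← Finset.sum_neg_distrib]
    congr 1
    · simp
    · refine Finset.sum_congr rfl fun i _ => ?_
      rw [List.ofFn_succ (f := fun k => φ (i.succ.succAbove k)), List.prod_cons,
        Module.End.mul_apply]
      simp only [Fin.succ_succAbove_zero, Fin.succ_succAbove_succ, map_smul]
      rw [← neg_smul]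
      congr 1
      simp [pow_succ]

/-- The coordinate at `|s⟩` in terms of the coordinate at `|s - 1⟩`. -/
theorem apply_ground (v : Fock R) (s : ℤ) : v (ground s) = annih R s v (ground (s - 1)) := by
  have h : toggle (ground (s - 1)) s = ground s := Maya.ext_mem fun n => by
    rw [mem_toggle, mem_ground, mem_ground]; omega
  have h1 : s ∉ (ground (s - 1)).1 := by rw [mem_ground]; omega
  rw [annih_apply, h, createCoeff_of_notMem h1, fsign_of_top]
  · simp
  · intro n hn; rw [mem_ground] at hn; omega

/-- Wick's theorem for a product of operators whose anticommutators with the `ψ*` are scalars. -/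
theorem prod_apply_ground {l : ℕ} (φ : Fin l → Module.End R (Fock R)) (c : Fin l → ℤ → R)
    (h : ∀ i m v, annih R m (φ i v) = c i m • v - φ i (annih R m v)) (s : ℤ) :
    (List.ofFn φ).prod (ket R (ground (s - l))) (ground s) =
      Matrix.det (Matrix.of fun i j : Fin l => c i (s - j)) := by
  induction l generalizing s with
  | zero => simp
  | succ l ih =>
    rw [apply_ground, annih_prod φ s (fun i => c i s) (fun i => h i s), Matrix.det_succ_column_zero,
      Finsupp.finsetSum_apply]
    · refine Finset.sum_congr rfl fun i _ => ?_
      have := ih (fun k => φ (i.succAbove k)) (fun k => c (i.succAbove k))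
        (fun k => h (i.succAbove k)) (s - 1)
      rw [show s - ((l + 1 : ℕ) : ℤ) = s - 1 - l by push_cast; ring, Finsupp.smul_apply, this,
        smul_eq_mul]
      congr 1
      · simp
      · congr 1
        ext a b
        simp only [Matrix.of_apply, Matrix.submatrix_apply, Fin.val_succ]
        congr 1; push_cast; ring
    · rw [annih_single, annihCoeff_of_notMem]
      · simp
      · rw [mem_ground]; push_cast; omega

/-- `fieldComb` as a linear operator. -/
def fieldOp (f : PowerSeries R) (j : ℤ) : Module.End R (Fock R) where
  toFun := fieldComb (create R) f j
  map_add' := fieldComb_add_right locallyFiniteBelow_create f j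
  map_smul' c v := by
    obtain ⟨K, h1⟩ := (locallyFiniteBelow_create.eventually j v).exists
    rw [fieldComb_eq_sum f h1, fieldComb_eq_sum (K := K) f fun k hk => by
      rw [map_smul, h1 k hk, smul_zero]]
    simp [Finset.smul_sum, smul_comm c]

theorem annih_fieldOp (f : PowerSeries R) (j m : ℤ) (v : Fock R) :
    annih R m (fieldOp f j v) = coeffInt f (j - m) • v - fieldOp f j (annih R m v) := by
  obtain ⟨M, h1⟩ := create_eq_zero_of_small v
  obtain ⟨N, h2⟩ := create_eq_zero_of_small (annih R m v)
  set a := min m (min M N)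
  change annih R m (fieldComb (create R) f j v) = _ - fieldComb (create R) f j (annih R m v)
  have ha : a ≤ m := min_le_left _ _
  rw [fieldComb_eq_sum_Icc (a := a) (b := max m j) f (fun i hi => h1 i (by omega)) (le_max_right _ _),
    fieldComb_eq_sum_Icc (a := a) (b := max m j) f (fun i hi => h2 i (by omega)) (le_max_right _ _),
    map_sum]
  simp only [map_smul, annih_create, smul_sub, Finset.sum_sub_distrib, smul_ite, smul_zero]
  rw [Finset.sum_ite_eq, if_pos (Finset.mem_Icc.2 ⟨ha, le_max_left _ _⟩)]

theorem currentExp_prod [Algebra ℂ R] {p : PowerSeries R} (hp : PowerSeries.coeff 0 p = 0) {l : ℕ}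
    (f : Fin l → ℤ) (v : Fock R) :
    currentExp p ((List.ofFn fun i => (create R (f i) : Module.End R (Fock R))).prod v) =
      (List.ofFn fun i => fieldOp (expSeries p) (f i)).prod (currentExp p v) := by
  induction l with
  | zero => simp
  | succ l ih =>
    rw [List.ofFn_succ, List.prod_cons, Module.End.mul_apply, List.ofFn_succ, List.prod_cons,
      Module.End.mul_apply, currentExp_create hp, ih]
    rfl

theorem eq_ground_of_range {f : ℕ → ℤ} {s : ℤ} (hl : ∀ i, f i = s - i) {S : Maya}
    (hS : S.1 = Set.range f) : S = ground s := Maya.ext_mem fun n => by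
  rw [hS, mem_ground, Set.mem_range]
  constructor
  · rintro ⟨i, rfl⟩; rw [hl i]; omega
  · intro h; exact ⟨(s - n).toNat, by rw [hl]; omega⟩

theorem toggle_top_of_range {f : ℕ → ℤ} (hf : StrictAnti f) {S : Maya} (hS : S.1 = Set.range f) :
    (toggle S (f 0)).1 = Set.range fun i => f (i + 1) := by
  ext n
  rw [mem_toggle, hS]
  constructor
  · rintro (⟨⟨i, rfl⟩, hi⟩ | ⟨rfl, h⟩)
    · obtain ⟨i, rfl⟩ := Nat.exists_eq_succ_of_ne_zero (n := i) (by rintro rfl; exact hi rfl)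
      exact ⟨i, rfl⟩
    · exact absurd ⟨0, rfl⟩ h
  · rintro ⟨i, rfl⟩
    exact Or.inl ⟨⟨i + 1, rfl⟩, (hf (Nat.succ_pos i)).ne⟩

/-- A state as a product of creation operators applied to a ground state of lower charge. -/
theorem ket_eq_prod {l : ℕ} {f : ℕ → ℤ} {s : ℤ} (hf : StrictAnti f) (hl : ∀ i ≥ l, f i = s - i)
    {S : Maya} (hS : S.1 = Set.range f) :
    ket R S = (List.ofFn fun i : Fin l => (create R (f i) : Module.End R (Fock R))).prod
      (ket R (ground (s - l))) := by
  induction l generalizing f s S with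
  | zero =>
    have : S = ground s := eq_ground_of_range (fun i => hl i (Nat.zero_le i)) hS
    simp [this]
  | succ l ih =>
    have hS' := toggle_top_of_range hf hS
    have htop : ∀ n ∈ (toggle S (f 0)).1, n < f 0 := by
      rw [hS']; rintro _ ⟨i, rfl⟩; exact hf (Nat.succ_pos i)
    have h1 := ih (f := fun i => f (i + 1)) (s := s - 1) (S := toggle S (f 0))
      (fun a b hab => hf (by omega)) (fun i hi => by
        rw [hl (i + 1) (by omega)]; push_cast; ring) hS'
    have h2 := ket_toggle_top R htop
    rw [toggle_toggle] at h2
    rw [h2, h1, List.ofFn_succ, List.prod_cons, Module.End.mul_apply,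
      show s - ((l + 1 : ℕ) : ℤ) = s - 1 - l by push_cast; ring]
    rfl

theorem weight_eq_sum {M : Type*} [AddCommGroup M] (a : ℤ → M) {l : ℕ} {f : ℕ → ℤ} {s : ℤ}
    (hf : StrictAnti f) (hl : ∀ i ≥ l, f i = s - i) {S : Maya} (hS : S.1 = Set.range f) :
    weight a S = weight a (ground (s - l)) + ∑ i ∈ Finset.range l, a (f i) := by
  induction l generalizing f s S with
  | zero =>
    have : S = ground s := eq_ground_of_range (fun i => hl i (Nat.zero_le i)) hS
    simp [this]
  | succ l ih =>
    have h0 : f 0 ∈ S.1 := by rw [hS]; exact ⟨0, rfl⟩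
    have hS' := toggle_top_of_range hf hS
    have h1 := ih (f := fun i => f (i + 1)) (s := s - 1) (S := toggle S (f 0))
      (fun a b hab => hf (by omega)) (fun i hi => by
        rw [hl (i + 1) (by omega)]; push_cast; ring) hS'
    have h2 := weight_toggle_of_mem a h0
    rw [h1, show s - 1 - (l : ℤ) = s - ((l + 1 : ℕ) : ℤ) by push_cast; ring] at h2
    rw [Finset.sum_range_succ', ← add_assoc, h2, sub_add_cancel]

end Wedge

/-! ### Coefficientwise finite families of power series -/

section Families

variable {ι κ : Type*}

/-- Every coefficient is nonzero for finitely many members of the family only. -/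
def CoeffFinite (f : ι → TSeries) : Prop := ∀ d, {i | MvPowerSeries.coeff d (f i) ≠ 0}.Finite

theorem CoeffFinite.summable {f : ι → TSeries} (hf : CoeffFinite f) : Summable f :=
  MvPowerSeries.WithPiTopology.summable_iff_summable_coeff.2 fun d =>
    summable_of_hasFiniteSupport (hf d)

theorem CoeffFinite.coeff_tsum {f : ι → TSeries} (hf : CoeffFinite f) (d : Time →₀ ℕ) :
    MvPowerSeries.coeff d (∑' i, f i) = ∑ᶠ i, MvPowerSeries.coeff d (f i) := by
  have h := MvPowerSeries.WithPiTopology.hasSum_iff_hasSum_coeff.1 hf.summable.hasSum d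
  rw [← h.tsum_eq]
  exact tsum_eq_finsum (hf d)

theorem CoeffFinite.exists_of_coeff_tsum_ne_zero {f : ι → TSeries} (hf : CoeffFinite f)
    {d : Time →₀ ℕ} (h : MvPowerSeries.coeff d (∑' i, f i) ≠ 0) :
    ∃ i, MvPowerSeries.coeff d (f i) ≠ 0 := by
  by_contra hne
  push Not at hne
  exact h (by rw [hf.coeff_tsum, finsum_eq_zero_of_forall_eq_zero hne])

theorem exists_of_coeff_mul_ne_zero {f g : TSeries} {d : Time →₀ ℕ}
    (h : MvPowerSeries.coeff d (f * g) ≠ 0) :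
    ∃ x ∈ Finset.HasAntidiagonal.antidiagonal d,
      MvPowerSeries.coeff x.1 f ≠ 0 ∧ MvPowerSeries.coeff x.2 g ≠ 0 := by
  classical
  rw [MvPowerSeries.coeff_mul] at h
  obtain ⟨x, hx, hne⟩ := Finset.exists_ne_zero_of_sum_ne_zero h
  exact ⟨x, hx, left_ne_zero_of_mul hne, right_ne_zero_of_mul hne⟩

theorem CoeffFinite.of_finite {f : ι → TSeries} (hf : (Function.support f).Finite) :
    CoeffFinite f := fun d => hf.subset fun i hi h => hi (by simp [h])

theorem CoeffFinite.comp_injective {f : ι → TSeries} (hf : CoeffFinite f) {e : κ → ι}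
    (he : Function.Injective e) : CoeffFinite fun k => f (e k) :=
  fun d => (hf d).preimage he.injOn

theorem CoeffFinite.mul_sigma {f : ι → TSeries} (hf : CoeffFinite f) {g : ι → κ → TSeries}
    (hg : ∀ i, CoeffFinite (g i)) : CoeffFinite fun x : ι × κ => f x.1 * g x.1 x.2 := by
  intro d
  have : (⋃ x ∈ (Finset.HasAntidiagonal.antidiagonal d : Finset _),
      ⋃ i ∈ {i | MvPowerSeries.coeff x.1 (f i) ≠ 0},
        (fun k => (i, k)) '' {k | MvPowerSeries.coeff x.2 (g i k) ≠ 0}).Finite :=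
    (Finset.finite_toSet _).biUnion fun x _ => (hf x.1).biUnion fun i _ => (hg i x.2).image _
  refine this.subset ?_
  rintro ⟨i, k⟩ hik
  obtain ⟨x, hx, h1, h2⟩ := exists_of_coeff_mul_ne_zero hik
  simp only [Set.mem_iUnion]
  exact ⟨x, hx, i, h1, k, h2, rfl⟩

theorem CoeffFinite.mul_right {f : ι → TSeries} (hf : CoeffFinite f) (g : ι → TSeries) :
    CoeffFinite fun i => f i * g i := by
  have := (hf.mul_sigma (g := fun i (_ : Unit) => g i) fun i =>
    CoeffFinite.of_finite (Set.toFinite _)).comp_injective (e := fun i => (i, ()))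
    fun a b h => (Prod.ext_iff.1 h).1
  exact this

theorem CoeffFinite.mul_left {f : ι → TSeries} (hf : CoeffFinite f) (g : ι → TSeries) :
    CoeffFinite fun i => g i * f i := by
  simpa only [mul_comm] using hf.mul_right g

theorem CoeffFinite.tsum_prod {f : ι × κ → TSeries} (hf : CoeffFinite f) :
    ∑' x, f x = ∑' i, ∑' k, f (i, k) :=
  hf.summable.tsum_prod' fun i =>
    (hf.comp_injective (e := fun k => (i, k)) fun _ _ h => (Prod.ext_iff.1 h).2).summable

theorem CoeffFinite.tsum_prod_right {f : ι × κ → TSeries} (hf : CoeffFinite f) :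
    ∑' x, f x = ∑' k, ∑' i, f (i, k) := by
  rw [← (Equiv.prodComm κ ι).tsum_eq]
  exact (hf.comp_injective (Equiv.prodComm κ ι).injective).tsum_prod

theorem CoeffFinite.tsum_mul {f : ι → TSeries} (hf : CoeffFinite f) (a : TSeries) :
    (∑' i, f i) * a = ∑' i, f i * a := (hf.summable.tsum_mul_right a).symm

theorem CoeffFinite.mul_tsum {f : ι → TSeries} (hf : CoeffFinite f) (a : TSeries) :
    a * (∑' i, f i) = ∑' i, a * f i := (hf.summable.tsum_mul_left a).symm

theorem CoeffFinite.tsum_mul_tsum {f : ι → TSeries} {g : κ → TSeries} (hf : CoeffFinite f)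
    (hg : CoeffFinite g) : (∑' i, f i) * (∑' k, g k) = ∑' x : ι × κ, f x.1 * g x.2 :=
  hf.summable.tsum_mul_tsum hg.summable (hf.mul_sigma (g := fun _ => g) fun _ => hg).summable

end Families

/-! ### Products of operators with coefficientwise finite rows or columns -/

/-- Operators whose rows are coefficientwise finite. -/
def RowFinite (A : Op TSeries) : Prop := ∀ S, CoeffFinite (A S)

/-- The transposed operator. -/
def opTranspose {R : Type} (A : Op R) : Op R := fun S S' => A S' S

/-- Operators with constant coefficients. -/
def constOp (g : Op ℂ) : Op TSeries := fun S S' => MvPowerSeries.C (g S S')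

theorem opTranspose_opMul {R : Type} [CommRing R] [TopologicalSpace R] (A B : Op R) :
    opTranspose (opMul A B) = opMul (opTranspose B) (opTranspose A) := by
  funext S S'
  exact tsum_congr fun P => mul_comm _ _

theorem RowFinite.opMul {A B : Op TSeries} (hA : RowFinite A) (hB : RowFinite B) :
    RowFinite (opMul A B) := by
  intro S d
  refine (((hA S).mul_sigma (g := fun P Q => B P Q) hB d).image Prod.snd).subset fun Q hQ => ?_
  obtain ⟨P, hP⟩ := ((hA S).mul_right fun P => B P Q).exists_of_coeff_tsum_ne_zero hQ
  exact ⟨(P, Q), hP, rfl⟩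

/-- Associativity of products of infinite matrices, under finiteness conditions that make the
double sum over intermediate states coefficientwise finite. -/
theorem opMul_assoc_of_coeffFinite {A B C : Op TSeries} (hA : RowFinite A)
    (hBC : RowFinite B ∨ RowFinite (opTranspose C)) :
    opMul (opMul A B) C = opMul A (opMul B C) := by
  funext S S'
  have h1 : ∀ P, CoeffFinite fun Q => B P Q * C Q S' := by
    intro P
    rcases hBC with h | h
    · exact (h P).mul_right (fun Q => C Q S')
    · exact (h S').mul_left (B P)
  have h2 : CoeffFinite fun x : Maya × Maya => A S x.1 * (B x.1 x.2 * C x.2 S') :=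
    (hA S).mul_sigma (g := fun P Q => B P Q * C Q S') h1
  have e1 : ∀ Q, opMul A B S Q * C Q S' = ∑' P, A S P * (B P Q * C Q S') := fun Q =>
    (((hA S).mul_right fun P => B P Q).tsum_mul (C Q S')).trans
      (tsum_congr fun P => mul_assoc _ _ _)
  have e2 : ∀ P, A S P * opMul B C P S' = ∑' Q, A S P * (B P Q * C Q S') := fun P =>
    (h1 P).mul_tsum (A S P)
  calc opMul (opMul A B) C S S' = ∑' Q, ∑' P, A S P * (B P Q * C Q S') := tsum_congr e1
    _ = ∑' P, ∑' Q, A S P * (B P Q * C Q S') := h2.tsum_prod_right.symm.trans h2.tsum_prod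
    _ = opMul A (opMul B C) S S' := (tsum_congr e2).symm

/-! ### Operations preserving the bilinear identity -/

section GroupLike

variable {R : Type} [CommRing R]

theorem IsGroupLike.transpose {A : Op R} (hA : IsGroupLike A) : IsGroupLike (opTranspose A) := by
  intro X Y u v
  have := hA v u Y X
  unfold opTranspose
  rw [finsum_congr fun j => (by push_cast; ring :
    ((annihCoeff X j * createCoeff Y j : ℤ) : R) * (A u (toggle X j) * A v (toggle Y j)) =
      ((createCoeff Y j * annihCoeff X j : ℤ) : R) * (A v (toggle Y j) * A u (toggle X j))),
    ← this]
  exact finsum_congr fun j => by push_cast; ring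

/-- Diagonal operators multiplicative under moving a particle between two states preserve the
bilinear identity. -/
theorem IsGroupLike.scale_left {A : Op R} (hA : IsGroupLike A) {d : Maya → R}
    (hd : ∀ X Y j, j ∈ X.1 → j ∉ Y.1 → d (toggle X j) * d (toggle Y j) = d X * d Y) :
    IsGroupLike fun S S' => d S * A S S' := by
  have key : ∀ (a : R) (f : ℤ → R), (Function.support f).Finite →
      ∑ᶠ j, a * f j = a * ∑ᶠ j, f j := fun a f hf => (mul_finsum' f a hf).symm
  intro X Y u v
  have e1 : ∀ j, ((annihCoeff X j * createCoeff Y j : ℤ) : R) *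
      (d (toggle X j) * A (toggle X j) u * (d (toggle Y j) * A (toggle Y j) v)) =
      (d X * d Y) * (((annihCoeff X j * createCoeff Y j : ℤ) : R) *
        (A (toggle X j) u * A (toggle Y j) v)) := by
    intro j
    by_cases h1 : j ∈ X.1
    · by_cases h2 : j ∈ Y.1
      · simp [createCoeff_of_mem h2]
      · rw [← hd X Y j h1 h2]; ring
    · simp [annihCoeff_of_notMem h1]
  have e2 : ∀ j, ((createCoeff u j * annihCoeff v j : ℤ) : R) *
      (d X * A X (toggle u j) * (d Y * A Y (toggle v j))) =
      (d X * d Y) * (((createCoeff u j * annihCoeff v j : ℤ) : R) *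
        (A X (toggle u j) * A Y (toggle v j))) := by
    intro j; ring
  rw [finsum_congr e1, finsum_congr e2, key, key, hA X Y u v]
  · refine (finite_annih_create v u).subset fun j hj h => hj ?_
    simp [mul_comm (createCoeff u j), h]
  · refine (finite_annih_create X Y).subset fun j hj h => hj ?_
    simp [h]

end GroupLike

theorem IsGroupLike.constOp {g : Op ℂ} (hg : IsGroupLike g) : IsGroupLike (constOp g) := by
  intro X Y u v
  have h := congrArg (MvPowerSeries.C (σ := Time)) (hg X Y u v)
  change (MvPowerSeries.C (σ := Time)).toAddMonoidHom _ =
    (MvPowerSeries.C (σ := Time)).toAddMonoidHom _ at h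
  rw [AddMonoidHom.map_finsum, AddMonoidHom.map_finsum] at h
  · convert h using 1 <;> refine finsum_congr fun j => ?_ <;> simp [CubicHodge.constOp]
  · refine (finite_annih_create v u).subset fun j hj h => hj ?_
    simp [mul_comm (createCoeff u j), h]
  · refine (finite_annih_create X Y).subset fun j hj h => hj ?_
    simp [h]

/-- Toggling a site in both members of a pair of Maya diagrams. -/
def togglePairEquiv : (Maya × Maya) × ℤ ≃ (Maya × Maya) × ℤ where
  toFun x := ((toggle x.1.1 x.2, toggle x.1.2 x.2), x.2)
  invFun x := ((toggle x.1.1 x.2, toggle x.1.2 x.2), x.2)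
  left_inv x := by simp
  right_inv x := by simp

theorem CoeffFinite.mul_mul_sigma {f : Maya → TSeries} {g : Maya → TSeries}
    (hf : CoeffFinite f) (hg : CoeffFinite g) (h : (Maya × Maya) × ℤ → TSeries)
    (hh : ∀ x : Maya × Maya, (Function.support fun j => h (x, j)).Finite) :
    CoeffFinite fun x : (Maya × Maya) × ℤ => f x.1.1 * g x.1.2 * h x :=
  (hf.mul_sigma (g := fun _ => g) fun _ => hg).mul_sigma (g := fun x j => h (x, j)) fun x => .of_finite (hh x)

/-- The bilinear identity is preserved by products. -/
theorem IsGroupLike.opMul {A B : Op TSeries} (hA : IsGroupLike A) (hB : IsGroupLike B)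
    (hrow : RowFinite A) : IsGroupLike (opMul A B) := by
  obtain ⟨c, hc⟩ : ∃ c : Maya → Maya → ℤ → TSeries,
      ∀ X Y j, ((annihCoeff X j * createCoeff Y j : ℤ) : TSeries) = c X Y j := ⟨_, fun _ _ _ => rfl⟩
  have hc' : ∀ u v j, ((createCoeff u j * annihCoeff v j : ℤ) : TSeries) = c v u j := by
    intro u v j; rw [← hc, mul_comm]
  have hctog : ∀ P Q j, c (toggle P j) (toggle Q j) j = c Q P j := by
    intro P Q j
    rw [← hc, ← hc', annihCoeff_toggle_self, createCoeff_toggle_self]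
  have hcfin : ∀ X Y, (Function.support (c X Y)).Finite := by
    intro X Y
    refine (finite_annih_create X Y).subset fun j hj h => hj ?_
    rw [← hc, h, Int.cast_zero]
  simp only [IsGroupLike, hc, hc'] at hA hB ⊢
  clear hc hc'
  have hfin : ∀ (P Q : Maya) (f : ℤ → TSeries), (Function.support fun j => c P Q j * f j).Finite :=
    fun P Q f => (hcfin P Q).subset fun j hj h => hj (by simp only [h, zero_mul])
  have hts : ∀ {f : ℤ → TSeries}, (Function.support f).Finite → ∑ᶠ j, f j = ∑' j, f j :=
    fun hf => (tsum_eq_finsum hf).symm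
  have hA' : ∀ X Y u v : Maya, ∑' j, c X Y j * (A (toggle X j) u * A (toggle Y j) v) =
      ∑' j, c v u j * (A X (toggle u j) * A Y (toggle v j)) := fun X Y u v => by
    rw [← hts (hfin X Y _), ← hts (hfin v u _), hA X Y u v]
  have hB' : ∀ X Y u v : Maya, ∑' j, c X Y j * (B (toggle X j) u * B (toggle Y j) v) =
      ∑' j, c v u j * (B X (toggle u j) * B Y (toggle v j)) := fun X Y u v => by
    rw [← hts (hfin X Y _), ← hts (hfin v u _), hB X Y u v]
  have hAB : ∀ X Y u v : Maya, CubicHodge.opMul A B X u * CubicHodge.opMul A B Y v =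
      ∑' x : Maya × Maya, A X x.1 * A Y x.2 * (B x.1 u * B x.2 v) := by
    intro X Y u v
    exact (((hrow X).mul_right fun P => B P u).tsum_mul_tsum
      ((hrow Y).mul_right fun P => B P v)).trans (tsum_congr fun x => mul_mul_mul_comm _ _ _ _)
  have hABfin : ∀ (X Y : Maya) (f : Maya × Maya → TSeries),
      CoeffFinite fun x : Maya × Maya => A X x.1 * A Y x.2 * f x := fun X Y f =>
    ((hrow X).mul_sigma (g := fun _ => A Y) fun _ => hrow Y).mul_right f
  intro X Y u v
  -- the terms of the double sums at the four stages of the computation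
  let H1 : (Maya × Maya) × ℤ → TSeries := fun x => c X Y x.2 *
    (A (toggle X x.2) x.1.1 * A (toggle Y x.2) x.1.2 * (B x.1.1 u * B x.1.2 v))
  let H2 : (Maya × Maya) × ℤ → TSeries := fun x => c x.1.2 x.1.1 x.2 *
    (A X (toggle x.1.1 x.2) * A Y (toggle x.1.2 x.2)) * (B x.1.1 u * B x.1.2 v)
  let H3 : (Maya × Maya) × ℤ → TSeries := fun x => A X x.1.1 * A Y x.1.2 *
    (c x.1.1 x.1.2 x.2 * (B (toggle x.1.1 x.2) u * B (toggle x.1.2 x.2) v))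
  let H4 : (Maya × Maya) × ℤ → TSeries := fun x => A X x.1.1 * A Y x.1.2 *
    (c v u x.2 * (B x.1.1 (toggle u x.2) * B x.1.2 (toggle v x.2)))
  have f1 : CoeffFinite H1 := by
    let g : ℤ → Maya × Maya → TSeries := fun j x =>
      A (toggle X j) x.1 * A (toggle Y j) x.2 * (B x.1 u * B x.2 v)
    have hg : ∀ j, CoeffFinite (g j) := fun j =>
      hABfin (toggle X j) (toggle Y j) fun x => B x.1 u * B x.2 v
    have h := CoeffFinite.mul_sigma (f := c X Y) (g := g) (.of_finite (hcfin X Y)) hg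
    exact h.comp_injective (e := Equiv.prodComm _ _) (Equiv.prodComm _ _).injective
  have f3 : CoeffFinite H3 := (hrow X).mul_mul_sigma (hrow Y)
    (fun x => c x.1.1 x.1.2 x.2 * (B (toggle x.1.1 x.2) u * B (toggle x.1.2 x.2) v)) fun x =>
    hfin x.1 x.2 fun j => B (toggle x.1 j) u * B (toggle x.2 j) v
  have f4 : CoeffFinite H4 := (hrow X).mul_mul_sigma (hrow Y)
    (fun x => c v u x.2 * (B x.1.1 (toggle u x.2) * B x.1.2 (toggle v x.2))) fun x =>
    hfin v u fun j => B x.1 (toggle u j) * B x.2 (toggle v j)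
  have e23 : ∀ x, H2 x = H3 (togglePairEquiv x) := by
    rintro ⟨⟨P, Q⟩, j⟩
    simp only [H2, H3, togglePairEquiv, Equiv.coe_fn_mk, toggle_toggle, hctog]
    ring
  have f2 : CoeffFinite H2 := by
    rw [funext e23]
    exact f3.comp_injective togglePairEquiv.injective
  rw [hts (hfin X Y _), hts (hfin v u _)]
  have s1 : ∀ j, c X Y j *
      (CubicHodge.opMul A B (toggle X j) u * CubicHodge.opMul A B (toggle Y j) v) =
      ∑' x, H1 (x, j) := fun j =>
    (congrArg _ (hAB (toggle X j) (toggle Y j) u v)).trans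
      ((hABfin (toggle X j) (toggle Y j) fun x => B x.1 u * B x.2 v).mul_tsum _)
  have s2 : ∀ x, ∑' j, H1 (x, j) = ∑' j, H2 (x, j) := by
    intro x
    have e1 := (CoeffFinite.of_finite (hfin X Y fun j =>
      A (toggle X j) x.1 * A (toggle Y j) x.2)).tsum_mul (B x.1 u * B x.2 v)
    have e2 := (CoeffFinite.of_finite (hfin x.2 x.1 fun j =>
      A X (toggle x.1 j) * A Y (toggle x.2 j))).tsum_mul (B x.1 u * B x.2 v)
    rw [hA' X Y x.1 x.2, e2] at e1
    exact (tsum_congr fun j => (mul_assoc _ _ _).symm).trans e1.symm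
  have s3 : ∀ x, ∑' j, H3 (x, j) = ∑' j, H4 (x, j) := by
    intro x
    have e1 := (CoeffFinite.of_finite (hfin x.1 x.2 fun j =>
      B (toggle x.1 j) u * B (toggle x.2 j) v)).mul_tsum (A X x.1 * A Y x.2)
    have e2 := (CoeffFinite.of_finite (hfin v u fun j =>
      B x.1 (toggle u j) * B x.2 (toggle v j))).mul_tsum (A X x.1 * A Y x.2)
    rw [hB' x.1 x.2 u v, e2] at e1
    exact e1.symm
  have s4 : ∀ j, c v u j *
      (CubicHodge.opMul A B X (toggle u j) * CubicHodge.opMul A B Y (toggle v j)) =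
      ∑' x, H4 (x, j) := fun j =>
    (congrArg _ (hAB X Y (toggle u j) (toggle v j))).trans
      (((hABfin X Y fun x => B x.1 (toggle u j) * B x.2 (toggle v j)).mul_tsum _).trans
      (tsum_congr fun x => mul_left_comm _ _ _))
  calc _ = ∑' j, ∑' x, H1 (x, j) := tsum_congr s1
    _ = ∑' x, ∑' j, H1 (x, j) := f1.tsum_prod_right.symm.trans f1.tsum_prod
    _ = ∑' x, ∑' j, H2 (x, j) := tsum_congr s2
    _ = ∑' x, H2 x := f2.tsum_prod.symm
    _ = ∑' x, H3 x := (tsum_congr e23).trans (togglePairEquiv.tsum_eq H3)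
    _ = ∑' x, ∑' j, H3 (x, j) := f3.tsum_prod
    _ = ∑' x, ∑' j, H4 (x, j) := tsum_congr s3
    _ = ∑' j, ∑' x, H4 (x, j) := f4.tsum_prod.symm.trans f4.tsum_prod_right
    _ = _ := (tsum_congr s4).symm

/-! ### Matrices of operators on finite combinations of basis states -/

section Matrix

variable {R : Type} [CommRing R]

/-- The matrix of an operator on finite combinations of basis states. -/
def opMatrix (L : Module.End R (Fock R)) : Op R := fun S S' => L (ket R S') S

variable [TopologicalSpace R]

theorem opMul_opMatrix (L M : Module.End R (Fock R)) :
    opMul (opMatrix L) (opMatrix M) = opMatrix (L * M) := by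
  funext S S'
  change ∑' P, L (ket R P) S * M (ket R S') P = L (M (ket R S')) S
  rw [Fock.map_apply (f := L) (v := M (ket R S')), Finsupp.sum, Finsupp.finsetSum_apply,
    tsum_eq_sum (s := (M (ket R S')).support)]
  · refine Finset.sum_congr rfl fun P _ => ?_
    simp [mul_comm]
  · intro P hP
    rw [Finsupp.notMem_support_iff.1 hP, mul_zero]

omit [TopologicalSpace R] in
theorem opOne_eq_opMatrix : (opOne : Op R) = opMatrix 1 := by
  funext S S'
  classical
  simp only [opOne, opMatrix, Module.End.one_apply, Finsupp.single_apply]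
  congr 1
  exact propext eq_comm

theorem opPow_opMatrix (L : Module.End R (Fock R)) (n : ℕ) :
    opPow (opMatrix L) n = opMatrix (L ^ n) := by
  induction n with
  | zero => rw [opPow, opOne_eq_opMatrix, pow_zero]
  | succ n ih => rw [opPow, ih, opMul_opMatrix, pow_succ]

theorem opPow_opTranspose (L : Module.End R (Fock R)) (n : ℕ) :
    opPow (opTranspose (opMatrix L)) n = opTranspose (opMatrix (L ^ n)) := by
  induction n with
  | zero =>
    rw [opPow, pow_zero, ← opOne_eq_opMatrix]
    funext S S'
    by_cases h : S = S'
    · simp [opTranspose, opOne, h]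
    · simp [opTranspose, opOne, h, Ne.symm h]
  | succ n ih => rw [opPow, ih, ← opTranspose_opMul, opMul_opMatrix, pow_succ']

end Matrix

/-! ### The fermions, currents and their exponentials -/

theorem fermiSign_eq (S : Maya) (n : ℤ) : fermiSign S.1 n = (fsign S n : ℂ) := by
  simp [fermiSign, fsign]

theorem psi_neg_eq (n : ℤ) : psi (-n) = opMatrix (create ℂ n) := by
  funext S S'
  classical
  simp only [psi, neg_neg, opMatrix, create_single, Finsupp.single_apply, one_mul]
  by_cases h : n ∈ S'.1
  · simp [h, createCoeff_of_mem]
  · rw [createCoeff_of_notMem h, fermiSign_eq]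
    have : (toggle S' n).1 = insert n S'.1 := by
      ext m; simp only [mem_toggle, Set.mem_insert_iff]
      by_cases hm : m = n
      · simp [hm, h]
      · simp [hm]
    have h2 : (n ∉ S'.1 ∧ S.1 = insert n S'.1) ↔ toggle S' n = S := by
      rw [← this]
      exact ⟨fun h => (Subtype.ext h.2).symm, fun h' => ⟨h, by rw [h']⟩⟩
    simp only [h2]

theorem psiStar_eq (n : ℤ) : psiStar n = opMatrix (annih ℂ n) := by
  funext S S'
  classical
  simp only [psiStar, opMatrix, annih_single, Finsupp.single_apply, one_mul]
  by_cases h : n ∈ S'.1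
  · rw [annihCoeff_of_mem h, fermiSign_eq]
    have : (toggle S' n).1 = S'.1 \ {n} := by
      ext m; simp only [mem_toggle, Set.mem_sdiff, Set.mem_singleton_iff]
      by_cases hm : m = n
      · simp [hm, h]
      · simp [hm]
    have h2 : (n ∈ S'.1 ∧ S.1 = S'.1 \ {n}) ↔ toggle S' n = S := by
      rw [← this]
      exact ⟨fun h => (Subtype.ext h.2).symm, fun h' => ⟨h, by rw [h']⟩⟩
    simp only [h2]
  · simp [h, annihCoeff_of_notMem]

theorem normalOrd_apply (m n : ℤ) (S S' : Maya) : normalOrd m n S S' =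
    create ℂ m (annih ℂ n (ket ℂ S')) S -
      (if m = n ∧ n ≤ 0 then (1 : ℂ) else 0) * (opOne : Op ℂ) S S' := by
  rw [normalOrd, psi_neg_eq, psiStar_eq, opMul_opMatrix]
  rfl

theorem opJ_eq {k : ℤ} (hk : k ≠ 0) : opJ k = opMatrix (current ℂ k) := by
  funext S S'
  have h : ∀ n, (1 : ℂ) * normalOrd n (n + k) S S' =
      create ℂ n (annih ℂ (n + k) (ket ℂ S')) S := by
    intro n
    rw [normalOrd_apply, if_neg (by omega)]
    ring
  rw [opJ, bilinear, tsum_congr h, opMatrix, current, Finsupp.linearCombination_single, one_smul,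
    finsum_eq_sum _ (finite_hop ℂ S' hk), Finsupp.finsetSum_apply, tsum_eq_sum]
  intro n hn
  simp only [Set.Finite.mem_toFinset, Function.mem_support, not_not] at hn
  rw [hn]; rfl

section Current

variable {R : Type} [CommRing R] [Algebra ℂ R]

theorem current_algebraMap {k : ℤ} (hk : k ≠ 0) (S S' : Maya) :
    current R k (ket R S') S = algebraMap ℂ R (current ℂ k (ket ℂ S') S) := by
  obtain ⟨B, h1, h2⟩ := ((current_eventually hk (ket R S')).and
    (current_eventually hk (ket ℂ S'))).exists
  rw [h1, h2, Finsupp.finsetSum_apply, Finsupp.finsetSum_apply, map_sum]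
  refine Finset.sum_congr rfl fun n _ => ?_
  classical
  simp only [annih_single, create_single, Finsupp.single_apply]
  split_ifs <;> simp

/-- The power series `∑_{k ≥ 1} a_k z^k`. -/
def seriesOfPos (a : ℕ+ → R) : PowerSeries R :=
  PowerSeries.mk fun n => if h : 0 < n then a ⟨n, h⟩ else 0

omit [Algebra ℂ R] in
theorem coeff_zero_seriesOfPos (a : ℕ+ → R) : PowerSeries.coeff 0 (seriesOfPos a) = 0 := by
  rw [seriesOfPos, PowerSeries.coeff_mk, dif_neg (lt_irrefl 0)]

omit [Algebra ℂ R] in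
theorem coeff_seriesOfPos (a : ℕ+ → R) (k : ℕ+) :
    PowerSeries.coeff (k : ℕ) (seriesOfPos a) = a k := by
  rw [seriesOfPos, PowerSeries.coeff_mk, dif_pos k.pos]; rfl

variable [TopologicalSpace R]

theorem currentPos_eq (a : ℕ+ → R) : currentPos a = opMatrix (currentSum (seriesOfPos a)) := by
  funext S S'
  have h : ∀ k : ℕ+, opJ (k : ℤ) S S' • a k = (fun n : ℕ =>
      PowerSeries.coeff n (seriesOfPos a) * current R n (ket R S') S) k := by
    intro k
    have hk : ((k : ℕ) : ℤ) ≠ 0 := by exact_mod_cast k.ne_zero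
    simp only
    rw [coeff_seriesOfPos, opJ_eq hk, current_algebraMap hk, Algebra.smul_def, mul_comm]
    rfl
  have h2 := Function.Injective.tsum_eq (g := fun k : ℕ+ => (k : ℕ)) PNat.coe_injective
    (f := fun n : ℕ => PowerSeries.coeff n (seriesOfPos a) * current R n (ket R S') S) fun n hn => by
      rcases Nat.eq_zero_or_pos n with rfl | h0
      · exact absurd (by simp only [coeff_zero_seriesOfPos, zero_mul]) hn
      · exact ⟨⟨n, h0⟩, rfl⟩
  rw [currentPos, tsum_congr h, h2, opMatrix, currentSum,
    Finsupp.linearCombination_single, one_smul, Finsupp.finsetSum_apply,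
    tsum_eq_sum (s := Finset.range ((energy S').toNat + 1))]
  · rfl
  · intro n hn
    rw [Finset.mem_range, not_lt] at hn
    rw [current_ket_eq_zero (by omega)]
    simp

theorem currentNeg_eq (a : ℕ+ → R) : currentNeg a = opTranspose (currentPos a) := by
  funext S S'
  refine tsum_congr fun k => ?_
  have hk : ((k : ℕ) : ℤ) ≠ 0 := by exact_mod_cast k.ne_zero
  rw [opJ_eq hk, opJ_eq (neg_ne_zero.2 hk), opMatrix, opMatrix, current_transpose hk]

theorem opExp_currentSum {p : PowerSeries R} (hp : PowerSeries.coeff 0 p = 0) :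
    opExp (opMatrix (currentSum p)) = expOp p := by
  funext S S'
  rw [opExp, expOp, currentExp, Finsupp.linearCombination_single, one_smul,
    Finsupp.finsetSum_apply, tsum_eq_sum (s := Finset.range ((energy S').toNat + 1))]
  · refine Finset.sum_congr rfl fun n _ => ?_
    rw [opPow_opMatrix]; rfl
  · intro n hn
    rw [Finset.mem_range, not_lt] at hn
    rw [opPow_opMatrix, opMatrix, currentSum_pow_ket_eq_zero hp (by omega)]
    simp

theorem opExp_opTranspose (L : Module.End R (Fock R)) :
    opExp (opTranspose (opMatrix L)) = opTranspose (opExp (opMatrix L)) := by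
  funext S S'
  refine tsum_congr fun n => ?_
  rw [opPow_opTranspose, opPow_opMatrix]
  rfl

theorem opExp_currentPos (a : ℕ+ → R) : opExp (currentPos a) = expOp (seriesOfPos a) := by
  rw [currentPos_eq, opExp_currentSum (coeff_zero_seriesOfPos a)]

theorem opExp_currentNeg (a : ℕ+ → R) :
    opExp (currentNeg a) = opTranspose (expOp (seriesOfPos a)) := by
  rw [currentNeg_eq, currentPos_eq, opExp_opTranspose, opExp_currentSum (coeff_zero_seriesOfPos a)]

end Current

/-! ### Diagonal operators -/

open Classical in
/-- The diagonal operator with eigenvalues `d`. -/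
def opDiag (d : Maya → ℂ) : Op ℂ := fun S S' => if S = S' then d S else 0

theorem opDiag_opMul (d : Maya → ℂ) (A : Op ℂ) :
    opMul (opDiag d) A = fun S S' => d S * A S S' := by
  funext S S'
  rw [opMul, tsum_eq_single S]
  · simp [opDiag]
  · intro P hP
    simp [opDiag, hP.symm]

theorem opMul_opDiag (d : Maya → ℂ) (A : Op ℂ) :
    opMul A (opDiag d) = fun S S' => A S S' * d S' := by
  funext S S'
  rw [opMul, tsum_eq_single S']
  · simp [opDiag]
  · intro P hP
    simp [opDiag, hP]

theorem smul_opDiag (c : ℂ) (d : Maya → ℂ) : c • opDiag d = opDiag fun S => c * d S := by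
  funext S S'
  simp [opDiag]

theorem opDiag_add (d e : Maya → ℂ) : opDiag d + opDiag e = opDiag fun S => d S + e S := by
  funext S S'
  by_cases h : S = S' <;> simp [opDiag, h]

theorem opExp_opDiag (d : Maya → ℂ) : opExp (opDiag d) = opDiag fun S => Complex.exp (d S) := by
  have hpow : ∀ n, opPow (opDiag d) n = opDiag fun S => d S ^ n := by
    intro n
    induction n with
    | zero => funext S S'; simp [opPow, opOne, opDiag]
    | succ n ih =>
      rw [opPow, ih, opMul_opDiag]
      funext S S'
      by_cases h : S = S'
      · simp [opDiag, h, pow_succ]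
      · simp [opDiag, h]
  funext S S'
  rw [opExp]
  by_cases h : S = S'
  · subst h
    simp only [hpow, opDiag, if_true]
    rw [Complex.exp_eq_exp_ℂ, NormedSpace.exp_eq_tsum (𝕂 := ℂ)]
  · simp [hpow, opDiag, h]

theorem opQpow_opDiag (ħ : ℂ) (d : Maya → ℂ) :
    opQpow ħ (opDiag d) = opDiag fun S => qpow ħ (d S) := by
  rw [opQpow, smul_opDiag, opExp_opDiag]
  simp only [qpow, mul_comm]

/-- A bilinear `∑ a_n :ψ_{-n} ψ*_n:` is diagonal in the basis of states. -/
theorem bilinear_zero (a : ℤ → ℂ) : bilinear a 0 = opDiag (weight a) := by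
  have h : ∀ (S S' : Maya) n, normalOrd n n S S' = opDiag (fun S => (occ S n : ℂ)) S S' := by
    intro S S' n
    classical
    unfold opDiag
    rw [normalOrd_apply, annih_single, create_single, toggle_toggle, createCoeff_toggle_self,
      one_mul, Finsupp.single_apply, opOne]
    by_cases hS : S = S'
    · subst hS
      have hs : ((fsign S n : ℤ) : ℂ) * (fsign S n : ℤ) = 1 := by
        exact_mod_cast fsign_mul_self S n
      rw [if_pos rfl, if_pos rfl, if_pos rfl]
      by_cases hn : n ∈ S.1
      · rw [annihCoeff_of_mem hn, hs]
        by_cases h0 : 0 < n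
        · simp [occ, hn, h0]
        · simp [occ, hn, h0, not_lt.1 h0]
      · rw [annihCoeff_of_notMem hn]
        by_cases h0 : 0 < n
        · simp [occ, hn, h0]
        · simp [occ, hn, h0, not_lt.1 h0]
    · rw [if_neg (Ne.symm hS), if_neg hS, if_neg hS]
      simp
  funext S S'
  simp only [bilinear, add_zero, h]
  by_cases hS : S = S'
  · simp only [opDiag, hS, if_true]
    rw [tsum_eq_finsum]
    · refine finsum_congr fun n => ?_
      simp [mul_comm]
    · exact (finite_occ S').subset fun n hn h0 => hn (by simp [h0])
  · simp [opDiag, hS]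

/-! ### Maya diagrams and partitions -/

theorem strictAnti_state (ν : YoungDiagram) (s : ℤ) :
    StrictAnti fun i : ℕ => (ν.rowLen i : ℤ) - i + s := by
  refine strictAnti_nat_of_succ_lt fun i => ?_
  have := ν.rowLen_anti i (i + 1) (Nat.le_succ i)
  push_cast; omega

theorem rowLen_eq_zero {ν : YoungDiagram} {i : ℕ} (h : ν.colLen 0 ≤ i) : ν.rowLen i = 0 := by
  by_contra hne
  have h1 : (i, 0) ∈ ν := YoungDiagram.mem_iff_lt_rowLen.2 (Nat.pos_of_ne_zero hne)
  have h2 := YoungDiagram.mem_iff_lt_colLen.1 h1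
  omega

theorem state_tail (ν : YoungDiagram) (s : ℤ) :
    ∀ i ≥ ν.colLen 0, (ν.rowLen i : ℤ) - i + s = s - i := by
  intro i hi
  rw [rowLen_eq_zero hi]; push_cast; ring

theorem youngDiagram_ext_rowLen {ν ν' : YoungDiagram} (h : ∀ i, ν.rowLen i = ν'.rowLen i) :
    ν = ν' := by
  refine SetLike.ext fun c => ?_
  rw [← Prod.mk.eta (p := c), YoungDiagram.mem_iff_lt_rowLen, YoungDiagram.mem_iff_lt_rowLen, h]

theorem state_injective (s : ℤ) : Function.Injective fun ν => state ν s := by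
  intro ν ν' h
  have h1 : Set.range (fun i : ℕ => (ν.rowLen i : ℤ) - i + s) =
      Set.range (fun i : ℕ => (ν'.rowLen i : ℤ) - i + s) := congrArg Subtype.val h
  have h2 := (StrictMono.range_inj (γ := ℤᵒᵈ) (strictAnti_state ν s) (strictAnti_state ν' s)).1 h1
  refine youngDiagram_ext_rowLen fun i => ?_
  have h3 : (ν.rowLen i : ℤ) - i + s = (ν'.rowLen i : ℤ) - i + s := congrFun h2 i
  omega

theorem exists_youngDiagram {f : ℕ → ℕ} (hf : Antitone f) {l : ℕ} (hl : ∀ i ≥ l, f i = 0) :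
    ∃ ν : YoungDiagram, ∀ i, ν.rowLen i = f i := by
  have hmem : ∀ c : ℕ × ℕ, c ∈ (Finset.range l ×ˢ Finset.range (f 0)).filter
      (fun c => c.2 < f c.1) ↔ c.2 < f c.1 := by
    intro c
    simp only [Finset.mem_filter, Finset.mem_product, Finset.mem_range, and_iff_right_iff_imp]
    intro h
    refine ⟨?_, h.trans_le (hf (Nat.zero_le _))⟩
    by_contra h'
    rw [hl _ (not_lt.1 h')] at h
    omega
  refine ⟨⟨(Finset.range l ×ˢ Finset.range (f 0)).filter (fun c => c.2 < f c.1), ?_⟩, fun i => ?_⟩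
  · intro c d hdc hc
    rw [Finset.mem_coe, hmem] at hc ⊢
    exact (hdc.2.trans_lt hc).trans_le (hf hdc.1)
  · refine eq_of_forall_lt_iff fun j => ?_
    rw [← YoungDiagram.mem_iff_lt_rowLen]
    exact hmem (i, j)

/-- Every Maya diagram belongs to a partition and a charge. -/
theorem exists_eq_state (S : Maya) : ∃ ν s, S = state ν s := by
  suffices h : ∃ f : ℕ → ℕ, Antitone f ∧ (∃ l, ∀ i ≥ l, f i = 0) ∧
      ∃ s : ℤ, S.1 = Set.range fun i : ℕ => (f i : ℤ) - i + s by
    obtain ⟨f, hf, ⟨l, hl⟩, s, hS⟩ := h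
    obtain ⟨ν, hν⟩ := exists_youngDiagram hf hl
    refine ⟨ν, s, Subtype.ext ?_⟩
    rw [hS]
    change _ = Set.range fun i : ℕ => (ν.rowLen i : ℤ) - i + s
    simp only [hν]
  induction S using Maya.induction_top with
  | h0 N =>
    refine ⟨fun _ => 0, fun _ _ _ => le_rfl, ⟨0, fun _ _ => rfl⟩, N, ?_⟩
    ext n
    rw [mem_ground, Set.mem_range]
    constructor
    · intro h; exact ⟨(N - n).toNat, by push_cast; omega⟩
    · rintro ⟨i, rfl⟩; push_cast; omega
  | h1 S j hj ih =>
    obtain ⟨f, hf, ⟨l, hl⟩, s, hS⟩ := ih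
    have h0 : (f 0 : ℤ) + s < j := hj _ (by rw [hS]; exact ⟨0, by simp⟩)
    obtain ⟨g, hg0, hg⟩ : ∃ g : ℕ → ℕ, g 0 = (j - s - 1).toNat ∧ ∀ i, g (i + 1) = f i :=
      ⟨fun i => Nat.casesOn i (j - s - 1).toNat f, rfl, fun _ => rfl⟩
    refine ⟨g, ?_, ⟨l + 1, ?_⟩, s + 1, ?_⟩
    · refine antitone_nat_of_succ_le fun i => ?_
      cases i with
      | zero => rw [hg, hg0]; omega
      | succ i => rw [hg, hg]; exact hf (Nat.le_succ i)
    · intro i hi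
      obtain ⟨i, rfl⟩ := Nat.exists_eq_add_of_le' (show 1 ≤ i by omega)
      rw [hg]
      exact hl i (by omega)
    · ext n
      rw [mem_toggle, Set.mem_range]
      constructor
      · rintro (⟨hn, -⟩ | ⟨rfl, -⟩)
        · rw [hS] at hn
          obtain ⟨i, rfl⟩ := hn
          exact ⟨i + 1, by simp only [hg]; push_cast; ring⟩
        · exact ⟨0, by simp only [hg0]; push_cast; omega⟩
      · rintro ⟨i, rfl⟩
        cases i with
        | zero =>
          right
          have e : ((g 0 : ℕ) : ℤ) - ((0 : ℕ) : ℤ) + (s + 1) = j := by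
            rw [hg0]; push_cast; omega
          refine ⟨e, fun h => ?_⟩
          have := hj _ h
          omega
        | succ i =>
          left
          have h1 : (f i : ℤ) - ((i + 1 : ℕ) : ℤ) + (s + 1) ∈ S.1 := by
            rw [hS]; exact ⟨i, by push_cast; ring⟩
          simp only [hg]
          exact ⟨h1, (hj _ h1).ne⟩

/-! ### Eigenvalues on the states -/

/-- The eigenvalue of `∑ a_n :ψ_{-n} ψ*_n:` on `|s⟩` is the discrete primitive of `a` that
vanishes at `s = 0`. -/
theorem weight_ground {M : Type*} [AddCommGroup M] {a F : ℤ → M} (h0 : F 0 = 0)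
    (h1 : ∀ s, F (s + 1) = F s + a (s + 1)) (s : ℤ) : weight a (ground s) = F s := by
  have hstep : ∀ s, weight a (ground (s + 1)) = weight a (ground s) + a (s + 1) := by
    intro s
    have h : toggle (ground s) (s + 1) = ground (s + 1) := Maya.ext_mem fun n => by
      rw [mem_toggle, mem_ground, mem_ground]; omega
    rw [← h, weight_toggle_of_notMem]
    rw [mem_ground]; omega
  induction s using Int.induction_on with
  | zero =>
    rw [h0]
    refine finsum_eq_zero_of_forall_eq_zero fun n => ?_
    unfold occ
    by_cases h : n ≤ 0
    · rw [if_pos (mem_ground.2 h), if_neg (not_lt.2 h), zero_smul]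
    · rw [if_neg fun h' => h (mem_ground.1 h'), if_pos (not_le.1 h), zero_smul]
  | succ i ih => rw [hstep, ih, h1]
  | pred i ih =>
    have e1 := hstep (-(i : ℤ) - 1)
    have e2 := h1 (-(i : ℤ) - 1)
    rw [sub_add_cancel] at e1 e2
    rw [ih, e2] at e1
    exact (add_right_cancel e1).symm

theorem weight_state {M : Type*} [AddCommGroup M] (a : ℤ → M) (ν : YoungDiagram) (s : ℤ) :
    weight a (state ν s) = weight a (ground s) + ∑ i ∈ Finset.range (ν.colLen 0),
      (a ((ν.rowLen i : ℤ) - i + s) - a (s - i)) := by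
  rw [weight_eq_sum a (strictAnti_state ν s) (state_tail ν s) rfl,
    weight_eq_sum a (S := ground s) (f := fun i : ℕ => s - i) (l := ν.colLen 0) (s := s),
    add_assoc, ← Finset.sum_add_distrib]
  · simp
  · intro i j h; simp only; omega
  · intro i _; rfl
  · ext n
    rw [mem_ground, Set.mem_range]
    constructor
    · intro h; exact ⟨(s - n).toNat, by omega⟩
    · rintro ⟨i, rfl⟩; omega

theorem charge_state (ν : YoungDiagram) (s : ℤ) : charge (state ν s) = s := by
  rw [charge, weight_state, weight_ground (F := fun s => s) rfl fun s => rfl]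
  simp

theorem charge_ground (s : ℤ) : charge (ground s) = s := charge_state ⊥ s

theorem card_eq_sum_rowLen (ν : YoungDiagram) :
    ν.card = ∑ i ∈ Finset.range (ν.colLen 0), ν.rowLen i := by
  rw [YoungDiagram.card, Finset.card_eq_sum_card_fiberwise (f := Prod.fst)
    (t := Finset.range (ν.colLen 0))]
  · refine Finset.sum_congr rfl fun i _ => ?_
    rw [YoungDiagram.rowLen_eq_card]
    rfl
  · intro c hc
    have h1 : (c.1, 0) ∈ ν := ν.up_left_mem le_rfl (Nat.zero_le c.2) hc
    simpa using YoungDiagram.mem_iff_lt_colLen.1 h1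

/-- The eigenvalue of `K/2 + c L₀ + (c² - c) J₀ / 2`. -/
def shiftedKWeight (c : ℂ) (S : Maya) : ℂ :=
  1 / 2 * weight (fun n : ℤ => ((n : ℂ) - 1 / 2) ^ 2) S + c * weight (fun n : ℤ => (n : ℂ)) S +
    (c ^ 2 - c) / 2 * weight (fun _ => (1 : ℂ)) S

theorem shiftedK_eq (c : ℂ) : shiftedK c = opDiag (shiftedKWeight c) := by
  rw [shiftedK, opK, opL0, opJ, bilinear_zero, bilinear_zero, bilinear_zero, smul_opDiag,
    smul_opDiag, smul_opDiag, opDiag_add, opDiag_add]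
  rfl

theorem shiftedKWeight_toggle (c : ℂ) {X Y : Maya} {j : ℤ} (hX : j ∈ X.1) (hY : j ∉ Y.1) :
    shiftedKWeight c (toggle X j) + shiftedKWeight c (toggle Y j) =
      shiftedKWeight c X + shiftedKWeight c Y := by
  simp only [shiftedKWeight, weight_toggle_of_mem _ hX, weight_toggle_of_notMem _ hY]
  ring

/-- The eigenvalue of `K/2 + c L₀ + (c² - c) J₀ / 2` on `|ν, s⟩` is that of `K/2` at the shifted
charge `s + c`, up to a constant. -/
theorem shiftedKWeight_state (c : ℂ) (ν : YoungDiagram) (s : ℤ) :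
    shiftedKWeight c (state ν s) = sExponent ν (s + c) - (4 * c ^ 3 - c) / 24 := by
  have hK := weight_ground (a := fun n : ℤ => ((n : ℂ) - 1 / 2) ^ 2)
    (F := fun s => (4 * (s : ℂ) ^ 3 - s) / 12) (by simp) (fun s => by push_cast; ring) s
  have hL := weight_ground (a := fun n : ℤ => (n : ℂ))
    (F := fun s => (s : ℂ) * (s + 1) / 2) (by simp) (fun s => by push_cast; ring) s
  have hJ := weight_ground (a := fun n : ℤ => (1 : ℂ))
    (F := fun s => (s : ℂ)) (by simp) (fun s => by push_cast; ring) s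
  have hsum : 1 / 2 * ∑ i ∈ Finset.range (ν.colLen 0),
        (((((ν.rowLen i : ℤ) - i + s : ℤ) : ℂ) - 1 / 2) ^ 2 - (((s - i : ℤ) : ℂ) - 1 / 2) ^ 2) +
      c * ∑ i ∈ Finset.range (ν.colLen 0),
        ((((ν.rowLen i : ℤ) - i + s : ℤ) : ℂ) - ((s - i : ℤ) : ℂ)) =
      (kappa ν : ℂ) / 2 + (s + c) * (ν.card : ℂ) := by
    rw [card_eq_sum_rowLen, kappa]
    push_cast
    rw [Finset.mul_sum, Finset.mul_sum, Finset.mul_sum, Finset.sum_div, ← Finset.sum_add_distrib,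
      ← Finset.sum_add_distrib]
    refine Finset.sum_congr rfl fun i _ => ?_
    ring
  rw [shiftedKWeight, weight_state, weight_state, weight_state, hK, hL, hJ, sExponent]
  simp only [sub_self, Finset.sum_const_zero, add_zero]
  linear_combination hsum

/-! ### Schur functions as matrix elements -/

/-- The Schur function `S_ν` is the matrix element `⟨s|exp (∑ (p_k/k) J_k)|ν, s⟩`: the
exponential turns each creation operator of `|ν, s⟩` into a combination with coefficients `S_m`,
and Wick's theorem gives the determinant. -/
theorem schur_eq_expOp (ν : YoungDiagram) (p a : ℕ+ → TSeries)
    (hpa : ∀ k : ℕ+, (((k : ℕ) : ℂ)⁻¹) • p k = a k) (s : ℤ) :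
    schur ν p = expOp (seriesOfPos a) (ground s) (state ν s) := by
  rw [expOp, ket_eq_prod (strictAnti_state ν s) (state_tail ν s) rfl,
    currentExp_prod (coeff_zero_seriesOfPos a), currentExp_ground (coeff_zero_seriesOfPos a),
    prod_apply_ground _ _ (fun i m v => annih_fieldOp _ _ _ _) s, schur]
  have hser : (PowerSeries.mk fun n : ℕ =>
        if h : 0 < n then ((n : ℂ)⁻¹) • p ⟨n, h⟩ else (0 : TSeries)) = seriesOfPos a := by
    ext1 n
    rw [seriesOfPos, PowerSeries.coeff_mk, PowerSeries.coeff_mk]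
    split_ifs with h
    · exact hpa ⟨n, h⟩
    · rfl
  congr 1
  funext i j
  simp only [Matrix.of_apply]
  rw [schurRow, hser, coeffInt, expSeries]
  have e : (ν.rowLen i : ℤ) - (i : ℕ) + s - (s - (j : ℕ)) = (ν.rowLen i : ℤ) - (i : ℕ) + (j : ℕ) := by
    ring
  rw [e]

/-! ### Translation invariance -/

/-- Translation of a Maya diagram by `s`. -/
def shiftMaya (s : ℤ) (S : Maya) : Maya := ⟨{n | n - s ∈ S.1}, by
  obtain ⟨N, hN⟩ := S.bddAbove
  obtain ⟨M, hM⟩ := S.exists_Iic_subset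
  constructor
  · refine (Set.finite_Icc 0 (N + s)).subset fun n hn => ?_
    have := hN _ hn.1
    have := hn.2
    rw [Set.mem_Icc]; omega
  · refine (Set.finite_Icc (M + s) 0).subset fun n hn => ?_
    rw [Set.mem_Icc]
    refine ⟨?_, hn.2⟩
    by_contra h
    exact hn.1 (hM _ (by omega))⟩

theorem mem_shiftMaya {s n : ℤ} {S : Maya} : n ∈ (shiftMaya s S).1 ↔ n - s ∈ S.1 := Iff.rfl

/-- Translation as a bijection of the Maya diagrams. -/
def shiftEquiv (s : ℤ) : Maya ≃ Maya where
  toFun := shiftMaya s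
  invFun := shiftMaya (-s)
  left_inv S := Maya.ext_mem fun n => by simp [mem_shiftMaya]
  right_inv S := Maya.ext_mem fun n => by simp [mem_shiftMaya]

theorem toggle_shift (s j : ℤ) (S : Maya) :
    toggle (shiftEquiv s S) (j + s) = shiftEquiv s (toggle S j) := Maya.ext_mem fun n => by
  rw [mem_toggle]
  change (n - s ∈ S.1 ∧ _) ∨ (_ ∧ n - s ∉ S.1) ↔ n - s ∈ (toggle S j).1
  rw [mem_toggle]
  constructor <;> rintro (⟨h1, h2⟩ | ⟨h1, h2⟩)
  · exact Or.inl ⟨h1, by omega⟩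
  · exact Or.inr ⟨by omega, h2⟩
  · exact Or.inl ⟨h1, by omega⟩
  · exact Or.inr ⟨by omega, h2⟩

theorem fsign_shift (s j : ℤ) (S : Maya) : fsign (shiftEquiv s S) (j + s) = fsign S j := by
  unfold fsign
  have : {m | m ∈ (shiftEquiv s S).1 ∧ j + s < m} = (fun m => m + s) '' {m | m ∈ S.1 ∧ j < m} := by
    ext m
    constructor
    · rintro ⟨h1, h2⟩; exact ⟨m - s, ⟨h1, by omega⟩, by simp⟩
    · rintro ⟨m, ⟨h1, h2⟩, rfl⟩
      exact ⟨mem_shiftMaya.2 (by simpa using h1), by simp only; omega⟩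
  rw [this, Set.ncard_image_of_injective _ (add_left_injective s)]

theorem createCoeff_shift (s j : ℤ) (S : Maya) :
    createCoeff (shiftEquiv s S) (j + s) = createCoeff S j := by
  have : j + s ∈ (shiftEquiv s S).1 ↔ j ∈ S.1 := by
    rw [shiftEquiv, Equiv.coe_fn_mk, mem_shiftMaya, add_sub_cancel_right]
  by_cases h : j ∈ S.1
  · rw [createCoeff_of_mem (this.2 h), createCoeff_of_mem h]
  · rw [createCoeff_of_notMem (mt this.1 h), createCoeff_of_notMem h, fsign_shift]

theorem annihCoeff_shift (s j : ℤ) (S : Maya) :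
    annihCoeff (shiftEquiv s S) (j + s) = annihCoeff S j := by
  have : j + s ∈ (shiftEquiv s S).1 ↔ j ∈ S.1 := by
    rw [shiftEquiv, Equiv.coe_fn_mk, mem_shiftMaya, add_sub_cancel_right]
  by_cases h : j ∈ S.1
  · rw [annihCoeff_of_mem (this.2 h), annihCoeff_of_mem h, fsign_shift]
  · rw [annihCoeff_of_notMem (mt this.1 h), annihCoeff_of_notMem h]

/-- Operators that commute with translations. -/
def IsShiftInvariant (A : Op ℂ) : Prop :=
  ∀ s S S', A (shiftEquiv s S) (shiftEquiv s S') = A S S'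

theorem IsShiftInvariant.opMul {A B : Op ℂ} (hA : IsShiftInvariant A) (hB : IsShiftInvariant B) :
    IsShiftInvariant (opMul A B) := by
  intro s S S'
  rw [CubicHodge.opMul, ← (shiftEquiv s).tsum_eq]
  exact tsum_congr fun P => by rw [hA, hB]

theorem isShiftInvariant_opOne : IsShiftInvariant opOne := by
  intro s S S'
  by_cases h : S = S'
  · rw [opOne, opOne, if_pos h, if_pos (congrArg _ h)]
  · rw [opOne, opOne, if_neg h, if_neg fun h' => h ((shiftEquiv s).injective h')]

theorem IsShiftInvariant.opExp {A : Op ℂ} (hA : IsShiftInvariant A) :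
    IsShiftInvariant (opExp A) := by
  have hpow : ∀ n, IsShiftInvariant (opPow A n) := by
    intro n
    induction n with
    | zero => exact isShiftInvariant_opOne
    | succ n ih => exact ih.opMul hA
  intro s S S'
  exact tsum_congr fun n => by rw [hpow]

theorem isShiftInvariant_opJ {k : ℤ} (hk : k ≠ 0) : IsShiftInvariant (opJ k) := by
  intro s S S'
  rw [opJ, bilinear, ← (Equiv.addRight s).tsum_eq]
  refine tsum_congr fun n => ?_
  rw [Equiv.coe_addRight, normalOrd_apply, normalOrd_apply, if_neg (by omega), if_neg (by omega)]
  classical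
  rw [annih_single, annih_single, create_single, create_single,
    show n + s + k = n + k + s by ring, toggle_shift, toggle_shift, annihCoeff_shift,
    createCoeff_shift, Finsupp.single_apply, Finsupp.single_apply]
  simp

theorem isShiftInvariant_GammaGamma (ħ : ℂ) : IsShiftInvariant (GammaGamma ħ) := by
  refine IsShiftInvariant.opMul (IsShiftInvariant.opExp ?_) (IsShiftInvariant.opExp ?_)
  · intro s S S'
    exact tsum_congr fun k => by
      rw [isShiftInvariant_opJ (neg_ne_zero.2 (by exact_mod_cast k.ne_zero))]
  · intro s S S'
    exact tsum_congr fun k => by rw [isShiftInvariant_opJ (by exact_mod_cast k.ne_zero)]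

theorem state_eq_shift (ν : YoungDiagram) (s : ℤ) : state ν s = shiftEquiv s (state ν 0) := by
  refine Maya.ext_mem fun n => ?_
  change n ∈ Set.range (fun i : ℕ => (ν.rowLen i : ℤ) - i + s) ↔
    n - s ∈ Set.range (fun i : ℕ => (ν.rowLen i : ℤ) - i + 0)
  simp only [Set.mem_range]
  exact exists_congr fun i => by constructor <;> intro h <;> omega

theorem GammaGamma_state (ħ : ℂ) (ν ν' : YoungDiagram) (s : ℤ) :
    GammaGamma ħ (state ν s) (state ν' s) = GammaGamma ħ (state ν 0) (state ν' 0) := by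
  rw [state_eq_shift ν s, state_eq_shift ν' s, isShiftInvariant_GammaGamma]

/-! ### Exponentials with coefficientwise finite rows -/

theorem rowFinite_opOne : RowFinite opOne := by
  intro S
  refine CoeffFinite.of_finite ((Set.finite_singleton S).subset fun P hP => ?_)
  by_contra h
  exact hP (if_neg (Ne.symm h))

theorem RowFinite.opPow {A : Op TSeries} (hA : RowFinite A) (n : ℕ) : RowFinite (opPow A n) := by
  induction n with
  | zero => exact rowFinite_opOne
  | succ n ih => exact ih.opMul hA

/-- The `n`-th power of an operator whose matrix elements have no constant term starts in degree
`n`. -/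
theorem le_degree_of_coeff_opPow_ne_zero {A : Op TSeries} (hA : RowFinite A)
    (h0 : ∀ S S', MvPowerSeries.constantCoeff (A S S') = 0) {n : ℕ} {d : Time →₀ ℕ}
    {S S' : Maya} (h : MvPowerSeries.coeff d (opPow A n S S') ≠ 0) : n ≤ d.degree := by
  induction n generalizing d S' with
  | zero => exact Nat.zero_le _
  | succ n ih =>
    obtain ⟨P, hP⟩ := ((hA.opPow n S).mul_right fun P => A P S').exists_of_coeff_tsum_ne_zero h
    obtain ⟨x, hx, h1, h2⟩ := exists_of_coeff_mul_ne_zero hP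
    have h3 := ih h1
    rw [Finset.HasAntidiagonal.mem_antidiagonal] at hx
    have h4 : x.2 ≠ 0 := by
      intro h
      rw [h] at h2
      exact h2 (h0 P S')
    have h5 : x.2.degree ≠ 0 := fun h => h4 (Finsupp.degree_eq_zero_iff x.2 |>.1 h)
    rw [← hx, map_add]
    omega

theorem RowFinite.opExp {A : Op TSeries} (hA : RowFinite A)
    (h0 : ∀ S S', MvPowerSeries.constantCoeff (A S S') = 0) : RowFinite (opExp A) := by
  intro S d
  have hfin : ∀ S', CoeffFinite fun n : ℕ => ((n.factorial : ℂ)⁻¹) • CubicHodge.opPow A n S S' := by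
    intro S' d
    refine (Set.finite_Iic d.degree).subset fun n hn => ?_
    refine le_degree_of_coeff_opPow_ne_zero hA h0 (S := S) (S' := S') fun h => hn ?_
    rw [MvPowerSeries.coeff_smul, h, mul_zero]
  have : (⋃ n ∈ Set.Iic d.degree, {S' | MvPowerSeries.coeff d (CubicHodge.opPow A n S S') ≠ 0}).Finite :=
    (Set.finite_Iic _).biUnion fun n _ => hA.opPow n S d
  refine this.subset fun S' hS' => ?_
  obtain ⟨n, hn⟩ := (hfin S').exists_of_coeff_tsum_ne_zero hS'
  have h1 : MvPowerSeries.coeff d (CubicHodge.opPow A n S S') ≠ 0 := fun h => hn (by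
    rw [MvPowerSeries.coeff_smul, h, mul_zero])
  simp only [Set.mem_iUnion]
  exact ⟨n, le_degree_of_coeff_opPow_ne_zero hA h0 h1, h1⟩

theorem finite_support_opJ (S : Maya) {k : ℤ} (hk : k ≠ 0) :
    (Function.support (opJ k S)).Finite := by
  refine (current ℂ (-k) (ket ℂ S)).hasFiniteSupport.subset fun S' h => ?_
  rw [Function.mem_support, opJ_eq hk, opMatrix, current_transpose hk] at h
  exact h

theorem rowFinite_currentPos {a : ℕ+ → TSeries} (ha : CoeffFinite a) :
    RowFinite (currentPos a) := by
  have key : ∀ S, CoeffFinite fun x : ℕ+ × Maya => opJ (x.1 : ℤ) S x.2 • a x.1 := by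
    intro S d
    have : (⋃ k ∈ {k | MvPowerSeries.coeff d (a k) ≠ 0},
        (fun S' => (k, S')) '' Function.support (opJ (k : ℤ) S)).Finite :=
      (ha d).biUnion fun k _ => (finite_support_opJ S (by exact_mod_cast k.ne_zero)).image _
    refine this.subset ?_
    rintro ⟨k, S'⟩ h
    rw [Set.mem_ofPred_eq, MvPowerSeries.coeff_smul] at h
    simp only [Set.mem_iUnion]
    exact ⟨k, right_ne_zero_of_mul h, S', left_ne_zero_of_mul h, rfl⟩
  intro S d
  refine ((key S d).image Prod.snd).subset fun S' hS' => ?_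
  obtain ⟨k, hk⟩ := ((key S).comp_injective (e := fun k => (k, S'))
    fun a b h => (Prod.ext_iff.1 h).1).exists_of_coeff_tsum_ne_zero hS'
  exact ⟨(k, S'), hk, rfl⟩

theorem constantCoeff_currentPos {a : ℕ+ → TSeries} (ha : CoeffFinite a)
    (h0 : ∀ k, MvPowerSeries.constantCoeff (a k) = 0) (S S' : Maya) :
    MvPowerSeries.constantCoeff (currentPos a S S') = 0 := by
  have : CoeffFinite fun k : ℕ+ => opJ (k : ℤ) S S' • a k := fun d =>
    (ha d).subset fun k hk h => hk (by rw [MvPowerSeries.coeff_smul, h, mul_zero])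
  by_contra h
  rw [← MvPowerSeries.coeff_zero_eq_constantCoeff_apply] at h
  obtain ⟨k, hk⟩ := this.exists_of_coeff_tsum_ne_zero h
  exact hk (by rw [MvPowerSeries.coeff_smul, MvPowerSeries.coeff_zero_eq_constantCoeff_apply, h0,
    mul_zero])

theorem rowFinite_expOp {a : ℕ+ → TSeries} (ha : CoeffFinite a)
    (h0 : ∀ k, MvPowerSeries.constantCoeff (a k) = 0) : RowFinite (expOp (seriesOfPos a)) := by
  rw [← opExp_currentPos]
  exact (rowFinite_currentPos ha).opExp (constantCoeff_currentPos ha h0)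

theorem coeffFinite_X {i : ℕ+ → Time} (hi : Function.Injective i) :
    CoeffFinite fun k => MvPowerSeries.X (i k) := by
  classical
  intro d
  refine Set.Subsingleton.finite fun k hk l hl => ?_
  simp only [Set.mem_ofPred_eq, MvPowerSeries.coeff_X] at hk hl
  have h1 : d = Finsupp.single (i k) 1 := by_contra fun h => hk (if_neg h)
  have h2 : d = Finsupp.single (i l) 1 := by_contra fun h => hl (if_neg h)
  exact hi (Finsupp.single_left_injective one_ne_zero (h1.symm.trans h2))

theorem rowFinite_expOp_tvar : RowFinite (expOp (seriesOfPos tvar)) :=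
  rowFinite_expOp (coeffFinite_X Sum.inl_injective) fun _ => MvPowerSeries.constantCoeff_X _

theorem coeffFinite_neg_tbar : CoeffFinite fun k => -tbar k := fun d =>
  (coeffFinite_X Sum.inr_injective d).subset fun k hk h =>
    hk (by rw [map_neg, tbar, h, neg_zero])

theorem constantCoeff_neg_tbar (k : ℕ+) : MvPowerSeries.constantCoeff (-tbar k) = 0 := by
  rw [map_neg, tbar, MvPowerSeries.constantCoeff_X, neg_zero]

theorem rowFinite_expOp_neg_tbar : RowFinite (expOp (seriesOfPos fun k => -tbar k)) :=
  rowFinite_expOp coeffFinite_neg_tbar constantCoeff_neg_tbar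

/-! ### The operators `h` and `h(c)` -/

theorem opHc_apply (ħ τ c : ℂ) (S S' : Maya) : opHc ħ τ c S S' =
    qpow ħ ((τ + τ⁻¹ + 2) * (4 * c ^ 3 - c) / 24) *
      (qpow ħ ((τ + 1) * shiftedKWeight c S) * GammaGamma ħ S S' *
        qpow ħ ((τ⁻¹ + 1) * shiftedKWeight c S')) := by
  rw [opHc, shiftedK_eq, smul_opDiag, smul_opDiag, opQpow_opDiag, opQpow_opDiag, opDiag_opMul,
    opMul_opDiag]
  rfl

theorem opH_eq (ħ τ : ℂ) : opH ħ τ = opHc ħ τ 0 := by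
  have h : shiftedK 0 = (1 / 2 : ℂ) • opK := by
    rw [shiftedK]; simp
  rw [opHc, h, smul_smul, smul_smul, opH]
  rw [show (τ + τ⁻¹ + 2) * (4 * 0 ^ 3 - 0) / 24 = (0 : ℂ) by ring, qpow, zero_mul, Complex.exp_zero,
    one_smul]
  congr 4 <;> ring

theorem qpow_add (ħ a b : ℂ) : qpow ħ (a + b) = qpow ħ a * qpow ħ b := by
  rw [qpow, qpow, qpow, ← Complex.exp_add]; ring_nf

/-- The matrix elements of `h(c)` are the weights in the double sum over partitions. -/
theorem opHc_state (ħ τ c : ℂ) (ν ν' : YoungDiagram) (s : ℤ) :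
    opHc ħ τ c (state ν s) (state ν' s) =
      qpow ħ ((τ + 1) * sExponent ν (s + c)) * qpow ħ ((τ⁻¹ + 1) * sExponent ν' (s + c)) *
        GammaGamma ħ (state ν 0) (state ν' 0) := by
  rw [opHc_apply, shiftedKWeight_state, shiftedKWeight_state, GammaGamma_state, ← qpow_add]
  rw [mul_right_comm (qpow ħ _) (GammaGamma _ _ _), ← qpow_add, ← mul_assoc, ← qpow_add]
  congr 2
  ring

theorem exists_state_of_expOp_ne_zero {a : ℕ+ → TSeries} {s : ℤ} {P : Maya}
    (h : expOp (seriesOfPos a) (ground s) P ≠ 0) : ∃ ν, state ν s = P := by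
  obtain ⟨ν, s', rfl⟩ := exists_eq_state P
  have h1 := (weight_of_currentExp_ne_zero (coeff_zero_seriesOfPos a) h).2
  rw [charge_ground, charge_state] at h1
  exact ⟨ν, by rw [h1]⟩

/-- Inserting the partition of unity on both sides of `g`; only states of charge `s` contribute,
since currents preserve the charge. -/
theorem fermionicTau_eq (g : Op ℂ) (s : ℤ) : fermionicTau g s =
    ∑' ν : YoungDiagram × YoungDiagram, g (state ν.1 s) (state ν.2 s) •
      (schur ν.1 (fun k => ((k : ℕ) : ℂ) • tvar k) *
        schur ν.2 (fun k => -(((k : ℕ) : ℂ) • tbar k))) := by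
  have hs1 : ∀ ν, schur ν (fun k => ((k : ℕ) : ℂ) • tvar k) =
      expOp (seriesOfPos tvar) (ground s) (state ν s) := fun ν =>
    schur_eq_expOp ν _ _ (fun k => by
      rw [smul_smul, inv_mul_cancel₀ (by exact_mod_cast k.ne_zero), one_smul]) s
  have hs2 : ∀ ν, schur ν (fun k => -(((k : ℕ) : ℂ) • tbar k)) =
      expOp (seriesOfPos fun k => -tbar k) (ground s) (state ν s) := fun ν =>
    schur_eq_expOp ν _ _ (fun k => by
      rw [smul_neg, smul_smul, inv_mul_cancel₀ (by exact_mod_cast k.ne_zero), one_smul]) s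
  set e : Maya → TSeries := expOp (seriesOfPos tvar) (ground s) with he
  set e' : Maya → TSeries := expOp (seriesOfPos fun k => -tbar k) (ground s) with he'
  have hfe : CoeffFinite e := rowFinite_expOp_tvar (ground s)
  have hfe' : CoeffFinite e' := rowFinite_expOp_neg_tbar (ground s)
  let t : YoungDiagram × YoungDiagram → TSeries := fun ν =>
    e' (state ν.2 s) * e (state ν.1 s) * MvPowerSeries.C (g (state ν.1 s) (state ν.2 s))
  have ht : CoeffFinite t := by
    let c : Maya × Maya → TSeries := fun x => MvPowerSeries.C (g x.2 x.1)
    have h1 := (hfe'.mul_sigma (g := fun _ => e) fun _ => hfe).mul_right c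
    refine h1.comp_injective (e := fun ν : YoungDiagram × YoungDiagram =>
      (state ν.2 s, state ν.1 s)) fun ν ν' h => ?_
    exact Prod.ext (state_injective s (Prod.ext_iff.1 h).2) (state_injective s (Prod.ext_iff.1 h).1)
  have hin : ∀ P', opMul (expOp (seriesOfPos tvar)) (constOp g) (ground s) P' =
      ∑' ν, e (state ν s) * MvPowerSeries.C (g (state ν s) P') := by
    intro P'
    refine ((state_injective s).tsum_eq (f := fun P => e P * MvPowerSeries.C (g P P')) ?_).symm
    intro P hP
    exact exists_state_of_expOp_ne_zero (left_ne_zero_of_mul hP)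
  have hout : fermionicTau g s = ∑' ν', (∑' ν, e (state ν s) *
      MvPowerSeries.C (g (state ν s) (state ν' s))) * e' (state ν' s) := by
    rw [fermionicTau, opExp_currentPos, opExp_currentNeg]
    change ∑' P', opMul (expOp (seriesOfPos tvar)) (constOp g) (ground s) P' * e' P' = _
    simp only [hin]
    refine ((state_injective s).tsum_eq (f := fun P' => (∑' ν, e (state ν s) *
      MvPowerSeries.C (g (state ν s) P')) * e' P') ?_).symm
    intro P hP
    exact exists_state_of_expOp_ne_zero (right_ne_zero_of_mul hP)
  rw [hout]
  have h2 : ∀ ν', (∑' ν, e (state ν s) * MvPowerSeries.C (g (state ν s) (state ν' s))) *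
      e' (state ν' s) = ∑' ν, t (ν, ν') := by
    intro ν'
    let f : YoungDiagram → TSeries := fun ν =>
      e (state ν s) * MvPowerSeries.C (g (state ν s) (state ν' s))
    have hf : CoeffFinite f := (hfe.comp_injective (state_injective s)).mul_right
      fun ν => MvPowerSeries.C (g (state ν s) (state ν' s))
    refine (hf.tsum_mul (e' (state ν' s))).trans (tsum_congr fun ν => ?_)
    simp only [f, t]; ring
  rw [tsum_congr h2, ← ht.tsum_prod_right]
  refine tsum_congr fun ν => ?_
  rw [hs1, hs2, MvPowerSeries.smul_eq_C_mul]
  simp only [t]; ring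

/-- The sum over pairs of partitions is the expectation value of `h(c)`. -/
theorem tau_eq_fermionicTau (ħ τ c : ℂ) (s : ℤ) :
    tau ħ τ (s + c) = fermionicTau (opHc ħ τ c) s := by
  rw [fermionicTau_eq, tau]
  exact tsum_congr fun ν => by rw [opHc_state]

/-! ### The shift of the time variables by `[w]` -/

section TimeShift

/-- The substitution `x_{ι k} ↦ x_{ι k} - w^k/k` for a sequence of variables `x_{ι k}`. -/
structure IsTimeShift (ι : ℕ+ → Time) (a : Time → MvPowerSeries (Option Time) ℂ) : Prop where
  shifted : ∀ k, a (ι k) = MvPowerSeries.X (some (ι k)) -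
    (((k : ℕ) : ℂ)⁻¹) • MvPowerSeries.X none ^ (k : ℕ)
  fixed : ∀ i, (∀ k, ι k ≠ i) → a i = MvPowerSeries.X (some i)

variable {ι : ℕ+ → Time} {a : Time → MvPowerSeries (Option Time) ℂ}

theorem IsTimeShift.hasSubst (ha : IsTimeShift ι a) :
    MvPowerSeries.HasSubst a where
  const_coeff i := by
    refine ⟨1, ?_⟩
    by_cases h : ∃ k, ι k = i
    · obtain ⟨k, rfl⟩ := h
      rw [ha.shifted, pow_one, map_sub, MvPowerSeries.constantCoeff_X, MvPowerSeries.smul_eq_C_mul,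
        map_mul, map_pow, MvPowerSeries.constantCoeff_X, zero_pow k.ne_zero]
      simp
    · push Not at h
      rw [ha.fixed i h, pow_one, MvPowerSeries.constantCoeff_X]
  coeff_zero d := by
    classical
    have h1 : {i : Time | d = Finsupp.single (some i) 1}.Finite :=
      Set.Subsingleton.finite fun i hi j hj => Option.some_injective _
        (Finsupp.single_left_injective one_ne_zero (hi.symm.trans hj))
    have h2 : {k : ℕ+ | d = Finsupp.single none (k : ℕ)}.Finite :=
      Set.Subsingleton.finite fun k hk l hl => PNat.coe_injective
        (Finsupp.single_injective none (hk.symm.trans hl))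
    refine (h1.union (h2.image ι)).subset fun i hi => ?_
    by_contra hne
    rw [Set.mem_union, not_or] at hne
    have e1 : ¬ d = Finsupp.single (some i) 1 := hne.1
    refine hi ?_
    by_cases h : ∃ k, ι k = i
    · obtain ⟨k, rfl⟩ := h
      have e2 : ¬ d = Finsupp.single none (k : ℕ) := fun h => hne.2 ⟨k, h, rfl⟩
      rw [ha.shifted, map_sub, MvPowerSeries.coeff_smul, MvPowerSeries.coeff_X,
        MvPowerSeries.coeff_X_pow, if_neg e1, if_neg e2]
      simp
    · push Not at h
      rw [ha.fixed i h, MvPowerSeries.coeff_X, if_neg e1]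

/-- Finitely many coefficients of a substitution agree with those of a polynomial in the
substituted series, so that identities for derivations need to be checked on generators only. -/
theorem exists_adjoin_coeff_eq_subst (ha : MvPowerSeries.HasSubst a) (f : TSeries)
    (E : Finset (Option Time →₀ ℕ)) : ∃ h ∈ Algebra.adjoin ℂ (Set.range a), ∀ e ∈ E,
      MvPowerSeries.coeff e (MvPowerSeries.subst a f) = MvPowerSeries.coeff e h := by
  classical
  let F : Finset (Time →₀ ℕ) :=
    E.biUnion fun e => (MvPowerSeries.coeff_subst_finite ha f e).toFinset
  refine ⟨∑ d ∈ F, MvPowerSeries.coeff d f • d.prod fun s n => a s ^ n, ?_, fun e he => ?_⟩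
  · refine Subalgebra.sum_mem _ fun d _ => Subalgebra.smul_mem _ (Subalgebra.prod_mem _ fun s _ => ?_) _
    exact Subalgebra.pow_mem _ (Algebra.subset_adjoin (Set.mem_range_self s)) _
  · rw [MvPowerSeries.coeff_subst ha, map_sum, finsum_eq_sum_of_support_subset (s := F)]
    · exact Finset.sum_congr rfl fun d _ => (MvPowerSeries.coeff_smul _ _ _).symm
    · intro d hd
      rw [Finset.mem_coe, Finset.mem_biUnion]
      exact ⟨e, he, (Set.Finite.mem_toFinset _).2 hd⟩

/-- The derivation `w ∂_w + ∑_{k ≤ M} w^k ∂_{ι k}`. -/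
def shiftDer (ι : ℕ+ → Time) (M : ℕ) :
    Derivation ℂ (MvPowerSeries (Option Time) ℂ) (MvPowerSeries (Option Time) ℂ) :=
  (MvPowerSeries.X none : MvPowerSeries (Option Time) ℂ) • MvPowerSeries.pderiv ℂ none +
    ∑ k ∈ Finset.range M, (MvPowerSeries.X none ^ (k + 1) : MvPowerSeries (Option Time) ℂ) •
      MvPowerSeries.pderiv ℂ (some (ι k.succPNat))

theorem shiftDer_apply (ι : ℕ+ → Time) (M : ℕ) (h : MvPowerSeries (Option Time) ℂ) :
    shiftDer ι M h = MvPowerSeries.X none * MvPowerSeries.pderiv ℂ none h +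
      ∑ k ∈ Finset.range M, MvPowerSeries.X none ^ (k + 1) *
        MvPowerSeries.pderiv ℂ (some (ι k.succPNat)) h := by
  rw [shiftDer, Derivation.add_apply, Derivation.smul_apply]
  congr 1
  rw [← Derivation.coeFnAddMonoidHom_apply, map_sum, Finset.sum_apply]
  rfl

/-- The shifted variables are constants of `w ∂_w + ∑ w^k ∂_{ι k}`, up to the truncation at
`k = M`. -/
theorem IsTimeShift.dvd_shiftDer (ha : IsTimeShift ι a) (hι : Function.Injective ι) (M : ℕ)
    (i : Time) : MvPowerSeries.X none ^ (M + 1) ∣ shiftDer ι M (a i) := by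
  classical
  by_cases h : ∃ k, ι k = i
  · obtain ⟨k, rfl⟩ := h
    have h1 : shiftDer ι M (MvPowerSeries.X (some (ι k))) =
        if (k : ℕ) ≤ M then MvPowerSeries.X none ^ (k : ℕ) else 0 := by
      rw [shiftDer_apply, MvPowerSeries.pderiv_X_of_ne (by simp), mul_zero, zero_add]
      split_ifs with hk
      · rw [Finset.sum_eq_single k.natPred]
        · have e : k.natPred.succPNat = k := k.succPNat_natPred
          rw [e, MvPowerSeries.pderiv_X_self, mul_one, PNat.natPred_add_one]
        · intro l _ hl
          rw [MvPowerSeries.pderiv_X_of_ne, mul_zero]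
          intro h'
          refine hl ?_
          rw [hι (Option.some_injective _ h'), Nat.natPred_succPNat]
        · intro hk'
          rw [Finset.mem_range, not_lt] at hk'
          have := PNat.natPred_add_one k
          omega
      · refine Finset.sum_eq_zero fun l hl => ?_
        rw [MvPowerSeries.pderiv_X_of_ne, mul_zero]
        intro h'
        have h2 := congrArg PNat.val (hι (Option.some_injective _ h'))
        rw [Finset.mem_range] at hl
        simp only [Nat.succPNat_coe] at h2
        omega
    have h2 : shiftDer ι M ((((k : ℕ) : ℂ)⁻¹) • MvPowerSeries.X none ^ (k : ℕ)) =
        MvPowerSeries.X none ^ (k : ℕ) := by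
      rw [Derivation.map_smul, Derivation.leibniz_pow, shiftDer_apply,
        MvPowerSeries.pderiv_X_self, Finset.sum_eq_zero, add_zero, mul_one, smul_eq_mul,
        ← Nat.cast_smul_eq_nsmul ℂ, smul_smul, inv_mul_cancel₀ (by exact_mod_cast k.ne_zero),
        one_smul, ← pow_succ, Nat.sub_add_cancel k.pos]
      intro l _
      rw [MvPowerSeries.pderiv_X_of_ne (by simp), mul_zero]
    rw [ha.shifted, map_sub, h1, h2]
    split_ifs with hk
    · rw [sub_self]; exact dvd_zero _
    · rw [zero_sub]; exact (pow_dvd_pow _ (by omega)).neg_right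
  · push Not at h
    rw [ha.fixed i h, shiftDer_apply, MvPowerSeries.pderiv_X_of_ne (by simp), mul_zero, zero_add,
      Finset.sum_eq_zero]
    · exact dvd_zero _
    · intro k _
      rw [MvPowerSeries.pderiv_X_of_ne, mul_zero]
      intro h'
      exact h _ (Option.some_injective _ h').symm

theorem IsTimeShift.dvd_shiftDer_adjoin (ha : IsTimeShift ι a) (hι : Function.Injective ι) (M : ℕ)
    {h : MvPowerSeries (Option Time) ℂ} (hh : h ∈ Algebra.adjoin ℂ (Set.range a)) :
    MvPowerSeries.X none ^ (M + 1) ∣ shiftDer ι M h := by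
  induction hh using Algebra.adjoin_induction with
  | mem x hx => obtain ⟨i, rfl⟩ := hx; exact ha.dvd_shiftDer hι M i
  | algebraMap r => rw [Derivation.map_algebraMap]; exact dvd_zero _
  | add x y _ _ hx hy => rw [map_add]; exact dvd_add hx hy
  | mul x y _ _ hx hy =>
    rw [Derivation.leibniz]
    exact dvd_add (hy.mul_left _) (hx.mul_left _)

/-- The exponent of `x^d w^n`. -/
def wExp (n : ℕ) (d : Time →₀ ℕ) : Option Time →₀ ℕ :=
  d.embDomain Function.Embedding.some + Finsupp.single none n

theorem wExp_none (n : ℕ) (d : Time →₀ ℕ) : wExp n d none = n := by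
  rw [wExp, Finsupp.add_apply, Finsupp.embDomain_of_notMem_range _ _ _ (by simp),
    Finsupp.single_eq_same, zero_add]

theorem wExp_some (n : ℕ) (d : Time →₀ ℕ) (i : Time) : wExp n d (some i) = d i := by
  have := Finsupp.embDomain_apply_self Function.Embedding.some d i
  rw [wExp, Finsupp.add_apply, Finsupp.single_eq_of_ne (by simp), add_zero]
  exact this

theorem coeff_wCoeff (n : ℕ) (g : MvPowerSeries (Option Time) ℂ) (d : Time →₀ ℕ) :
    MvPowerSeries.coeff d (wCoeff n g) = MvPowerSeries.coeff (wExp n d) g := rfl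

theorem wExp_add_single (n : ℕ) (d : Time →₀ ℕ) (i : Time) :
    wExp n d + Finsupp.single (some i) 1 = wExp n (d + Finsupp.single i 1) := by
  have : Finsupp.single (some i) 1 =
      (Finsupp.single i 1 : Time →₀ ℕ).embDomain Function.Embedding.some := by
    rw [Finsupp.embDomain_single]; rfl
  rw [wExp, wExp, this, Finsupp.embDomain_add, add_right_comm]

theorem wExp_add_single_none (n k : ℕ) (d : Time →₀ ℕ) :
    wExp n d + Finsupp.single none k = wExp (n + k) d := by
  rw [wExp, wExp, add_assoc, ← Finsupp.single_add]

/-- The coefficients of `shiftDer ι m h` at `w^m`. -/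
theorem coeff_shiftDer (ι : ℕ+ → Time) (m : ℕ) (d : Time →₀ ℕ)
    (h : MvPowerSeries (Option Time) ℂ) :
    MvPowerSeries.coeff (wExp (m + 1) d) (shiftDer ι (m + 1) h) =
      ((m : ℂ) + 1) * MvPowerSeries.coeff (wExp (m + 1) d) h +
        ∑ k ∈ Finset.range (m + 1),
          MvPowerSeries.coeff (wExp (m - k) (d + Finsupp.single (ι k.succPNat) 1)) h *
            (d (ι k.succPNat) + 1) := by
  rw [shiftDer_apply, map_add, map_sum]
  congr 1
  · rw [← wExp_add_single_none m 1, add_comm (wExp m d), MvPowerSeries.X, MvPowerSeries.coeff_add_monomial_mul,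
      MvPowerSeries.coeff_pderiv, one_mul, wExp_none, mul_comm, add_comm (wExp m d)]
  · refine Finset.sum_congr rfl fun k hk => ?_
    have e : m + 1 = (m - k) + (k + 1) := by rw [Finset.mem_range] at hk; omega
    rw [e, ← wExp_add_single_none (m - k) (k + 1), add_comm, MvPowerSeries.X_pow_eq,
      MvPowerSeries.coeff_add_monomial_mul, MvPowerSeries.coeff_pderiv, one_mul, wExp_some,
      wExp_add_single]

/-- The coefficients `χ_m` of the shift operator `exp (-∑ (w^k/k) ∂_{ι k})` satisfy Newton's
recursion in the derivations `-∂_{ι k}`. -/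
theorem IsTimeShift.recursion (ha : IsTimeShift ι a) (hι : Function.Injective ι) (m : ℕ)
    (f : TSeries) : ((m : ℂ) + 1) • wCoeff (m + 1) (MvPowerSeries.subst a f) =
      -∑ k ∈ Finset.range (m + 1), MvPowerSeries.pderiv ℂ (ι k.succPNat)
        (wCoeff (m - k) (MvPowerSeries.subst a f)) := by
  classical
  ext d
  let E : Finset (Option Time →₀ ℕ) := insert (wExp (m + 1) d) ((Finset.range (m + 1)).image fun k =>
    wExp (m - k) (d + Finsupp.single (ι k.succPNat) 1))
  obtain ⟨h, hh, hE⟩ := exists_adjoin_coeff_eq_subst (ha.hasSubst) f E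
  have h0 := MvPowerSeries.X_pow_dvd_iff.1 (ha.dvd_shiftDer_adjoin hι (m + 1) hh)
    (wExp (m + 1) d) (by rw [wExp_none]; omega)
  rw [coeff_shiftDer, ← hE _ (Finset.mem_insert_self _ _), add_eq_zero_iff_eq_neg] at h0
  rw [MvPowerSeries.coeff_smul, coeff_wCoeff, h0, map_neg, map_sum]
  congr 1
  refine Finset.sum_congr rfl fun k hk => ?_
  rw [MvPowerSeries.coeff_pderiv, coeff_wCoeff,
    hE _ (Finset.mem_insert_of_mem (Finset.mem_image_of_mem _ hk))]

theorem IsTimeShift.dvd_sub_X (ha : IsTimeShift ι a) (i : Time) :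
    MvPowerSeries.X none ∣ a i - MvPowerSeries.X (some i) := by
  by_cases h : ∃ k, ι k = i
  · obtain ⟨k, rfl⟩ := h
    rw [ha.shifted, sub_sub_cancel_left, MvPowerSeries.smul_eq_C_mul]
    exact ((dvd_pow_self _ k.ne_zero).mul_left _).neg_right
  · push Not at h
    rw [ha.fixed i h, sub_self]; exact dvd_zero _

/-- The constant term in `w` of the shifted series is the series itself. -/
theorem IsTimeShift.wCoeff_zero (ha : IsTimeShift ι a) (f : TSeries) :
    wCoeff 0 (MvPowerSeries.subst a f) = f := by
  classical
  ext d
  have key : ∀ d' : Time →₀ ℕ, MvPowerSeries.coeff (wExp 0 d) (d'.prod fun s n => a s ^ n) =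
      if d' = d then 1 else 0 := by
    intro d'
    have h1 : MvPowerSeries.X none ∣ (d'.prod fun s n => a s ^ n) -
        d'.prod fun s n => (MvPowerSeries.X (some s) : MvPowerSeries (Option Time) ℂ) ^ n := by
      rw [← Ideal.mem_span_singleton, ← Ideal.Quotient.eq, Finsupp.prod, Finsupp.prod, map_prod,
        map_prod]
      refine Finset.prod_congr rfl fun s _ => ?_
      rw [map_pow, map_pow]
      congr 1
      rw [Ideal.Quotient.eq, Ideal.mem_span_singleton]
      exact ha.dvd_sub_X s
    have h2 := MvPowerSeries.X_dvd_iff.1 h1 (wExp 0 d) (wExp_none 0 d)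
    have h3 : (d'.prod fun s n => (MvPowerSeries.X (some s) : MvPowerSeries (Option Time) ℂ) ^ n) =
        MvPowerSeries.monomial (wExp 0 d') 1 := by
      have := MvPowerSeries.monomial_eq (R := ℂ) (wExp 0 d') fun _ => 1
      simp only [one_smul, one_pow, Finsupp.prod_fun_one] at this
      rw [this, wExp, Finsupp.single_zero, add_zero, Finsupp.prod_embDomain]
      rfl
    rw [map_sub, h3, MvPowerSeries.coeff_monomial, sub_eq_zero] at h2
    rw [h2]
    congr 1
    refine propext ⟨fun h => ?_, fun h => by rw [h]⟩
    ext i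
    rw [← wExp_some 0 d', ← wExp_some 0 d, h]
  rw [coeff_wCoeff, MvPowerSeries.coeff_subst (ha.hasSubst), finsum_eq_single _ d]
  · rw [key, if_pos rfl, smul_eq_mul, mul_one]
  · intro d' hd'
    rw [key, if_neg hd', smul_zero]

end TimeShift

/-- The substitution defining `shiftT`. -/
def shiftTVar (i : Time) : MvPowerSeries (Option Time) ℂ := match i with
  | Sum.inl k => (MvPowerSeries.X (some (Sum.inl k)) : MvPowerSeries (Option Time) ℂ) -
      (((k : ℕ) : ℂ)⁻¹) • MvPowerSeries.X none ^ (k : ℕ)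
  | Sum.inr k => MvPowerSeries.X (some (Sum.inr k))

/-- The substitution defining `shiftTbar`. -/
def shiftTbarVar (i : Time) : MvPowerSeries (Option Time) ℂ := match i with
  | Sum.inl k => (MvPowerSeries.X (some (Sum.inl k)) : MvPowerSeries (Option Time) ℂ)
  | Sum.inr k => MvPowerSeries.X (some (Sum.inr k)) -
      (((k : ℕ) : ℂ)⁻¹) • MvPowerSeries.X none ^ (k : ℕ)

theorem isTimeShift_shiftTVar : IsTimeShift Sum.inl shiftTVar where
  shifted _ := rfl
  fixed i hi := by
    rcases i with k | k
    · exact absurd rfl (hi k)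
    · rfl

theorem isTimeShift_shiftTbarVar : IsTimeShift Sum.inr shiftTbarVar where
  shifted _ := rfl
  fixed i hi := by
    rcases i with k | k
    · rfl
    · exact absurd rfl (hi k)

/-- A sequence obeying the recursion of the shift operator and starting from `f` consists of the
coefficients of the shift of `f`. -/
theorem IsTimeShift.wCoeff_eq {ι : ℕ+ → Time} {a : Time → MvPowerSeries (Option Time) ℂ}
    (ha : IsTimeShift ι a) (hι : Function.Injective ι) {f : TSeries} {y : ℕ → TSeries}
    (h0 : y 0 = f) (hy : ∀ m : ℕ, ((m : ℂ) + 1) • y (m + 1) =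
      -∑ k ∈ Finset.range (m + 1), MvPowerSeries.pderiv ℂ (ι k.succPNat) (y (m - k))) (m : ℕ) :
    wCoeff m (MvPowerSeries.subst a f) = y m := by
  induction m using Nat.strong_induction_on with
  | _ m ih =>
    rcases m with _ | m
    · rw [ha.wCoeff_zero, h0]
    · have h1 := ha.recursion hι m f
      rw [Finset.sum_congr rfl fun k _ => by rw [ih (m - k) (by omega)], ← hy] at h1
      have hm : (m : ℂ) + 1 ≠ 0 := by exact_mod_cast Nat.succ_ne_zero m
      have h2 := congrArg (fun z => ((m : ℂ) + 1)⁻¹ • z) h1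
      simpa only [smul_smul, inv_mul_cancel₀ hm, one_smul] using h2

/-! ### Derivatives of the exponentials of currents -/

section Derivation

variable {R : Type} [CommRing R] [Algebra ℂ R]

/-- A derivation of the coefficient ring, applied to the coordinates of a vector. -/
def fockDeriv (δ : Derivation ℂ R R) : Fock R →+ Fock R :=
  Finsupp.mapRange.addMonoidHom (δ : R →+ R)

variable (δ : Derivation ℂ R R)

theorem fockDeriv_apply (v : Fock R) (S : Maya) : fockDeriv δ v S = δ (v S) := rfl

theorem fockDeriv_ket (S : Maya) : fockDeriv δ (ket R S) = 0 := by
  classical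
  ext T
  rw [fockDeriv_apply, Finsupp.single_apply]
  split_ifs <;> simp

theorem fockDeriv_smul (r : R) (v : Fock R) :
    fockDeriv δ (r • v) = r • fockDeriv δ v + δ r • v := by
  ext S
  simp only [fockDeriv_apply, Finsupp.smul_apply, Finsupp.add_apply, smul_eq_mul,
    Derivation.leibniz, mul_comm (δ r)]

theorem fockDeriv_smul_complex (r : ℂ) (v : Fock R) :
    fockDeriv δ (r • v) = r • fockDeriv δ v := by
  ext S
  simp only [fockDeriv_apply, Finsupp.smul_apply, Derivation.map_smul]

theorem fockDeriv_create (j : ℤ) (v : Fock R) :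
    fockDeriv δ (create R j v) = create R j (fockDeriv δ v) := by
  ext S
  rw [fockDeriv_apply, create_apply, create_apply, fockDeriv_apply, Derivation.leibniz,
    Derivation.map_intCast, smul_zero, add_zero, smul_eq_mul]

theorem fockDeriv_annih (j : ℤ) (v : Fock R) :
    fockDeriv δ (annih R j v) = annih R j (fockDeriv δ v) := by
  ext S
  rw [fockDeriv_apply, annih_apply, annih_apply, fockDeriv_apply, Derivation.leibniz,
    Derivation.map_intCast, smul_zero, add_zero, smul_eq_mul]

theorem fockDeriv_current {k : ℤ} (hk : k ≠ 0) (v : Fock R) :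
    fockDeriv δ (current R k v) = current R k (fockDeriv δ v) := by
  obtain ⟨B, h1, h2⟩ := ((current_eventually hk v).and
    (current_eventually hk (fockDeriv δ v))).exists
  rw [h1, h2, map_sum]
  exact Finset.sum_congr rfl fun n _ => by rw [fockDeriv_create, fockDeriv_annih]

omit [Algebra ℂ R] in
theorem current_currentSum {p : PowerSeries R} (hp : PowerSeries.coeff 0 p = 0) {k : ℤ}
    (hk : 0 < k) (v : Fock R) :
    current R k (currentSum p v) = currentSum p (current R k v) := by
  obtain ⟨K, h1, h2⟩ := ((currentSum_eventually p v).and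
    (currentSum_eventually p (current R k v))).exists
  rw [h1, h2, map_sum]
  refine Finset.sum_congr rfl fun l _ => ?_
  rcases Nat.eq_zero_or_pos l with rfl | hl
  · simp [hp]
  · rw [map_smul, current_comm hk (by exact_mod_cast hl)]

variable {p : PowerSeries R} {k : ℕ} {c : R}

theorem fockDeriv_currentSum (hp : PowerSeries.coeff 0 p = 0)
    (h : ∀ l, δ (PowerSeries.coeff l p) = if l = k then c else 0) (v : Fock R) :
    fockDeriv δ (currentSum p v) = currentSum p (fockDeriv δ v) + c • current R k v := by
  obtain ⟨K, h1, h2, h3⟩ := ((currentSum_eventually p v).and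
    ((currentSum_eventually p (fockDeriv δ v)).and (eventually_gt_atTop k))).exists
  have h4 : c • current R k v =
      ∑ l ∈ Finset.range K, (if l = k then c else 0) • current R l v := by
    rw [Finset.sum_eq_single k]
    · rw [if_pos rfl]
    · intro l _ hl; rw [if_neg hl, zero_smul]
    · intro hk; exact absurd (Finset.mem_range.2 h3) hk
  rw [h1, h2, h4, map_sum, ← Finset.sum_add_distrib]
  refine Finset.sum_congr rfl fun l _ => ?_
  rw [fockDeriv_smul, h]
  rcases Nat.eq_zero_or_pos l with rfl | hl
  · simp [hp]
  · rw [fockDeriv_current δ (by omega)]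

theorem fockDeriv_currentSum_pow (hp : PowerSeries.coeff 0 p = 0) (hk : 0 < k)
    (h : ∀ l, δ (PowerSeries.coeff l p) = if l = k then c else 0) (n : ℕ) (v : Fock R) :
    fockDeriv δ ((currentSum p ^ (n + 1)) v) = (currentSum p ^ (n + 1)) (fockDeriv δ v) +
      ((n : ℂ) + 1) • c • current R k ((currentSum p ^ n) v) := by
  induction n with
  | zero => simpa using fockDeriv_currentSum δ hp h v
  | succ n ih =>
    rw [pow_succ' _ (n + 1), Module.End.mul_apply, fockDeriv_currentSum δ hp h, ih, map_add,
      LinearMap.map_smul_of_tower, map_smul, ← current_currentSum hp (by exact_mod_cast hk),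
      ← Module.End.mul_apply (currentSum p) (currentSum p ^ (n + 1)),
      ← Module.End.mul_apply (currentSum p) (currentSum p ^ n), ← pow_succ', ← pow_succ', add_assoc]
    congr 1
    push_cast
    rw [add_smul ((n : ℂ) + 1), one_smul]

theorem fockDeriv_currentExp (hp : PowerSeries.coeff 0 p = 0) (hk : 0 < k)
    (h : ∀ l, δ (PowerSeries.coeff l p) = if l = k then c else 0) (v : Fock R) :
    fockDeriv δ (currentExp p v) =
      currentExp p (fockDeriv δ v) + c • current R k (currentExp p v) := by
  obtain ⟨K, h1, h2⟩ := ((eventually_forall_ge_atTop.2 (currentExp_eventually hp v)).and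
    (eventually_forall_ge_atTop.2 (currentExp_eventually hp (fockDeriv δ v)))).exists
  have h3 : c • current R k (currentExp p v) = ∑ n ∈ Finset.range K,
      ((n.factorial : ℂ)⁻¹) • c • current R k ((currentSum p ^ n) v) := by
    rw [h1 K le_rfl, map_sum, Finset.smul_sum]
    refine Finset.sum_congr rfl fun n _ => ?_
    rw [LinearMap.map_smul_of_tower, smul_comm]
  rw [h3, h1 (K + 1) (by omega), h2 (K + 1) (by omega), map_sum, Finset.sum_range_succ' _ K,
    Finset.sum_range_succ' (fun n => _ • (currentSum p ^ n) (fockDeriv δ v)) K, add_right_comm,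
    ← Finset.sum_add_distrib]
  congr 1
  · refine Finset.sum_congr rfl fun n _ => ?_
    rw [fockDeriv_smul_complex, fockDeriv_currentSum_pow δ hp hk h, smul_add, smul_smul]
    congr 2
    have hn : (n : ℂ) + 1 ≠ 0 := by exact_mod_cast Nat.succ_ne_zero n
    rw [Nat.factorial_succ]
    push_cast
    rw [mul_inv, mul_right_comm, inv_mul_cancel₀ hn, one_mul]
  · rw [fockDeriv_smul_complex]; simp

/-- The matrix of a current acts through its constant matrix elements. -/
theorem current_apply {k : ℤ} (hk : k ≠ 0) (v : Fock R) (S : Maya) :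
    current R k v S = Finsupp.linearCombination ℂ v (current ℂ (-k) (ket ℂ S)) := by
  induction v using Finsupp.induction_linear with
  | zero => simp
  | add v w hv hw =>
    rw [map_add, Finsupp.add_apply, hv, hw]
    simp [Finsupp.linearCombination_apply, Finsupp.sum, Finset.sum_add_distrib]
  | single P r =>
    classical
    have hr : (Finsupp.single P r : Fock R) = r • ket R P := by simp
    rw [hr, map_smul, Finsupp.smul_apply, current_algebraMap hk, current_transpose hk,
      Finsupp.linearCombination_apply, Finsupp.sum_eq_single P]
    · simp [Algebra.smul_def, mul_comm]
    · intro Q _ hQ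
      simp [hQ.symm]
    · intro _; simp

/-- If `δ p_l` is `c` for `l = k` and `0` otherwise, `δ` acts on `exp (∑ p_l J_l)` as left
multiplication by `c J_k`. -/
theorem deriv_expOp (hp : PowerSeries.coeff 0 p = 0) (hk : 0 < k)
    (h : ∀ l, δ (PowerSeries.coeff l p) = if l = k then c else 0) (S P : Maya) :
    δ (expOp p S P) =
      c * Finsupp.linearCombination ℂ (fun Q => expOp p Q P) (current ℂ (-k) (ket ℂ S)) := by
  rw [expOp, ← fockDeriv_apply, fockDeriv_currentExp δ hp hk h, fockDeriv_ket, map_zero, zero_add,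
    Finsupp.smul_apply, current_apply (by omega), smul_eq_mul]
  rfl

end Derivation

theorem CoeffFinite.pderiv {ι : Type*} {f : ι → TSeries} (hf : CoeffFinite f) (i : Time) :
    CoeffFinite fun x => MvPowerSeries.pderiv ℂ i (f x) := fun d =>
  (hf (d + Finsupp.single i 1)).subset fun x hx h => hx (by
    rw [MvPowerSeries.coeff_pderiv, h, zero_mul])

theorem CoeffFinite.pderiv_tsum {ι : Type*} {f : ι → TSeries} (hf : CoeffFinite f) (i : Time) :
    MvPowerSeries.pderiv ℂ i (∑' x, f x) = ∑' x, MvPowerSeries.pderiv ℂ i (f x) := by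
  ext d
  rw [MvPowerSeries.coeff_pderiv, hf.coeff_tsum, (hf.pderiv i).coeff_tsum, finsum_mul' _ _ (hf _)]
  exact finsum_congr fun x => by rw [MvPowerSeries.coeff_pderiv]

/-- The derivative of `A` in the time `i` is `c J_k A`. -/
def HasTimeDeriv (i : Time) (c : ℂ) (k : ℕ+) (A : Op TSeries) : Prop := ∀ S P,
  MvPowerSeries.pderiv ℂ i (A S P) =
    c • Finsupp.linearCombination ℂ (fun Q => A Q P) (current ℂ (-(k : ℤ)) (ket ℂ S))

theorem RowFinite.coeffFinite_linearCombination {A : Op TSeries} (hA : RowFinite A) (w : Fock ℂ) :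
    CoeffFinite fun P => Finsupp.linearCombination ℂ (fun Q => A Q P) w := by
  intro d
  refine (w.support.finite_toSet.biUnion fun Q _ => hA Q d).subset fun P hP => ?_
  simp only [Set.mem_ofPred_eq] at hP
  rw [Finsupp.linearCombination_apply, Finsupp.sum, map_sum] at hP
  obtain ⟨Q, hQ, hne⟩ := Finset.exists_ne_zero_of_sum_ne_zero hP
  simp only [Set.mem_iUnion]
  exact ⟨Q, hQ, fun h => hne (by rw [MvPowerSeries.coeff_smul, h, mul_zero])⟩

theorem RowFinite.linearCombination_opMul {A : Op TSeries} (hA : RowFinite A) (B : Op TSeries)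
    (w : Fock ℂ) (S' : Maya) :
    Finsupp.linearCombination ℂ (fun Q => CubicHodge.opMul A B Q S') w =
      ∑' P, Finsupp.linearCombination ℂ (fun Q => A Q P) w * B P S' := by
  let g : Maya → Maya → TSeries := fun Q P => w Q • (A Q P * B P S')
  have hg : ∀ Q ∈ w.support, Summable (g Q) := fun Q _ =>
    CoeffFinite.summable fun d => ((hA Q).mul_right (fun P => B P S') d).subset fun P hP h =>
      hP (by simp only [g]; rw [MvPowerSeries.coeff_smul, h, mul_zero])
  have h1 : ∀ P, Finsupp.linearCombination ℂ (fun Q => A Q P) w * B P S' =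
      ∑ Q ∈ w.support, g Q P := by
    intro P
    rw [Finsupp.linearCombination_apply, Finsupp.sum, Finset.sum_mul]
    exact Finset.sum_congr rfl fun Q _ => smul_mul_assoc _ _ _
  rw [tsum_congr h1, Summable.tsum_finsetSum hg, Finsupp.linearCombination_apply, Finsupp.sum]
  refine Finset.sum_congr rfl fun Q _ => ?_
  have h2 : w Q • CubicHodge.opMul A B Q S' = MvPowerSeries.C (w Q) * CubicHodge.opMul A B Q S' :=
    MvPowerSeries.smul_eq_C_mul _ _
  rw [h2]
  refine (((hA Q).mul_right fun P => B P S').mul_tsum _).trans (tsum_congr fun P => ?_)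
  simp only [g]
  rw [MvPowerSeries.smul_eq_C_mul]

theorem HasTimeDeriv.opMul_constOp {i : Time} {c : ℂ} {k : ℕ+} {A : Op TSeries}
    (h : HasTimeDeriv i c k A) (hA : RowFinite A) (N : Op ℂ) :
    HasTimeDeriv i c k (opMul A (constOp N)) := by
  intro S S'
  let f : Maya → TSeries := fun P => A S P * constOp N P S'
  have hf : CoeffFinite f := (hA S).mul_right fun P => constOp N P S'
  have h1 : ∀ P, MvPowerSeries.pderiv ℂ i (f P) = MvPowerSeries.C c * (Finsupp.linearCombination ℂ
      (fun Q => A Q P) (current ℂ (-(k : ℤ)) (ket ℂ S)) * constOp N P S') := by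
    intro P
    simp only [f, constOp]
    rw [Derivation.leibniz, MvPowerSeries.pderiv_C, smul_zero, zero_add, h S P, smul_eq_mul,
      MvPowerSeries.smul_eq_C_mul]
    ring
  rw [hA.linearCombination_opMul, MvPowerSeries.smul_eq_C_mul]
  refine (hf.pderiv_tsum i).trans ((tsum_congr h1).trans ?_)
  exact (((hA.coeffFinite_linearCombination _).mul_right _).mul_tsum _).symm

theorem hasTimeDeriv_expOp {a : ℕ+ → TSeries} {i : Time} {c : ℂ} {k : ℕ+}
    (h : ∀ l, MvPowerSeries.pderiv ℂ i (a l) = if l = k then MvPowerSeries.C c else 0) :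
    HasTimeDeriv i c k (expOp (seriesOfPos a)) := by
  intro S P
  rw [MvPowerSeries.smul_eq_C_mul]
  refine deriv_expOp (MvPowerSeries.pderiv ℂ i) (coeff_zero_seriesOfPos a) k.pos (fun l => ?_) S P
  rcases Nat.eq_zero_or_pos l with rfl | hl
  · rw [coeff_zero_seriesOfPos, map_zero, if_neg k.ne_zero.symm]
  · obtain ⟨l, rfl⟩ : ∃ l' : ℕ+, (l' : ℕ) = l := ⟨⟨l, hl⟩, rfl⟩
    rw [coeff_seriesOfPos, h]
    simp only [PNat.coe_inj]

theorem hasTimeDeriv_tvar (k : ℕ+) : HasTimeDeriv (Sum.inl k) 1 k (expOp (seriesOfPos tvar)) :=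
  hasTimeDeriv_expOp fun l => by
    by_cases h : l = k
    · rw [h, if_pos rfl, tvar, MvPowerSeries.pderiv_X_self, map_one]
    · rw [if_neg h, tvar, MvPowerSeries.pderiv_X_of_ne (by simpa using h)]

theorem hasTimeDeriv_tvar_inr (k : ℕ+) :
    HasTimeDeriv (Sum.inr k) 0 k (expOp (seriesOfPos tvar)) :=
  hasTimeDeriv_expOp fun l => by
    rw [map_zero, ite_self, tvar, MvPowerSeries.pderiv_X_of_ne (by simp)]

theorem hasTimeDeriv_neg_tbar (k : ℕ+) :
    HasTimeDeriv (Sum.inr k) (-1) k (expOp (seriesOfPos fun k => -tbar k)) :=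
  hasTimeDeriv_expOp fun l => by
    by_cases h : l = k
    · rw [h, if_pos rfl, map_neg, tbar, MvPowerSeries.pderiv_X_self, map_neg, map_one]
    · rw [if_neg h, map_neg, tbar, MvPowerSeries.pderiv_X_of_ne (by simpa using h), neg_zero]

theorem hasTimeDeriv_neg_tbar_inl (k : ℕ+) :
    HasTimeDeriv (Sum.inl k) 0 k (expOp (seriesOfPos fun k => -tbar k)) :=
  hasTimeDeriv_expOp fun l => by
    rw [map_zero, ite_self, map_neg, tbar, MvPowerSeries.pderiv_X_of_ne (by simp), neg_zero]

/-- The derivative of `A Bᵀ`. -/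
theorem HasTimeDeriv.opMul_opTranspose {i : Time} {c c' : ℂ} {k : ℕ+} {A B : Op TSeries}
    (hA : HasTimeDeriv i c k A) (hB : HasTimeDeriv i c' k B) (hrA : RowFinite A)
    (hrB : RowFinite B) (S S' : Maya) :
    MvPowerSeries.pderiv ℂ i (opMul A (opTranspose B) S S') =
      c • Finsupp.linearCombination ℂ (fun Q => opMul A (opTranspose B) Q S')
        (current ℂ (-(k : ℤ)) (ket ℂ S)) +
      c' • Finsupp.linearCombination ℂ (fun Q => opMul A (opTranspose B) S Q)
        (current ℂ (-(k : ℤ)) (ket ℂ S')) := by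
  let f : Maya → TSeries := fun P => A S P * B S' P
  have hf : CoeffFinite f := (hrA S).mul_right fun P => B S' P
  set w : Fock ℂ := current ℂ (-(k : ℤ)) (ket ℂ S)
  set w' : Fock ℂ := current ℂ (-(k : ℤ)) (ket ℂ S')
  let g : Maya → TSeries := fun P => Finsupp.linearCombination ℂ (fun Q => A Q P) w * B S' P
  let g' : Maya → TSeries := fun P => Finsupp.linearCombination ℂ (fun Q => B Q P) w' * A S P
  have hg : CoeffFinite g := (hrA.coeffFinite_linearCombination w).mul_right fun P => B S' P
  have hg' : CoeffFinite g' := (hrB.coeffFinite_linearCombination w').mul_right fun P => A S P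
  have hcg : CoeffFinite fun P => MvPowerSeries.C c * g P :=
    hg.mul_left fun _ => MvPowerSeries.C c
  have hcg' : CoeffFinite fun P => MvPowerSeries.C c' * g' P :=
    hg'.mul_left fun _ => MvPowerSeries.C c'
  have h1 : ∀ P, MvPowerSeries.pderiv ℂ i (f P) =
      MvPowerSeries.C c * g P + MvPowerSeries.C c' * g' P := by
    intro P
    simp only [f, g, g']
    rw [Derivation.leibniz, hA S P, hB S' P, smul_eq_mul, smul_eq_mul,
      MvPowerSeries.smul_eq_C_mul, MvPowerSeries.smul_eq_C_mul]
    ring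
  have h2 : Finsupp.linearCombination ℂ (fun Q => opMul A (opTranspose B) Q S') w = ∑' P, g P :=
    hrA.linearCombination_opMul _ w S'
  have h3 : Finsupp.linearCombination ℂ (fun Q => opMul A (opTranspose B) S Q) w' = ∑' P, g' P := by
    have e : ∀ Q, opMul A (opTranspose B) S Q = opMul B (opTranspose A) Q S := fun Q =>
      tsum_congr fun P => mul_comm _ _
    simp only [e]
    exact hrB.linearCombination_opMul _ w' S
  rw [h2, h3, MvPowerSeries.smul_eq_C_mul, MvPowerSeries.smul_eq_C_mul]
  refine (hf.pderiv_tsum i).trans ((tsum_congr h1).trans ?_)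
  refine (hcg.summable.tsum_add hcg'.summable).trans ?_
  exact congrArg₂ _ (hg.mul_tsum _).symm (hg'.mul_tsum _).symm

/-! ### Matrix elements between vectors with constant coefficients -/

/-- The matrix element `⟨x|G|u⟩`, bilinear in the vectors `x` and `u`. -/
def pairing (G : Op TSeries) : Fock ℂ →ₗ[ℂ] Fock ℂ →ₗ[ℂ] TSeries :=
  Finsupp.linearCombination ℂ fun S => Finsupp.linearCombination ℂ (G S)

theorem pairing_ket (G : Op TSeries) (S S' : Maya) : pairing G (ket ℂ S) (ket ℂ S') = G S S' := by
  simp [pairing]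

theorem pairing_ket_left (G : Op TSeries) (S : Maya) (u : Fock ℂ) :
    pairing G (ket ℂ S) u = Finsupp.linearCombination ℂ (G S) u := by
  simp [pairing]

theorem pairing_ket_right (G : Op TSeries) (x : Fock ℂ) (S' : Maya) :
    pairing G x (ket ℂ S') = Finsupp.linearCombination ℂ (fun S => G S S') x := by
  induction x using Finsupp.induction_linear with
  | zero => simp
  | add v w hv hw => simp [hv, hw]
  | single S r => simp [pairing]

/-- The matrices `G = exp (∑ t_k J_k) g exp (-∑ t̄_k J_{-k})` with a group-like operator `g`. -/
structure IsTodaKernel (G : Op TSeries) : Prop where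
  groupLike : IsGroupLike G
  isUnit : ∀ s, IsUnit (G (ground s) (ground s))
  pderiv_t : ∀ (k : ℕ+) (x u : Fock ℂ), MvPowerSeries.pderiv ℂ (Sum.inl k) (pairing G x u) =
    pairing G (current ℂ (-(k : ℤ)) x) u
  pderiv_tbar : ∀ (k : ℕ+) (x u : Fock ℂ), MvPowerSeries.pderiv ℂ (Sum.inr k) (pairing G x u) =
    -pairing G x (current ℂ (-(k : ℤ)) u)

theorem Fock.bilin_ext {M : Type*} [AddCommGroup M] [Module ℂ M]
    {f g : Fock ℂ →ₗ[ℂ] Fock ℂ →ₗ[ℂ] M} (h : ∀ S S', f (ket ℂ S) (ket ℂ S') = g (ket ℂ S) (ket ℂ S')) :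
    f = g := by
  refine Finsupp.lhom_ext' fun S => LinearMap.ext_ring (Finsupp.lhom_ext' fun S' =>
    LinearMap.ext_ring ?_)
  exact h S S'

theorem IsTodaKernel.of_basis {G : Op TSeries} (h1 : IsGroupLike G)
    (h2 : ∀ s, IsUnit (G (ground s) (ground s)))
    (h3 : ∀ (k : ℕ+) S S', MvPowerSeries.pderiv ℂ (Sum.inl k) (G S S') =
      Finsupp.linearCombination ℂ (fun Q => G Q S') (current ℂ (-(k : ℤ)) (ket ℂ S)))
    (h4 : ∀ (k : ℕ+) S S', MvPowerSeries.pderiv ℂ (Sum.inr k) (G S S') =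
      -Finsupp.linearCombination ℂ (G S) (current ℂ (-(k : ℤ)) (ket ℂ S'))) :
    IsTodaKernel G where
  groupLike := h1
  isUnit := h2
  pderiv_t k x u := by
    have : (pairing G).compr₂ (MvPowerSeries.pderiv ℂ (Sum.inl k)).toLinearMap =
        (pairing G).comp (current ℂ (-(k : ℤ))) := Fock.bilin_ext fun S S' => by
      rw [LinearMap.compr₂_apply, LinearMap.comp_apply, pairing_ket, pairing_ket_right]
      exact h3 k S S'
    exact LinearMap.congr_fun₂ this x u
  pderiv_tbar k x u := by
    have : (pairing G).compr₂ (MvPowerSeries.pderiv ℂ (Sum.inr k)).toLinearMap =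
        -(pairing G).compl₂ (current ℂ (-(k : ℤ))) := Fock.bilin_ext fun S S' => by
      rw [LinearMap.compr₂_apply, LinearMap.neg_apply, LinearMap.neg_apply, LinearMap.compl₂_apply,
        pairing_ket, pairing_ket_left]
      exact h4 k S S'
    exact LinearMap.congr_fun₂ this x u

/-- The bilinear identity between arbitrary vectors. -/
theorem IsGroupLike.bilinear {G : Op TSeries} (hG : IsGroupLike G) (x y u v : Fock ℂ) :
    ∀ᶠ B : Finset ℤ in atTop,
      ∑ j ∈ B, pairing G (annih ℂ j x) u * pairing G (create ℂ j y) v =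
      ∑ j ∈ B, pairing G x (create ℂ j u) * pairing G y (annih ℂ j v) := by
  have hz : ∀ (r : ℂ) (S : Maya), (Finsupp.single S r : Fock ℂ) = r • ket ℂ S := by simp
  induction x using Finsupp.induction_linear with
  | zero => simp
  | add x x' hx hx' =>
    filter_upwards [hx, hx'] with B h h'
    simp only [map_add, LinearMap.add_apply, add_mul, Finset.sum_add_distrib, h, h']
  | single X r =>
  rw [hz]
  simp only [map_smul, LinearMap.smul_apply, smul_mul_assoc, ← Finset.smul_sum]
  suffices h : ∀ᶠ B : Finset ℤ in atTop,
      ∑ j ∈ B, pairing G (annih ℂ j (ket ℂ X)) u * pairing G (create ℂ j y) v =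
      ∑ j ∈ B, pairing G (ket ℂ X) (create ℂ j u) * pairing G y (annih ℂ j v) by
    filter_upwards [h] with B hB
    rw [hB]
  clear r
  induction y using Finsupp.induction_linear with
  | zero => simp
  | add x x' hx hx' =>
    filter_upwards [hx, hx'] with B h h'
    simp only [map_add, LinearMap.add_apply, mul_add, Finset.sum_add_distrib, h, h']
  | single Y r =>
  rw [hz]
  simp only [map_smul, LinearMap.smul_apply, mul_smul_comm, ← Finset.smul_sum]
  suffices h : ∀ᶠ B : Finset ℤ in atTop,
      ∑ j ∈ B, pairing G (annih ℂ j (ket ℂ X)) u * pairing G (create ℂ j (ket ℂ Y)) v =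
      ∑ j ∈ B, pairing G (ket ℂ X) (create ℂ j u) * pairing G (ket ℂ Y) (annih ℂ j v) by
    filter_upwards [h] with B hB
    rw [hB]
  clear r
  induction u using Finsupp.induction_linear with
  | zero => simp
  | add x x' hx hx' =>
    filter_upwards [hx, hx'] with B h h'
    simp only [map_add, add_mul, Finset.sum_add_distrib, h, h']
  | single U r =>
  rw [hz]
  simp only [map_smul, smul_mul_assoc, ← Finset.smul_sum]
  suffices h : ∀ᶠ B : Finset ℤ in atTop,
      ∑ j ∈ B, pairing G (annih ℂ j (ket ℂ X)) (ket ℂ U) * pairing G (create ℂ j (ket ℂ Y)) v =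
      ∑ j ∈ B, pairing G (ket ℂ X) (create ℂ j (ket ℂ U)) *
        pairing G (ket ℂ Y) (annih ℂ j v) by
    filter_upwards [h] with B hB
    rw [hB]
  clear r
  induction v using Finsupp.induction_linear with
  | zero => simp
  | add x x' hx hx' =>
    filter_upwards [hx, hx'] with B h h'
    simp only [map_add, mul_add, Finset.sum_add_distrib, h, h']
  | single V r =>
  rw [hz]
  simp only [map_smul, mul_smul_comm, ← Finset.smul_sum]
  clear hz
  have hA : ∀ (S : Maya) j, annih ℂ j (ket ℂ S) = (annihCoeff S j : ℂ) • ket ℂ (toggle S j) := by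
    intro S j; rw [annih_single]; simp
  have hC : ∀ (S : Maya) j, create ℂ j (ket ℂ S) = (createCoeff S j : ℂ) • ket ℂ (toggle S j) := by
    intro S j; rw [create_single]; simp
  have hc : ∀ n : ℤ, (n : TSeries) = MvPowerSeries.C (n : ℂ) := fun n => (map_intCast _ n).symm
  have e1 : ∀ j, ((annihCoeff X j * createCoeff Y j : ℤ) : TSeries) *
      (G (toggle X j) U * G (toggle Y j) V) =
      pairing G (annih ℂ j (ket ℂ X)) (ket ℂ U) * pairing G (create ℂ j (ket ℂ Y)) (ket ℂ V) := by
    intro j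
    rw [hA, hC, map_smul, map_smul, LinearMap.smul_apply, LinearMap.smul_apply, pairing_ket,
      pairing_ket, MvPowerSeries.smul_eq_C_mul, MvPowerSeries.smul_eq_C_mul, hc, Int.cast_mul,
      map_mul]
    ring
  have e2 : ∀ j, ((createCoeff U j * annihCoeff V j : ℤ) : TSeries) *
      (G X (toggle U j) * G Y (toggle V j)) =
      pairing G (ket ℂ X) (create ℂ j (ket ℂ U)) * pairing G (ket ℂ Y) (annih ℂ j (ket ℂ V)) := by
    intro j
    rw [hA, hC, map_smul, map_smul, pairing_ket,
      pairing_ket, MvPowerSeries.smul_eq_C_mul, MvPowerSeries.smul_eq_C_mul, hc, Int.cast_mul,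
      map_mul]
    ring
  have h := hG X Y U V
  filter_upwards [eventually_ge_atTop ((finite_annih_create X Y).toFinset ∪
    (finite_annih_create V U).toFinset)] with B hB
  rw [finsum_eq_sum_of_support_subset (s := B), finsum_eq_sum_of_support_subset (s := B),
    Finset.sum_congr rfl fun j _ => e1 j, Finset.sum_congr rfl fun j _ => e2 j] at h
  · rw [h]
  · intro j hj
    refine hB (Finset.mem_union_right _ ((Set.Finite.mem_toFinset _).2 fun h => hj ?_))
    simp only
    rw [mul_comm (createCoeff U j), h, Int.cast_zero, zero_mul]
  · intro j hj
    refine hB (Finset.mem_union_left _ ((Set.Finite.mem_toFinset _).2 fun h => hj ?_))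
    simp only
    rw [h, Int.cast_zero, zero_mul]

/-! ### The kernel attached to `h(c)` -/

/-- The operator `d Γ₋`, where `d` is diagonal. -/
def diagGammaNeg (ħ : ℂ) (d : Maya → ℂ) : Op ℂ := fun S P => d S * GammaNeg (qNegRho ħ) S P

theorem GammaNeg_eq (ħ : ℂ) : GammaNeg (qNegRho ħ) =
    opTranspose (expOp (seriesOfPos (powerSumDiv (qNegRho ħ)))) := by
  rw [GammaNeg, opExp_currentNeg]

theorem GammaPos_eq (ħ : ℂ) : GammaPos (qNegRho ħ) = opTranspose (GammaNeg (qNegRho ħ)) := by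
  rw [GammaNeg_eq, GammaPos, opExp_currentPos]; rfl

theorem finite_support_GammaNeg (ħ : ℂ) (S : Maya) :
    (Function.support (GammaNeg (qNegRho ħ) S)).Finite := by
  rw [GammaNeg_eq]
  exact (currentExp (seriesOfPos (powerSumDiv (qNegRho ħ))) (ket ℂ S)).hasFiniteSupport

theorem rowFinite_constOp_diagGammaNeg (ħ : ℂ) (d : Maya → ℂ) :
    RowFinite (constOp (diagGammaNeg ħ d)) := fun S =>
  .of_finite ((finite_support_GammaNeg ħ S).subset fun P hP h => hP (by
    simp only [constOp, diagGammaNeg]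
    rw [h, mul_zero, map_zero]))

theorem isGroupLike_diagGammaNeg (ħ : ℂ) {d : Maya → ℂ}
    (hd : ∀ X Y j, j ∈ X.1 → j ∉ Y.1 → d (toggle X j) * d (toggle Y j) = d X * d Y) :
    IsGroupLike (diagGammaNeg ħ d) := by
  refine IsGroupLike.scale_left ?_ hd
  rw [GammaNeg_eq]
  exact (isGroupLike_expOp (coeff_zero_seriesOfPos _)).transpose

/-- The operator `h(c)` as `(D Γ₋) (D' Γ₋)ᵀ` with diagonal `D`, `D'`, using `Γ₊ = Γ₋ᵀ`. -/
theorem constOp_opHc (ħ τ c : ℂ) : constOp (opHc ħ τ c) =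
    opMul (constOp (diagGammaNeg ħ fun S => qpow ħ ((τ + τ⁻¹ + 2) * (4 * c ^ 3 - c) / 24) *
        qpow ħ ((τ + 1) * shiftedKWeight c S)))
      (opTranspose (constOp (diagGammaNeg ħ fun S => qpow ħ ((τ⁻¹ + 1) * shiftedKWeight c S)))) := by
  funext S S'
  have h0 : ∀ P ∉ (finite_support_GammaNeg ħ S).toFinset, GammaNeg (qNegRho ħ) S P = 0 := by
    intro P hP
    by_contra h
    exact hP ((Set.Finite.mem_toFinset _).2 h)
  rw [constOp, opHc_apply, GammaGamma, opMul, tsum_eq_sum (s := (finite_support_GammaNeg ħ S).toFinset)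
    fun P hP => by rw [h0 P hP, zero_mul], opMul,
    tsum_eq_sum (s := (finite_support_GammaNeg ħ S).toFinset)
    fun P hP => by simp only [constOp, diagGammaNeg]; rw [h0 P hP, mul_zero, map_zero, zero_mul],
    Finset.mul_sum, Finset.sum_mul, Finset.mul_sum, map_sum]
  refine Finset.sum_congr rfl fun P _ => ?_
  rw [GammaPos_eq]
  simp only [constOp, diagGammaNeg, opTranspose]
  rw [← map_mul]
  congr 1
  ring

theorem qpow_ne_zero (ħ a : ℂ) : qpow ħ a ≠ 0 := Complex.exp_ne_zero _

theorem toggle_qpow_shiftedKWeight (ħ a c : ℂ) (X Y : Maya) (j : ℤ) (hX : j ∈ X.1) (hY : j ∉ Y.1) :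
    qpow ħ (a * shiftedKWeight c (toggle X j)) * qpow ħ (a * shiftedKWeight c (toggle Y j)) =
      qpow ħ (a * shiftedKWeight c X) * qpow ħ (a * shiftedKWeight c Y) := by
  rw [← qpow_add, ← qpow_add, ← mul_add, ← mul_add, shiftedKWeight_toggle c hX hY]

/-- The matrix `exp (∑ t_k J_k) g exp (-∑ t̄_k J_{-k})`. -/
def todaMatrix (g : Op ℂ) : Op TSeries :=
  opMul (opMul (opExp (currentPos tvar)) (constOp g)) (opExp (currentNeg fun k => -tbar k))

theorem fermionicTau_eq_todaMatrix (g : Op ℂ) (s : ℤ) :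
    fermionicTau g s = todaMatrix g (ground s) (ground s) := rfl

/-- The factorization of the kernel into two group-like operators with coefficientwise finite
rows. -/
theorem todaMatrix_opHc (ħ τ c : ℂ) : todaMatrix (opHc ħ τ c) =
    opMul (opMul (expOp (seriesOfPos tvar)) (constOp (diagGammaNeg ħ fun S =>
        qpow ħ ((τ + τ⁻¹ + 2) * (4 * c ^ 3 - c) / 24) * qpow ħ ((τ + 1) * shiftedKWeight c S))))
      (opTranspose (opMul (expOp (seriesOfPos fun k => -tbar k))
        (constOp (diagGammaNeg ħ fun S => qpow ħ ((τ⁻¹ + 1) * shiftedKWeight c S))))) := by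
  rw [todaMatrix, opExp_currentPos, opExp_currentNeg, constOp_opHc,
    ← opMul_assoc_of_coeffFinite rowFinite_expOp_tvar
      (Or.inl (rowFinite_constOp_diagGammaNeg ħ _)), opTranspose_opMul]
  exact opMul_assoc_of_coeffFinite
    (rowFinite_expOp_tvar.opMul (rowFinite_constOp_diagGammaNeg ħ _))
    (C := opTranspose (expOp (seriesOfPos fun k => -tbar k))) (Or.inr rowFinite_expOp_neg_tbar)

theorem coeff_zero_expOp {a : ℕ+ → TSeries} (ha : CoeffFinite a)
    (h0 : ∀ k, MvPowerSeries.constantCoeff (a k) = 0) {S P : Maya}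
    (h : MvPowerSeries.constantCoeff (expOp (seriesOfPos a) S P) ≠ 0) : S = P := by
  rw [← opExp_currentPos, ← MvPowerSeries.coeff_zero_eq_constantCoeff_apply] at h
  have hA := rowFinite_currentPos ha
  have hA0 := constantCoeff_currentPos ha h0
  have hfin : CoeffFinite fun n : ℕ => ((n.factorial : ℂ)⁻¹) • opPow (currentPos a) n S P := by
    intro d
    refine (Set.finite_Iic d.degree).subset fun n hn => ?_
    refine le_degree_of_coeff_opPow_ne_zero hA hA0 (S := S) (S' := P) fun h => hn ?_
    rw [MvPowerSeries.coeff_smul, h, mul_zero]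
  obtain ⟨n, hn⟩ := hfin.exists_of_coeff_tsum_ne_zero h
  rw [MvPowerSeries.coeff_smul] at hn
  have h1 := right_ne_zero_of_mul hn
  have h2 := le_degree_of_coeff_opPow_ne_zero hA hA0 h1
  rw [map_zero, Nat.le_zero] at h2
  subst h2
  by_contra hne
  exact h1 (by rw [opPow, opOne, if_neg hne, map_zero])

theorem expOp_ground (a : ℕ+ → TSeries) (s : ℤ) :
    expOp (seriesOfPos a) (ground s) (ground s) = 1 := by
  rw [expOp, currentExp_ground (coeff_zero_seriesOfPos a)]
  simp

theorem CoeffFinite.constantCoeff_tsum {ι : Type*} {f : ι → TSeries} (hf : CoeffFinite f) {i : ι}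
    (h : ∀ j, j ≠ i → MvPowerSeries.constantCoeff (f j) = 0) :
    MvPowerSeries.constantCoeff (∑' j, f j) = MvPowerSeries.constantCoeff (f i) := by
  rw [← MvPowerSeries.coeff_zero_eq_constantCoeff_apply, hf.coeff_tsum]
  exact finsum_eq_single _ _ h

theorem constantCoeff_todaMatrix (g : Op ℂ) (s : ℤ) :
    MvPowerSeries.constantCoeff (todaMatrix g (ground s) (ground s)) = g (ground s) (ground s) := by
  have h1 : ∀ P, P ≠ ground s →
      MvPowerSeries.constantCoeff (expOp (seriesOfPos tvar) (ground s) P) = 0 := by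
    intro P hP
    by_contra h
    exact hP (coeff_zero_expOp (coeffFinite_X Sum.inl_injective)
      (fun _ => MvPowerSeries.constantCoeff_X _) h).symm
  have h2 : ∀ P, P ≠ ground s → MvPowerSeries.constantCoeff
      (expOp (seriesOfPos fun k => -tbar k) (ground s) P) = 0 := by
    intro P hP
    by_contra h
    exact hP (coeff_zero_expOp coeffFinite_neg_tbar constantCoeff_neg_tbar h).symm
  let e := expOp (seriesOfPos tvar)
  let e' := expOp (seriesOfPos fun k => -tbar k)
  let f' : Maya → TSeries := fun P => opMul e (constOp g) (ground s) P * e' (ground s) P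
  let f : Maya → TSeries := fun P => e (ground s) P * constOp g P (ground s)
  have hf' : CoeffFinite f' := (rowFinite_expOp_neg_tbar (ground s)).mul_left _
  have hf : CoeffFinite f := (rowFinite_expOp_tvar (ground s)).mul_right _
  have e1 : MvPowerSeries.constantCoeff (∑' P, f P) = g (ground s) (ground s) := by
    rw [hf.constantCoeff_tsum (i := ground s) fun P hP => by
      simp only [f, e]; rw [map_mul, h1 P hP, zero_mul]]
    simp only [f, e]
    rw [expOp_ground, one_mul, constOp, MvPowerSeries.constantCoeff_C]
  have e2 : MvPowerSeries.constantCoeff (∑' P, f' P) = g (ground s) (ground s) := by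
    rw [hf'.constantCoeff_tsum (i := ground s) fun P hP => by
      simp only [f', e']; rw [map_mul, h2 P hP, mul_zero]]
    simp only [f', e']
    rw [expOp_ground, mul_one]
    exact e1
  rw [todaMatrix, opExp_currentPos, opExp_currentNeg]
  exact e2

theorem GammaGamma_ground (ħ : ℂ) (s : ℤ) : GammaGamma ħ (ground s) (ground s) = 1 := by
  have h : ∀ P, GammaNeg (qNegRho ħ) (ground s) P = ket ℂ (ground s) P := by
    intro P
    rw [GammaNeg_eq, opTranspose, expOp, currentExp_ground (coeff_zero_seriesOfPos _)]
  rw [GammaGamma, opMul, tsum_eq_single (ground s), GammaPos_eq, opTranspose, h]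
  · simp
  · intro P hP
    rw [h, Finsupp.single_eq_of_ne hP, zero_mul]

theorem isTodaKernel_todaMatrix (ħ τ c : ℂ) : IsTodaKernel (todaMatrix (opHc ħ τ c)) := by
  set d : Maya → ℂ := fun S => qpow ħ ((τ + τ⁻¹ + 2) * (4 * c ^ 3 - c) / 24) *
    qpow ħ ((τ + 1) * shiftedKWeight c S) with hd
  set d' : Maya → ℂ := fun S => qpow ħ ((τ⁻¹ + 1) * shiftedKWeight c S) with hd'
  have hX : RowFinite (opMul (expOp (seriesOfPos tvar)) (constOp (diagGammaNeg ħ d))) :=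
    rowFinite_expOp_tvar.opMul (rowFinite_constOp_diagGammaNeg ħ d)
  have hY : RowFinite (opMul (expOp (seriesOfPos fun k => -tbar k))
      (constOp (diagGammaNeg ħ d'))) :=
    rowFinite_expOp_neg_tbar.opMul (rowFinite_constOp_diagGammaNeg ħ d')
  have hXg : IsGroupLike (opMul (expOp (seriesOfPos tvar)) (constOp (diagGammaNeg ħ d))) := by
    refine (isGroupLike_expOp (coeff_zero_seriesOfPos _)).opMul
      (isGroupLike_diagGammaNeg ħ fun X Y j hX hY => ?_).constOp rowFinite_expOp_tvar
    have := toggle_qpow_shiftedKWeight ħ (τ + 1) c X Y j hX hY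
    simp only [hd]
    linear_combination qpow ħ ((τ + τ⁻¹ + 2) * (4 * c ^ 3 - c) / 24) ^ 2 * this
  have hYg : IsGroupLike (opMul (expOp (seriesOfPos fun k => -tbar k))
      (constOp (diagGammaNeg ħ d'))) :=
    (isGroupLike_expOp (coeff_zero_seriesOfPos _)).opMul
      (isGroupLike_diagGammaNeg ħ fun X Y j hX hY =>
        toggle_qpow_shiftedKWeight ħ (τ⁻¹ + 1) c X Y j hX hY).constOp rowFinite_expOp_neg_tbar
  refine IsTodaKernel.of_basis ?_ ?_ ?_ ?_
  · rw [todaMatrix_opHc]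
    exact hXg.opMul hYg.transpose hX
  · intro s
    rw [MvPowerSeries.isUnit_iff_constantCoeff, constantCoeff_todaMatrix, isUnit_iff_ne_zero,
      opHc_apply, GammaGamma_ground]
    simp [qpow_ne_zero]
  · intro k S S'
    rw [todaMatrix_opHc]
    have h := ((hasTimeDeriv_tvar k).opMul_constOp rowFinite_expOp_tvar
      (diagGammaNeg ħ d)).opMul_opTranspose ((hasTimeDeriv_neg_tbar_inl k).opMul_constOp
      rowFinite_expOp_neg_tbar (diagGammaNeg ħ d')) hX hY S S'
    rw [one_smul, zero_smul, add_zero] at h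
    exact h
  · intro k S S'
    rw [todaMatrix_opHc]
    have h := ((hasTimeDeriv_tvar_inr k).opMul_constOp rowFinite_expOp_tvar
      (diagGammaNeg ħ d)).opMul_opTranspose ((hasTimeDeriv_neg_tbar k).opMul_constOp
      rowFinite_expOp_neg_tbar (diagGammaNeg ħ d')) hX hY S S'
    rw [zero_smul, zero_add, neg_one_smul] at h
    exact h

/-! ### Shifts of the tau function as matrix elements with a fermion -/

theorem annih_ground_self (s : ℤ) : annih ℂ s (ket ℂ (ground s)) = ket ℂ (ground (s - 1)) := by
  have h : toggle (ground s) s = ground (s - 1) := Maya.ext_mem fun n => by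
    rw [mem_toggle, mem_ground, mem_ground]; omega
  rw [annih_single, annihCoeff_of_mem (mem_ground.2 le_rfl),
    fsign_of_top fun n hn => mem_ground.1 hn, h]
  simp

theorem create_ground_succ (s : ℤ) : create ℂ s (ket ℂ (ground (s - 1))) = ket ℂ (ground s) := by
  have h : toggle (ground (s - 1)) s = ground s := Maya.ext_mem fun n => by
    rw [mem_toggle, mem_ground, mem_ground]; omega
  rw [← h, ket_toggle_top]
  intro n hn
  rw [mem_ground] at hn
  omega

theorem annih_ground {s j : ℤ} (h : s < j) : annih ℂ j (ket ℂ (ground s)) = 0 := by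
  rw [annih_single, annihCoeff_of_notMem (by rw [mem_ground]; omega)]
  simp

theorem create_ground {s j : ℤ} (h : j ≤ s) : create ℂ j (ket ℂ (ground s)) = 0 := by
  rw [create_single, createCoeff_of_mem (mem_ground.2 h)]
  simp

/-- On a ground state the bilinear sum of `J_{-(k+1)}` may be taken over any window of sites
containing those `l` for which `ψ*` hits a filled site and `ψ` an empty one. -/
theorem current_neg_ground {k m : ℕ} {b s : ℤ} (h1 : b ≤ s + 1) (h2 : s + k + 1 ≤ b + m) :
    current ℂ (-((k : ℤ) + 1)) (ket ℂ (ground s)) = ∑ l ∈ Finset.range (m + 1),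
      create ℂ (b + l) (annih ℂ (b + l - (k + 1)) (ket ℂ (ground s))) := by
  obtain ⟨B, hB, hI⟩ := ((current_eventually (k := -((k : ℤ) + 1)) (by omega)
    (ket ℂ (ground s))).and (eventually_ge_atTop
      ((Finset.range (m + 1)).image fun l : ℕ => b + (l : ℤ)))).exists
  rw [hB, ← Finset.sum_subset hI, Finset.sum_image]
  · exact Finset.sum_congr rfl fun l _ => rfl
  · intro l _ l' _ h; simpa using h
  · intro q _ hq
    by_cases h3 : s < q + -((k : ℤ) + 1)
    · rw [annih_ground h3, map_zero]
    · by_cases h4 : q ≤ s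
      · have e := create_annih (R := ℂ) q (q + -((k : ℤ) + 1)) (ket ℂ (ground s))
        rw [create_ground h4, map_zero, if_neg (by omega)] at e
        simpa using e
      · exfalso
        refine hq (Finset.mem_image.2 ⟨(q - b).toNat, ?_, ?_⟩)
        · rw [Finset.mem_range]; omega
        · omega

theorem sum_sum_eq_zero_of_antisymm {M : Type*} [AddCommGroup M] [Module ℂ M] (I : Finset ℕ)
    {f : ℕ → ℕ → M} (h : ∀ k l, f k l = -f l k) : ∑ k ∈ I, ∑ l ∈ I, f k l = 0 := by
  have h1 : ∑ k ∈ I, ∑ l ∈ I, f k l = -∑ k ∈ I, ∑ l ∈ I, f k l := by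
    conv_lhs => rw [Finset.sum_comm]
    rw [← Finset.sum_neg_distrib]
    refine Finset.sum_congr rfl fun k _ => ?_
    rw [← Finset.sum_neg_distrib]
    exact Finset.sum_congr rfl fun l _ => h l k
  have h2 : (2 : ℂ) • ∑ k ∈ I, ∑ l ∈ I, f k l = 0 := by
    rw [two_smul]
    nth_rewrite 1 [h1]
    exact neg_add_cancel _
  exact (smul_eq_zero.1 h2).resolve_left two_ne_zero

/-- Newton's recursion for the states `ψ* |s⟩`. The terms that are quadratic in `ψ*` cancel by
antisymmetry. -/
theorem annih_ground_recursion (s : ℤ) (m : ℕ) :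
    ((m : ℂ) + 1) • annih ℂ (s - (m + 1 : ℕ)) (ket ℂ (ground s)) =
      -∑ k ∈ Finset.range (m + 1), current ℂ (-((k : ℤ) + 1))
        (annih ℂ (s - (m - k : ℕ)) (ket ℂ (ground s))) := by
  have h1 : ∀ k ∈ Finset.range (m + 1), current ℂ (-((k : ℤ) + 1))
      (annih ℂ (s - (m - k : ℕ)) (ket ℂ (ground s))) =
      (-∑ l ∈ Finset.range (m + 1), create ℂ (s - m + k + l + 1)
        (annih ℂ (s - m + k) (annih ℂ (s - m + l) (ket ℂ (ground s))))) -
      annih ℂ (s - (m + 1 : ℕ)) (ket ℂ (ground s)) := by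
    intro k hk
    rw [Finset.mem_range] at hk
    have e : s - (m - k : ℕ) = s - m + k := by omega
    rw [e, current_annih (by omega), current_neg_ground (b := s - m + k + 1) (m := m) (by omega)
      (by omega), map_sum, ← Finset.sum_neg_distrib]
    congr 1
    · refine Finset.sum_congr rfl fun l _ => ?_
      rw [annih_create, if_neg (by omega), zero_sub, add_right_comm _ 1 (l : ℤ),
        show s - m + k + l + 1 - ((k : ℤ) + 1) = s - m + l by ring]
    · rw [show s - m + k + -((k : ℤ) + 1) = s - (m + 1 : ℕ) by push_cast; ring]
  rw [Finset.sum_congr rfl h1, Finset.sum_sub_distrib, Finset.sum_neg_distrib,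
    sum_sum_eq_zero_of_antisymm]
  · rw [neg_zero, zero_sub, neg_neg, Finset.sum_const, Finset.card_range, ← Nat.cast_smul_eq_nsmul ℂ]
    push_cast; rfl
  · intro k l
    rw [annih_annih, map_neg, add_right_comm (s - m) (k : ℤ) (l : ℤ)]

/-- Newton's recursion for the states `ψ |s - 1⟩`. The terms that are quadratic in `ψ` cancel by
antisymmetry. -/
theorem create_ground_recursion (s : ℤ) (m : ℕ) :
    ((m : ℂ) + 1) • create ℂ (s + (m + 1 : ℕ)) (ket ℂ (ground (s - 1))) =
      ∑ k ∈ Finset.range (m + 1), current ℂ (-((k : ℤ) + 1))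
        (create ℂ (s + (m - k : ℕ)) (ket ℂ (ground (s - 1)))) := by
  have h1 : ∀ k ∈ Finset.range (m + 1), current ℂ (-((k : ℤ) + 1))
      (create ℂ (s + (m - k : ℕ)) (ket ℂ (ground (s - 1)))) =
      (∑ l ∈ Finset.range (m + 1), create ℂ (s + (m + 1 - 1 - k : ℕ))
        (create ℂ (s + l) (annih ℂ (s + l + (m + 1 - 1 - k : ℕ) - (m + 1))
          (ket ℂ (ground (s - 1)))))) +
      create ℂ (s + (m + 1 : ℕ)) (ket ℂ (ground (s - 1))) := by
    intro k hk
    rw [Finset.mem_range] at hk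
    have e1 : s + ((m - k : ℕ) : ℤ) = s + ((m + 1 - 1 - k : ℕ) : ℤ) := by omega
    have e2 : s + ((m + 1 - 1 - k : ℕ) : ℤ) - -((k : ℤ) + 1) = s + ((m + 1 : ℕ) : ℤ) := by omega
    rw [e1, current_create (by omega), current_neg_ground (b := s) (m := m) (by omega)
      (by omega), map_sum, e2]
    refine congrArg (· + _) (Finset.sum_congr rfl fun l _ => ?_)
    rw [show s + l + ((m + 1 - 1 - k : ℕ) : ℤ) - (m + 1) = s + l - ((k : ℤ) + 1) by omega]
  rw [Finset.sum_congr rfl h1, Finset.sum_add_distrib,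
    Finset.sum_range_reflect (fun k : ℕ => ∑ l ∈ Finset.range (m + 1), create ℂ (s + k)
        (create ℂ (s + l) (annih ℂ (s + l + k - (m + 1)) (ket ℂ (ground (s - 1)))))) (m + 1),
    sum_sum_eq_zero_of_antisymm]
  · rw [zero_add, Finset.sum_const, Finset.card_range, ← Nat.cast_smul_eq_nsmul ℂ]
    push_cast; rfl
  · intro k l
    rw [create_create, add_right_comm s (k : ℤ) (l : ℤ)]

/-- The tau function of a kernel. -/
def kernelTau (G : Op TSeries) (s : ℤ) : TSeries := G (ground s) (ground s)

section Kernel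

variable {G : Op TSeries}

theorem pairing_ground (G : Op TSeries) (s : ℤ) :
    pairing G (ket ℂ (ground s)) (ket ℂ (ground s)) = kernelTau G s := pairing_ket G _ _

theorem IsTodaKernel.wCoeff_shiftT (hG : IsTodaKernel G) (s : ℤ) (m : ℕ) :
    wCoeff m (shiftT (kernelTau G (s - 1))) =
      pairing G (annih ℂ (s - m) (ket ℂ (ground s))) (ket ℂ (ground (s - 1))) := by
  refine isTimeShift_shiftTVar.wCoeff_eq Sum.inl_injective (y := fun m : ℕ =>
    pairing G (annih ℂ (s - m) (ket ℂ (ground s))) (ket ℂ (ground (s - 1)))) ?_ (fun m => ?_) m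
  · simp only [Nat.cast_zero, sub_zero]
    rw [annih_ground_self, pairing_ground]
  · simp only [hG.pderiv_t, Nat.succPNat_coe, Nat.cast_succ]
    rw [← LinearMap.smul_apply, ← map_smul]
    have h := annih_ground_recursion s m
    push_cast at h
    rw [h, map_neg, map_sum, LinearMap.neg_apply, LinearMap.sum_apply]

theorem IsTodaKernel.wCoeff_shiftTbar (hG : IsTodaKernel G) (s : ℤ) (m : ℕ) :
    wCoeff m (shiftTbar (kernelTau G s)) =
      pairing G (ket ℂ (ground s)) (create ℂ (s + m) (ket ℂ (ground (s - 1)))) := by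
  refine isTimeShift_shiftTbarVar.wCoeff_eq Sum.inr_injective (y := fun m : ℕ =>
    pairing G (ket ℂ (ground s)) (create ℂ (s + m) (ket ℂ (ground (s - 1))))) ?_ (fun m => ?_) m
  · simp only [Nat.cast_zero, add_zero]
    rw [create_ground_succ, pairing_ground]
  · simp only [hG.pderiv_tbar, Nat.succPNat_coe, Nat.cast_succ]
    rw [← map_smul]
    have h := create_ground_recursion s m
    push_cast at h
    rw [h, map_sum, Finset.sum_neg_distrib, neg_neg]

/-! ### The dressing operators and their inverses -/

theorem IsTodaKernel.dressW_apply (hG : IsTodaKernel G) (n s : ℤ) :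
    dressW (kernelTau G) n s =
      (kernelTau G (s - 1))⁻¹ *
        pairing G (annih ℂ (s + n) (ket ℂ (ground s))) (ket ℂ (ground (s - 1))) := by
  rw [dressW]
  split_ifs with h
  · rw [hG.wCoeff_shiftT, mul_comm]
    congr 5; omega
  · rw [annih_ground (by omega), map_zero, LinearMap.zero_apply, mul_zero]

theorem IsTodaKernel.dressWbar_apply (hG : IsTodaKernel G) (n s : ℤ) :
    dressWbar (kernelTau G) n s =
      (kernelTau G (s - 1))⁻¹ *
        pairing G (ket ℂ (ground s)) (create ℂ (s + n) (ket ℂ (ground (s - 1)))) := by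
  rw [dressWbar]
  split_ifs with h
  · rw [hG.wCoeff_shiftTbar, mul_comm]
    congr 4; omega
  · rw [create_ground (by omega), map_zero, mul_zero]

/-- The inverse of the dressing operator `W`: its coefficients are matrix elements with `ψ*`. -/
def dressWInv (G : Op TSeries) : DiffOp := fun n s =>
  pairing G (create ℂ s (ket ℂ (ground (s + n - 1)))) (ket ℂ (ground (s + n))) *
    (kernelTau G (s + n))⁻¹

/-- The inverse of the dressing operator `W̄`. -/
def dressWbarInv (G : Op TSeries) : DiffOp := fun n s =>
  pairing G (ket ℂ (ground (s + n - 1))) (annih ℂ s (ket ℂ (ground (s + n)))) *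
    (kernelTau G (s + n))⁻¹

theorem dressWInv_of_pos (G : Op TSeries) {n : ℤ} (s : ℤ) (h : 0 < n) : dressWInv G n s = 0 := by
  rw [dressWInv, create_ground (by omega), map_zero, LinearMap.zero_apply, zero_mul]

theorem dressWbarInv_of_neg (G : Op TSeries) {n : ℤ} (s : ℤ) (h : n < 0) :
    dressWbarInv G n s = 0 := by
  rw [dressWbarInv, annih_ground (by omega), map_zero, zero_mul]

/-- The bilinear identity as an identity between products of difference operators. -/
theorem IsTodaKernel.finsum_eq (hG : IsTodaKernel G) (c₁ c₂ : TSeries) (x₁ x₂ u₁ u₂ : Fock ℂ)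
    (n s : ℤ) :
    ∑ᶠ k : ℤ, (c₁ * pairing G (annih ℂ (s + k) x₁) u₁ + c₂ * pairing G (annih ℂ (s + k) x₂) u₂) *
        dressWInv G (n - k) (s + k) =
      ∑ᶠ k : ℤ, (c₁ * pairing G x₁ (create ℂ (s + k) u₁) +
        c₂ * pairing G x₂ (create ℂ (s + k) u₂)) * dressWbarInv G (n - k) (s + k) := by
  set y := ket ℂ (ground (s + n - 1)) with hy
  set v := ket ℂ (ground (s + n)) with hv
  set r := (kernelTau G (s + n))⁻¹ with hr
  have hV : ∀ k, dressWInv G (n - k) (s + k) = pairing G (create ℂ (s + k) y) v * r := by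
    intro k
    rw [dressWInv, add_add_sub_cancel]
  have hVb : ∀ k, dressWbarInv G (n - k) (s + k) = pairing G y (annih ℂ (s + k) v) * r := by
    intro k
    rw [dressWbarInv, add_add_sub_cancel]
  let f : ℤ → TSeries := fun j => (c₁ * pairing G (annih ℂ j x₁) u₁ +
    c₂ * pairing G (annih ℂ j x₂) u₂) * (pairing G (create ℂ j y) v * r)
  let g : ℤ → TSeries := fun j => (c₁ * pairing G x₁ (create ℂ j u₁) +
    c₂ * pairing G x₂ (create ℂ j u₂)) * (pairing G y (annih ℂ j v) * r)
  have hf : (Function.support f).Finite := by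
    obtain ⟨N₁, h1⟩ := annih_eq_zero_of_large x₁
    obtain ⟨N₂, h2⟩ := annih_eq_zero_of_large x₂
    obtain ⟨M, h3⟩ := create_eq_zero_of_small y
    refine (Set.finite_Icc M (max N₁ N₂)).subset fun j hj => ?_
    rw [Set.mem_Icc]
    by_contra h
    rw [not_and_or, not_le, not_le] at h
    refine hj ?_
    simp only [f]
    rcases h with h | h
    · rw [h3 j h]; simp
    · rw [h1 j (lt_of_le_of_lt (le_max_left _ _) h), h2 j (lt_of_le_of_lt (le_max_right _ _) h)]
      simp
  have hg : (Function.support g).Finite := by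
    obtain ⟨N₁, h1⟩ := create_eq_zero_of_small u₁
    obtain ⟨N₂, h2⟩ := create_eq_zero_of_small u₂
    obtain ⟨M, h3⟩ := annih_eq_zero_of_large v
    refine (Set.finite_Icc (min N₁ N₂) M).subset fun j hj => ?_
    rw [Set.mem_Icc]
    by_contra h
    rw [not_and_or, not_le, not_le] at h
    refine hj ?_
    simp only [g]
    rcases h with h | h
    · rw [h1 j (lt_of_lt_of_le h (min_le_left _ _)), h2 j (lt_of_lt_of_le h (min_le_right _ _))]
      simp
    · rw [h3 j h]; simp
  obtain ⟨B, h1, h2, h3⟩ := ((hG.groupLike.bilinear x₁ y u₁ v).and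
    ((hG.groupLike.bilinear x₂ y u₂ v).and
      (eventually_ge_atTop (hf.toFinset ∪ hg.toFinset)))).exists
  have key : ∑ᶠ j, f j = ∑ᶠ j, g j := by
    rw [finsum_eq_sum_of_support_subset (s := B) f fun j hj =>
        h3 (Finset.mem_union_left _ (hf.mem_toFinset.2 hj)),
      finsum_eq_sum_of_support_subset (s := B) g fun j hj =>
        h3 (Finset.mem_union_right _ (hg.mem_toFinset.2 hj))]
    have e1 : ∑ j ∈ B, f j = c₁ * r * (∑ j ∈ B, pairing G (annih ℂ j x₁) u₁ *
        pairing G (create ℂ j y) v) + c₂ * r * (∑ j ∈ B, pairing G (annih ℂ j x₂) u₂ *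
        pairing G (create ℂ j y) v) := by
      rw [Finset.mul_sum, Finset.mul_sum, ← Finset.sum_add_distrib]
      refine Finset.sum_congr rfl fun j _ => ?_
      simp only [f]; ring
    have e2 : ∑ j ∈ B, g j = c₁ * r * (∑ j ∈ B, pairing G x₁ (create ℂ j u₁) *
        pairing G y (annih ℂ j v)) + c₂ * r * (∑ j ∈ B, pairing G x₂ (create ℂ j u₂) *
        pairing G y (annih ℂ j v)) := by
      rw [Finset.mul_sum, Finset.mul_sum, ← Finset.sum_add_distrib]
      refine Finset.sum_congr rfl fun j _ => ?_
      simp only [g]; ring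
    rw [e1, e2, h1, h2]
  simp only [hV, hVb]
  exact (finsum_comp_equiv (Equiv.addLeft s) (f := f)).trans
    (key.trans (finsum_comp_equiv (Equiv.addLeft s) (f := g)).symm)

theorem IsTodaKernel.mul_inv (hG : IsTodaKernel G) (s : ℤ) :
    kernelTau G s * (kernelTau G s)⁻¹ = 1 :=
  MvPowerSeries.mul_inv_cancel _
    (MvPowerSeries.isUnit_iff_constantCoeff.1 (hG.isUnit s)).ne_zero

theorem IsTodaKernel.dressW_zero (hG : IsTodaKernel G) (s : ℤ) :
    dressW (kernelTau G) 0 s = 1 := by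
  rw [hG.dressW_apply, add_zero, annih_ground_self, pairing_ground, mul_comm, hG.mul_inv]

theorem IsTodaKernel.dressWInv_zero (hG : IsTodaKernel G) (s : ℤ) : dressWInv G 0 s = 1 := by
  rw [dressWInv, add_zero, create_ground_succ, pairing_ground, hG.mul_inv]

theorem dmul_dLambda (a : DiffOp) (k n s : ℤ) : dmul a (dLambda k) n s = a (n - k) s := by
  rw [dmul, finsum_eq_single _ (n - k)]
  · rw [dLambda, if_pos (by ring), mul_one]
  · intro j hj
    rw [dLambda, if_neg (by omega), mul_zero]

theorem dLambda_dmul (a : DiffOp) (k n s : ℤ) : dmul (dLambda k) a n s = a (n - k) (s + k) := by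
  rw [dmul, finsum_eq_single _ k]
  · rw [dLambda, if_pos rfl, one_mul]
  · intro j hj
    rw [dLambda, if_neg hj, zero_mul]

theorem IsTodaKernel.dmul_dressW_eq (hG : IsTodaKernel G) :
    dmul (dressW (kernelTau G)) (dressWInv G) = dmul (dressWbar (kernelTau G)) (dressWbarInv G) := by
  funext n s
  have h := hG.finsum_eq (kernelTau G (s - 1))⁻¹ 0 (ket ℂ (ground s)) 0 (ket ℂ (ground (s - 1))) 0 n s
  simp only [zero_mul, add_zero, ← hG.dressW_apply, ← hG.dressWbar_apply] at h
  exact h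

theorem dressW_of_pos (T : ℤ → TSeries) {n : ℤ} (s : ℤ) (h : 0 < n) : dressW T n s = 0 := by
  rw [dressW, if_neg (by omega)]

theorem dressWbar_of_neg (T : ℤ → TSeries) {n : ℤ} (s : ℤ) (h : n < 0) : dressWbar T n s = 0 := by
  rw [dressWbar, if_neg (by omega)]

theorem IsTodaKernel.dmul_dressWInv (hG : IsTodaKernel G) :
    dmul (dressW (kernelTau G)) (dressWInv G) = dLambda 0 := by
  funext n s
  rw [dLambda]
  rcases lt_trichotomy n 0 with h | rfl | h
  · rw [if_neg h.ne, hG.dmul_dressW_eq]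
    refine finsum_eq_zero_of_forall_eq_zero fun k => ?_
    by_cases hk : k < 0
    · rw [dressWbar_of_neg _ _ hk, zero_mul]
    · rw [dressWbarInv_of_neg _ _ (by omega), mul_zero]
  · rw [if_pos rfl, dmul, finsum_eq_single _ 0, hG.dressW_zero, sub_zero, hG.dressWInv_zero, one_mul]
    intro k hk
    by_cases hk : 0 < k
    · rw [dressW_of_pos _ _ hk, zero_mul]
    · rw [dressWInv_of_pos _ _ (by omega), mul_zero]
  · rw [if_neg h.ne']
    refine finsum_eq_zero_of_forall_eq_zero fun k => ?_
    by_cases hk : 0 < k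
    · rw [dressW_of_pos _ _ hk, zero_mul]
    · rw [dressWInv_of_pos _ _ (by omega), mul_zero]

theorem IsTodaKernel.dmul_dressWbarInv (hG : IsTodaKernel G) :
    dmul (dressWbar (kernelTau G)) (dressWbarInv G) = dLambda 0 := by
  rw [← hG.dmul_dressW_eq, hG.dmul_dressWInv]

theorem pderiv_mul (i : Time) (f g : TSeries) : MvPowerSeries.pderiv ℂ i (f * g) =
    f * MvPowerSeries.pderiv ℂ i g + MvPowerSeries.pderiv ℂ i f * g := by
  rw [Derivation.leibniz, smul_eq_mul, smul_eq_mul, mul_comm g]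

/-- The bilinear identity for `⟨s|J_k` and `|s - 1⟩`. -/
theorem IsTodaKernel.dderiv_t (hG : IsTodaKernel G) (k : ℕ+) :
    dmul (dderiv (Sum.inl k) (dressW (kernelTau G)) +
        dmul (dressW (kernelTau G)) (dLambda k)) (dressWInv G) =
      dmul (dderiv (Sum.inl k) (dressWbar (kernelTau G))) (dressWbarInv G) := by
  have hk : (-(k : ℤ)) ≠ 0 := neg_ne_zero.2 (by exact_mod_cast k.ne_zero)
  funext n s
  set r := (kernelTau G (s - 1))⁻¹ with hr
  set x := ket ℂ (ground s) with hx
  set u := ket ℂ (ground (s - 1)) with hu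
  have e1 : ∀ j, (dderiv (Sum.inl k) (dressW (kernelTau G)) +
      dmul (dressW (kernelTau G)) (dLambda k)) j s =
      r * pairing G (annih ℂ (s + j) (current ℂ (-(k : ℤ)) x)) u +
        MvPowerSeries.pderiv ℂ (Sum.inl k) r * pairing G (annih ℂ (s + j) x) u := by
    intro j
    rw [Pi.add_apply, Pi.add_apply, dmul_dLambda, dderiv, hG.dressW_apply, hG.dressW_apply,
      pderiv_mul, hG.pderiv_t, current_annih hk, map_sub, LinearMap.sub_apply,
      show s + j + -(k : ℤ) = s + (j - k) by ring]
    ring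
  have e2 : ∀ j, dderiv (Sum.inl k) (dressWbar (kernelTau G)) j s =
      r * pairing G (current ℂ (-(k : ℤ)) x) (create ℂ (s + j) u) +
        MvPowerSeries.pderiv ℂ (Sum.inl k) r * pairing G x (create ℂ (s + j) u) := by
    intro j
    rw [dderiv, hG.dressWbar_apply, pderiv_mul, hG.pderiv_t]
  simp only [dmul] at e1 e2 ⊢
  simp only [e1, e2]
  exact hG.finsum_eq r _ _ x u u n s

/-- The bilinear identity for `⟨s|` and `J_{-k}|s - 1⟩`. -/
theorem IsTodaKernel.dderiv_tbar (hG : IsTodaKernel G) (k : ℕ+) :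
    dmul (dderiv (Sum.inr k) (dressW (kernelTau G))) (dressWInv G) =
      dmul (dderiv (Sum.inr k) (dressWbar (kernelTau G)) +
        dmul (dressWbar (kernelTau G)) (dLambda (-(k : ℤ)))) (dressWbarInv G) := by
  have hk : (-(k : ℤ)) ≠ 0 := neg_ne_zero.2 (by exact_mod_cast k.ne_zero)
  funext n s
  set r := (kernelTau G (s - 1))⁻¹ with hr
  set x := ket ℂ (ground s) with hx
  set u := ket ℂ (ground (s - 1)) with hu
  have e1 : ∀ j, dderiv (Sum.inr k) (dressW (kernelTau G)) j s =
      (-r) * pairing G (annih ℂ (s + j) x) (current ℂ (-(k : ℤ)) u) +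
        MvPowerSeries.pderiv ℂ (Sum.inr k) r * pairing G (annih ℂ (s + j) x) u := by
    intro j
    rw [dderiv, hG.dressW_apply, pderiv_mul, hG.pderiv_tbar]
    ring
  have e2 : ∀ j, (dderiv (Sum.inr k) (dressWbar (kernelTau G)) +
      dmul (dressWbar (kernelTau G)) (dLambda (-(k : ℤ)))) j s =
      (-r) * pairing G x (create ℂ (s + j) (current ℂ (-(k : ℤ)) u)) +
        MvPowerSeries.pderiv ℂ (Sum.inr k) r * pairing G x (create ℂ (s + j) u) := by
    intro j
    rw [Pi.add_apply, Pi.add_apply, dmul_dLambda, dderiv, hG.dressWbar_apply, hG.dressWbar_apply,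
      pderiv_mul, hG.pderiv_tbar, current_create hk, map_add,
      show s + j - -(k : ℤ) = s + (j - -(k : ℤ)) by ring]
    ring
  simp only [dmul] at e1 e2 ⊢
  simp only [e1, e2]
  exact hG.finsum_eq (-r) _ x x _ u n s

end Kernel

/-! ### Rings of difference operators -/

/-- The difference operators whose powers `Λ^n` have bounded `σ n`, where `σ = ±1`. -/
def halfBounded (σ : ℤˣ) : AddSubgroup DiffOp where
  carrier := {a | ∃ N : ℤ, ∀ n s, N < σ * n → a n s = 0}
  zero_mem' := ⟨0, fun _ _ _ => rfl⟩
  add_mem' := by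
    rintro a b ⟨N, ha⟩ ⟨M, hb⟩
    refine ⟨max N M, fun n s h => ?_⟩
    rw [Pi.add_apply, Pi.add_apply, ha n s (lt_of_le_of_lt (le_max_left _ _) h),
      hb n s (lt_of_le_of_lt (le_max_right _ _) h), add_zero]
  neg_mem' := by
    rintro a ⟨N, ha⟩
    exact ⟨N, fun n s h => by rw [Pi.neg_apply, Pi.neg_apply, ha n s h, neg_zero]⟩

theorem finite_units_mul_mem_Icc (σ : ℤˣ) (x y : ℤ) :
    {k : ℤ | x ≤ σ * k ∧ σ * k ≤ y}.Finite := by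
  rcases Int.units_eq_one_or σ with rfl | rfl
  · exact (Set.finite_Icc x y).subset fun k hk => by simpa using hk
  · refine (Set.finite_Icc (-y) (-x)).subset fun k hk => ?_
    have h1 : x ≤ -k := by simpa using hk.1
    have h2 : -k ≤ y := by simpa using hk.2
    rw [Set.mem_Icc]; omega

section Ring

variable {σ : ℤˣ}

theorem finite_support_dmul {a b : DiffOp} (ha : a ∈ halfBounded σ) (hb : b ∈ halfBounded σ)
    (n s : ℤ) : (Function.support fun k => a k s * b (n - k) (s + k)).Finite := by
  obtain ⟨N, ha⟩ := ha
  obtain ⟨M, hb⟩ := hb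
  refine (finite_units_mul_mem_Icc σ (σ * n - M) N).subset fun k hk => ?_
  by_contra h
  rw [Set.mem_ofPred_eq, not_and_or, not_le, not_le] at h
  rcases h with h | h
  · exact hk (by simp only; rw [hb _ _ (by rw [mul_sub]; linarith), mul_zero])
  · exact hk (by simp only; rw [ha _ _ h, zero_mul])

theorem dmul_eq_zero {a b : DiffOp} {N M : ℤ} (ha : ∀ n s, N < σ * n → a n s = 0)
    (hb : ∀ n s, M < σ * n → b n s = 0) {n : ℤ} (s : ℤ) (h : N + M < σ * n) :
    dmul a b n s = 0 := by
  refine finsum_eq_zero_of_forall_eq_zero fun k => ?_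
  by_cases hk : N < σ * k
  · rw [ha _ _ hk, zero_mul]
  · rw [hb _ _ (by rw [mul_sub]; linarith), mul_zero]

theorem dmul_mem {a b : DiffOp} (ha : a ∈ halfBounded σ) (hb : b ∈ halfBounded σ) :
    dmul a b ∈ halfBounded σ := by
  obtain ⟨N, ha⟩ := ha
  obtain ⟨M, hb⟩ := hb
  exact ⟨N + M, fun n s h => dmul_eq_zero ha hb s h⟩

theorem dLambda_mem (m : ℤ) : dLambda m ∈ halfBounded σ :=
  ⟨σ * m, fun n s h => if_neg fun hn => by rw [hn] at h; exact lt_irrefl _ h⟩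

theorem finsum_mul_finsum_assoc {R : Type*} [CommRing R] (a : ℤ → R) (b : ℤ → ℤ → R) (c : ℤ → R)
    (hF : (Function.support fun x : ℤ × ℤ => a x.1 * b x.1 x.2 * c x.2).Finite)
    (hab : ∀ m, (Function.support fun k => a k * b k m).Finite)
    (hbc : ∀ k, (Function.support fun m => b k m * c m).Finite) :
    ∑ᶠ m, (∑ᶠ k, a k * b k m) * c m = ∑ᶠ k, a k * ∑ᶠ m, b k m * c m := by
  have e1 : ∀ m, (∑ᶠ k, a k * b k m) * c m = ∑ᶠ k, a k * b k m * c m := fun m =>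
    finsum_mul' _ _ (hab m)
  have e2 : ∀ k, (a k * ∑ᶠ m, b k m * c m) = ∑ᶠ m, a k * b k m * c m := fun k => by
    rw [mul_finsum' _ _ (hbc k)]
    exact finsum_congr fun m => (mul_assoc _ _ _).symm
  rw [finsum_congr e1, finsum_congr e2]
  have h1 := finsum_curry _ hF
  have h2 := finsum_curry (fun x : ℤ × ℤ => a x.2 * b x.2 x.1 * c x.1)
    (hF.preimage (Equiv.prodComm ℤ ℤ).injective.injOn)
  rw [← h1, ← h2]
  exact finsum_comp_equiv (Equiv.prodComm ℤ ℤ)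
    (f := fun x : ℤ × ℤ => a x.1 * b x.1 x.2 * c x.2)

/-- Associativity for operators bounded on the same side; it fails for general formal sums. -/
theorem dmul_assoc {a b c : DiffOp} (ha : a ∈ halfBounded σ) (hb : b ∈ halfBounded σ)
    (hc : c ∈ halfBounded σ) : dmul (dmul a b) c = dmul a (dmul b c) := by
  funext n s
  let F : ℤ × ℤ → TSeries := fun x => a x.1 s * b (x.2 - x.1) (s + x.1) * c (n - x.2) (s + x.2)
  have hF : (Function.support F).Finite := by
    obtain ⟨N, ha⟩ := ha
    obtain ⟨M, hb⟩ := hb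
    obtain ⟨K, hc⟩ := hc
    refine ((finite_units_mul_mem_Icc σ (σ * n - M - K) N).prod
      (finite_units_mul_mem_Icc σ (σ * n - K) (N + M))).subset ?_
    rintro ⟨k, m⟩ hkm
    have h1 : σ * k ≤ N := by
      by_contra h
      exact hkm (by simp only [F]; rw [ha _ _ (not_le.1 h), zero_mul, zero_mul])
    have h2 : σ * (m - k) ≤ M := by
      by_contra h
      exact hkm (by simp only [F]; rw [hb _ _ (not_le.1 h), mul_zero, zero_mul])
    have h3 : σ * (n - m) ≤ K := by
      by_contra h
      exact hkm (by simp only [F]; rw [hc _ _ (not_le.1 h), mul_zero])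
    rw [mul_sub] at h2 h3
    exact ⟨⟨by simp only; linarith, h1⟩, ⟨by simp only; linarith, by simp only; linarith⟩⟩
  have e (k : ℤ) : dmul b c (n - k) (s + k) =
      ∑ᶠ m, b (m - k) (s + k) * c (n - m) (s + m) := by
    rw [dmul, ← finsum_comp_equiv (Equiv.addLeft k)
      (f := fun m => b (m - k) (s + k) * c (n - m) (s + m))]
    refine finsum_congr fun l => ?_
    simp only [Equiv.coe_addLeft]
    rw [add_sub_cancel_left, sub_sub, add_assoc]
  have hbc' (k : ℤ) :
      (Function.support fun m => b (m - k) (s + k) * c (n - m) (s + m)).Finite := by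
    refine ((finite_support_dmul hb hc (n - k) (s + k)).image (k + ·)).subset fun m hm => ?_
    refine ⟨m - k, ?_, by simp only; ring⟩
    simp only [Function.mem_support] at hm ⊢
    rwa [sub_sub_sub_cancel_right, add_add_sub_cancel]
  have h := finsum_mul_finsum_assoc (fun k => a k s) (fun k m => b (m - k) (s + k))
    (fun m => c (n - m) (s + m)) hF (fun m => finite_support_dmul ha hb m s) hbc'
  refine h.trans (finsum_congr fun k => ?_)
  rw [e k]

theorem dmul_add {a b c : DiffOp} (ha : a ∈ halfBounded σ) (hb : b ∈ halfBounded σ)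
    (hc : c ∈ halfBounded σ) : dmul a (b + c) = dmul a b + dmul a c := by
  funext n s
  refine (finsum_congr fun k => mul_add _ _ _).trans ?_
  exact finsum_add_distrib (finite_support_dmul ha hb n s) (finite_support_dmul ha hc n s)

theorem add_dmul {a b c : DiffOp} (ha : a ∈ halfBounded σ) (hb : b ∈ halfBounded σ)
    (hc : c ∈ halfBounded σ) : dmul (a + b) c = dmul a c + dmul b c := by
  funext n s
  refine (finsum_congr fun k => add_mul _ _ _).trans ?_
  exact finsum_add_distrib (finite_support_dmul ha hc n s) (finite_support_dmul hb hc n s)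

theorem dLambda_zero_dmul (a : DiffOp) : dmul (dLambda 0) a = a := by
  funext n s
  rw [dLambda_dmul, sub_zero, add_zero]

theorem dmul_dLambda_zero (a : DiffOp) : dmul a (dLambda 0) = a := by
  funext n s
  rw [dmul_dLambda, sub_zero]

/-- The product of difference operators makes the operators bounded on one side a ring. -/
instance : Ring (halfBounded σ) :=
  { (inferInstance : AddCommGroup (halfBounded σ)) with
    mul := fun a b => ⟨dmul a b, dmul_mem a.2 b.2⟩
    one := ⟨dLambda 0, dLambda_mem 0⟩
    zero_mul := fun _ => Subtype.ext (funext₂ fun n s =>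
      finsum_eq_zero_of_forall_eq_zero fun k => zero_mul _)
    mul_zero := fun _ => Subtype.ext (funext₂ fun n s =>
      finsum_eq_zero_of_forall_eq_zero fun k => mul_zero _)
    mul_assoc := fun a b c => Subtype.ext (dmul_assoc a.2 b.2 c.2)
    one_mul := fun a => Subtype.ext (dLambda_zero_dmul a)
    mul_one := fun a => Subtype.ext (dmul_dLambda_zero a)
    left_distrib := fun a b c => Subtype.ext (dmul_add a.2 b.2 c.2)
    right_distrib := fun a b c => Subtype.ext (add_dmul a.2 b.2 c.2) }

theorem coe_dmul (a b : halfBounded σ) : ((a * b : halfBounded σ) : DiffOp) = dmul a b := rfl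

theorem coe_dpow (a : halfBounded σ) (k : ℕ) : ((a ^ k : halfBounded σ) : DiffOp) = dpow a k := by
  induction k with
  | zero => rw [pow_zero]; rfl
  | succ k ih => rw [pow_succ, coe_dmul, ih]; rfl

theorem dderiv_mem (i : Time) {a : DiffOp} (ha : a ∈ halfBounded σ) :
    dderiv i a ∈ halfBounded σ := by
  obtain ⟨N, ha⟩ := ha
  exact ⟨N, fun n s h => by rw [dderiv, ha n s h, map_zero]⟩

/-- The derivative in a time variable as an additive map of the ring of half-bounded operators. -/
def timeDeriv (σ : ℤˣ) (i : Time) : halfBounded σ →+ halfBounded σ where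
  toFun a := ⟨dderiv i a, dderiv_mem i a.2⟩
  map_zero' := Subtype.ext (funext₂ fun _ _ => map_zero _)
  map_add' _ _ := Subtype.ext (funext₂ fun _ _ => map_add _ _ _)

theorem coe_timeDeriv (i : Time) (a : halfBounded σ) :
    ((timeDeriv σ i a : halfBounded σ) : DiffOp) = dderiv i a := rfl

theorem timeDeriv_mul (i : Time) (a b : halfBounded σ) :
    timeDeriv σ i (a * b) = timeDeriv σ i a * b + a * timeDeriv σ i b := by
  refine Subtype.ext (funext₂ fun n s => ?_)
  change (MvPowerSeries.pderiv ℂ i) (∑ᶠ k, a.1 k s * b.1 (n - k) (s + k)) =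
    dmul (dderiv i a) b n s + dmul a (dderiv i b) n s
  have h := AddMonoidHom.map_finsum (MvPowerSeries.pderiv ℂ i).toLinearMap.toAddMonoidHom
    (finite_support_dmul a.2 b.2 n s)
  refine h.trans ((finsum_congr fun k => ?_).trans (finsum_add_distrib
    (finite_support_dmul (dderiv_mem i a.2) b.2 n s)
    (finite_support_dmul a.2 (dderiv_mem i b.2) n s)))
  exact (pderiv_mul i _ _).trans (add_comm _ _)

/-- The shift `Λ^m`. -/
def shiftPow (σ : ℤˣ) (m : ℤ) : halfBounded σ := ⟨dLambda m, dLambda_mem m⟩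

theorem shiftPow_mul (m m' : ℤ) : shiftPow σ m * shiftPow σ m' = shiftPow σ (m + m') :=
  Subtype.ext (funext₂ fun n s => by
    rw [coe_dmul]
    change dmul (dLambda m) (dLambda m') n s = dLambda (m + m') n s
    rw [dmul_dLambda, dLambda, dLambda]
    congr 1
    exact propext ⟨fun h => by omega, fun h => by omega⟩)

theorem shiftPow_zero : shiftPow σ 0 = 1 := rfl

theorem timeDeriv_shiftPow (i : Time) (m : ℤ) : timeDeriv σ i (shiftPow σ m) = 0 :=
  Subtype.ext (funext₂ fun n s => by
    change (MvPowerSeries.pderiv ℂ i) (if n = m then 1 else 0) = 0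
    split_ifs
    · exact Derivation.map_one_eq_zero _
    · exact map_zero _)

/-- A right inverse of a triangular operator is a left inverse if the diagonal of the reverse
product is `1`: an idempotent with diagonal `1` is the identity. -/
theorem mul_eq_one_of_triangular {a b : halfBounded σ} (hab : a * b = 1)
    (h0 : ∀ s, (b * a : halfBounded σ).1 0 s = 1)
    (h1 : ∀ n s : ℤ, (0 : ℤ) < σ * n → (b * a : halfBounded σ).1 n s = 0) : b * a = 1 := by
  -- `b a` is idempotent, so `M = b a - 1` is minus an idempotent
  have hM : b * a - 1 = -((b * a - 1) * (b * a - 1)) := by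
    have h2 : b * a * (b * a) = b * a := by rw [mul_assoc, ← mul_assoc a, hab, one_mul]
    rw [sub_mul, mul_sub, h2]; simp
  set M := b * a - 1 with hMdef
  have hinit : ∀ n s : ℤ, (-1 : ℤ) < σ * n → M.1 n s = 0 := by
    intro n s h
    change (b * a : halfBounded σ).1 n s - dLambda 0 n s = 0
    by_cases hn : n = 0
    · rw [hn, h0, dLambda, if_pos rfl, sub_self]
    · have h2 : (0 : ℤ) < σ * n := by
        rcases lt_trichotomy (σ * n : ℤ) 0 with h | h | h
        · omega
        · exact absurd (by simpa using h) hn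
        · exact h
      rw [h1 n s h2, dLambda, if_neg hn, sub_self]
  -- `M` is strictly triangular, and `M = -M²` raises its order of vanishing at each step
  have hind : ∀ (p : ℕ) (n s : ℤ), -1 - (p : ℤ) < σ * n → M.1 n s = 0 := by
    intro p
    induction p with
    | zero => intro n s h; exact hinit n s (by simpa using h)
    | succ p ih =>
      intro n s h
      rw [hM]
      change -dmul M.1 M.1 n s = 0
      rw [neg_eq_zero]
      refine dmul_eq_zero (N := -1 - (p : ℤ)) (M := -1) ih hinit s ?_
      push_cast at h
      linarith
  have : M = 0 := Subtype.ext (funext₂ fun n s => hind (-1 - σ * n + 1).toNat n s (by omega))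
  rwa [hMdef, sub_eq_zero] at this

end Ring

/-! ### Lax equations from the evolution of a dressing operator -/

/-- If `w` evolves by `δ w = b w - w c`, a conjugate `w l w⁻¹` of a constant `l` commuting with `c`
evolves by the commutator with `b`. -/
theorem deriv_conj {A : Type*} [Ring A] (δ : A →+ A) (hδ : ∀ x y, δ (x * y) = δ x * y + x * δ y)
    {w v l b c : A} (hwv : w * v = 1) (hvw : v * w = 1) (hl : δ l = 0) (hc : c * l = l * c)
    (hw : δ w = b * w - w * c) : δ (w * l * v) = b * (w * l * v) - w * l * v * b := by
  have h1 : δ 1 = 0 := by simpa using hδ 1 1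
  have h2 : w * δ v = w * c * v - b := by
    have h := hδ w v
    rw [hwv, h1, hw, sub_mul, mul_assoc b, hwv, mul_one] at h
    rw [eq_comm, ← sub_eq_zero, ← neg_eq_zero, h]
    abel
  have h3 : w * l * δ v = w * l * c * v - w * l * v * b := by
    calc w * l * δ v = w * l * (v * w) * δ v := by rw [hvw, mul_one]
      _ = w * l * v * (w * δ v) := by simp only [mul_assoc]
      _ = w * l * (v * w) * c * v - w * l * v * b := by rw [h2]; noncomm_ring
      _ = w * l * c * v - w * l * v * b := by rw [hvw, mul_one]
  rw [hδ, hδ, hl, hw, h3, mul_zero, add_zero, mul_assoc w l c, ← hc]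
  noncomm_ring

theorem conj_pow {A : Type*} [Ring A] {w v : A} (hwv : w * v = 1) (hvw : v * w = 1) (l : A) (k : ℕ) :
    (w * l * v) ^ k = w * l ^ k * v := by
  induction k with
  | zero => rw [pow_zero, pow_zero, mul_one, hwv]
  | succ k ih =>
    rw [pow_succ, ih, pow_succ]
    calc w * l ^ k * v * (w * l * v) = w * l ^ k * (v * w) * l * v := by simp only [mul_assoc]
      _ = w * (l ^ k * l) * v := by rw [hvw, mul_one]; simp only [mul_assoc]

theorem shiftPow_one_pow (σ : ℤˣ) (e : ℤ) (k : ℕ) : shiftPow σ e ^ k = shiftPow σ (k * e) := by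
  induction k with
  | zero => rw [pow_zero, Nat.cast_zero, zero_mul, shiftPow_zero]
  | succ k ih => rw [pow_succ, ih, shiftPow_mul]; congr 1; push_cast; ring

/-! ### The tau function of the hierarchy -/

section Toda

variable {G : Op TSeries}

/-- The dressing operator `W` in the ring of operators bounded above. -/
def ringW (G : Op TSeries) : halfBounded 1 := ⟨dressW (kernelTau G), 0, fun n s h =>
  dressW_of_pos _ s (by simpa using h)⟩

/-- The inverse of `W` in the ring of operators bounded above. -/
def ringV (G : Op TSeries) : halfBounded 1 := ⟨dressWInv G, 0, fun n s h =>
  dressWInv_of_pos _ s (by simpa using h)⟩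

/-- The dressing operator `W̄` in the ring of operators bounded below. -/
def ringWbar (G : Op TSeries) : halfBounded (-1) := ⟨dressWbar (kernelTau G), 0, fun n s h =>
  dressWbar_of_neg _ s (by simpa using h)⟩

/-- The inverse of `W̄` in the ring of operators bounded below. -/
def ringVbar (G : Op TSeries) : halfBounded (-1) := ⟨dressWbarInv G, 0, fun n s h =>
  dressWbarInv_of_neg _ s (by simpa using h)⟩

theorem IsTodaKernel.ringW_mul_ringV (hG : IsTodaKernel G) : ringW G * ringV G = 1 :=
  Subtype.ext hG.dmul_dressWInv

theorem IsTodaKernel.ringWbar_mul_ringVbar (hG : IsTodaKernel G) : ringWbar G * ringVbar G = 1 :=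
  Subtype.ext hG.dmul_dressWbarInv

theorem dmul_zero_of_nonpos {a b : DiffOp} (ha : ∀ n s, 0 < n → a n s = 0)
    (hb : ∀ n s, 0 < n → b n s = 0) (s : ℤ) : dmul a b 0 s = a 0 s * b 0 s := by
  rw [dmul, finsum_eq_single _ 0, sub_zero, add_zero]
  intro k hk
  by_cases hk : 0 < k
  · rw [ha _ _ hk, zero_mul]
  · rw [hb _ _ (by omega), mul_zero]

theorem dmul_zero_of_nonneg {a b : DiffOp} (ha : ∀ n s, n < 0 → a n s = 0)
    (hb : ∀ n s, n < 0 → b n s = 0) (s : ℤ) : dmul a b 0 s = a 0 s * b 0 s := by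
  rw [dmul, finsum_eq_single _ 0, sub_zero, add_zero]
  intro k hk
  by_cases hk : k < 0
  · rw [ha _ _ hk, zero_mul]
  · rw [hb _ _ (by omega), mul_zero]

theorem IsTodaKernel.ringV_mul_ringW (hG : IsTodaKernel G) : ringV G * ringW G = 1 := by
  refine mul_eq_one_of_triangular hG.ringW_mul_ringV (fun s => ?_) fun n s h => ?_
  · rw [coe_dmul]
    refine (dmul_zero_of_nonpos (fun n s => dressWInv_of_pos G s)
      (fun n s => dressW_of_pos _ s) s).trans ?_
    rw [hG.dressW_zero, hG.dressWInv_zero, one_mul]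
  · rw [coe_dmul]
    change dmul (dressWInv G) (dressW (kernelTau G)) n s = 0
    exact dmul_eq_zero (σ := 1) (N := 0) (M := 0)
      (fun n s h => dressWInv_of_pos G s (by simpa using h))
      (fun n s h => dressW_of_pos _ s (by simpa using h)) s (by simpa using h)

theorem IsTodaKernel.ringVbar_mul_ringWbar (hG : IsTodaKernel G) :
    ringVbar G * ringWbar G = 1 := by
  refine mul_eq_one_of_triangular hG.ringWbar_mul_ringVbar (fun s => ?_) fun n s h => ?_
  · rw [coe_dmul]
    refine (dmul_zero_of_nonneg (fun n s => dressWbarInv_of_neg G s)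
      (fun n s => dressWbar_of_neg _ s) s).trans ?_
    have h1 := dmul_zero_of_nonneg (fun n s => dressWbar_of_neg (kernelTau G) s)
      (fun n s => dressWbarInv_of_neg G s) s
    rw [hG.dmul_dressWbarInv, dLambda, if_pos rfl] at h1
    rw [mul_comm, ← h1]
  · rw [coe_dmul]
    change dmul (dressWbarInv G) (dressWbar (kernelTau G)) n s = 0
    exact dmul_eq_zero (σ := -1) (N := 0) (M := 0)
      (fun n s h => dressWbarInv_of_neg G s (by simpa using h))
      (fun n s h => dressWbar_of_neg _ s (by simpa using h)) s (by simpa using h)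

/-- `L = W Λ W⁻¹`. -/
def ringL (G : Op TSeries) : halfBounded 1 := ringW G * shiftPow 1 1 * ringV G

/-- `L̄⁻¹ = W̄ Λ⁻¹ W̄⁻¹`. -/
def ringLbarInv (G : Op TSeries) : halfBounded (-1) := ringWbar G * shiftPow (-1) (-1) * ringVbar G

/-- `L̄ = W̄ Λ W̄⁻¹`. -/
def ringLbar (G : Op TSeries) : halfBounded (-1) := ringWbar G * shiftPow (-1) 1 * ringVbar G

theorem IsTodaKernel.ringL_pow (hG : IsTodaKernel G) (k : ℕ) :
    ringL G ^ k = ringW G * shiftPow 1 k * ringV G := by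
  rw [ringL, conj_pow hG.ringW_mul_ringV hG.ringV_mul_ringW, shiftPow_one_pow, mul_one]

theorem IsTodaKernel.ringLbarInv_pow (hG : IsTodaKernel G) (k : ℕ) :
    ringLbarInv G ^ k = ringWbar G * shiftPow (-1) (-k) * ringVbar G := by
  rw [ringLbarInv, conj_pow hG.ringWbar_mul_ringVbar hG.ringVbar_mul_ringWbar, shiftPow_one_pow,
    mul_neg_one]

/-- The logarithmic derivative of `W`, which has negative powers of `Λ` only. -/
theorem IsTodaKernel.timeDeriv_ringW_mul (hG : IsTodaKernel G) (i : Time) {n : ℤ} (s : ℤ)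
    (h : 0 ≤ n) : (timeDeriv 1 i (ringW G) * ringV G).1 n s = 0 := by
  rw [coe_dmul]
  refine dmul_eq_zero (σ := 1) (N := -1) (M := 0) (fun n s h => ?_)
    (fun n s h => dressWInv_of_pos G s (by simpa using h)) s ?_
  · rw [coe_timeDeriv, dderiv]
    change MvPowerSeries.pderiv ℂ i (dressW (kernelTau G) n s) = 0
    have h' : -1 < n := by simpa using h
    rcases eq_or_ne n 0 with rfl | hn
    · rw [hG.dressW_zero]; exact Derivation.map_one_eq_zero _
    · rw [dressW_of_pos _ _ (by omega), map_zero]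
  · rw [Units.val_one, one_mul]; omega

/-- The logarithmic derivative of `W̄`, which has non-negative powers of `Λ` only. -/
theorem timeDeriv_ringWbar_mul (G : Op TSeries) (i : Time) {n : ℤ} (s : ℤ) (h : n < 0) :
    (timeDeriv (-1) i (ringWbar G) * ringVbar G).1 n s = 0 := by
  rw [coe_dmul]
  refine dmul_eq_zero (σ := -1) (N := 0) (M := 0) (fun n s h => ?_)
    (fun n s h => dressWbarInv_of_neg G s (by simpa using h)) s (by simpa using h)
  rw [coe_timeDeriv, dderiv]
  change MvPowerSeries.pderiv ℂ i (dressWbar (kernelTau G) n s) = 0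
  rw [dressWbar_of_neg _ _ (by simpa using h), map_zero]

/-- The bilinear identity equates an operator whose non-negative part
is that of `L^k` with one that has no negative powers. -/
theorem IsTodaKernel.opB_eq (hG : IsTodaKernel G) (k : ℕ+) : opB (ringL G) k =
    (timeDeriv (-1) (Sum.inl k) (ringWbar G) * ringVbar G : halfBounded (-1)) := by
  have h : ((timeDeriv 1 (Sum.inl k) (ringW G) + ringW G * shiftPow 1 k) * ringV G :
      halfBounded 1).1 = (timeDeriv (-1) (Sum.inl k) (ringWbar G) * ringVbar G).1 :=
    hG.dderiv_t k
  funext n s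
  rw [opB, dNonneg, ← coe_dpow, hG.ringL_pow]
  split_ifs with hn
  · rw [← h, add_mul]
    change _ = (timeDeriv 1 (Sum.inl k) (ringW G) * ringV G).1 n s + _
    rw [hG.timeDeriv_ringW_mul _ _ hn, zero_add]
  · rw [timeDeriv_ringWbar_mul G _ _ (not_le.1 hn)]

theorem IsTodaKernel.opB_eq' (hG : IsTodaKernel G) (k : ℕ+) : opB (ringL G) k =
    ((timeDeriv 1 (Sum.inl k) (ringW G) + ringW G * shiftPow 1 k) * ringV G : halfBounded 1) :=
  (hG.opB_eq k).trans (hG.dderiv_t k).symm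

theorem IsTodaKernel.opBbar_eq (hG : IsTodaKernel G) (k : ℕ+) : opBbar (ringLbarInv G) k =
    (timeDeriv 1 (Sum.inr k) (ringW G) * ringV G : halfBounded 1) := by
  have h : (timeDeriv 1 (Sum.inr k) (ringW G) * ringV G : halfBounded 1).1 =
      ((timeDeriv (-1) (Sum.inr k) (ringWbar G) + ringWbar G * shiftPow (-1) (-k)) *
        ringVbar G : halfBounded (-1)).1 := hG.dderiv_tbar k
  funext n s
  rw [opBbar, dNeg, ← coe_dpow, hG.ringLbarInv_pow]
  split_ifs with hn
  · rw [h, add_mul]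
    change _ = (timeDeriv (-1) (Sum.inr k) (ringWbar G) * ringVbar G).1 n s + _
    rw [timeDeriv_ringWbar_mul G _ _ hn, zero_add]
  · rw [hG.timeDeriv_ringW_mul _ _ (not_lt.1 hn)]

theorem IsTodaKernel.opBbar_eq' (hG : IsTodaKernel G) (k : ℕ+) : opBbar (ringLbarInv G) k =
    ((timeDeriv (-1) (Sum.inr k) (ringWbar G) + ringWbar G * shiftPow (-1) (-k)) *
      ringVbar G : halfBounded (-1)) :=
  (hG.opBbar_eq k).trans (hG.dderiv_tbar k)

/-- The four evolution equations, in the rings of half-bounded operators. -/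
theorem IsTodaKernel.evolution (hG : IsTodaKernel G) (k : ℕ+) :
    (∃ b : halfBounded 1, b.1 = opB (ringL G) k ∧
      timeDeriv 1 (Sum.inl k) (ringW G) = b * ringW G - ringW G * shiftPow 1 k) ∧
    (∃ b : halfBounded 1, b.1 = opBbar (ringLbarInv G) k ∧
      timeDeriv 1 (Sum.inr k) (ringW G) = b * ringW G) ∧
    (∃ b : halfBounded (-1), b.1 = opB (ringL G) k ∧
      timeDeriv (-1) (Sum.inl k) (ringWbar G) = b * ringWbar G) ∧
    (∃ b : halfBounded (-1), b.1 = opBbar (ringLbarInv G) k ∧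
      timeDeriv (-1) (Sum.inr k) (ringWbar G) =
        b * ringWbar G - ringWbar G * shiftPow (-1) (-k)) := by
  refine ⟨⟨_, (hG.opB_eq' k).symm, ?_⟩, ⟨_, (hG.opBbar_eq k).symm, ?_⟩,
    ⟨_, (hG.opB_eq k).symm, ?_⟩, ⟨_, (hG.opBbar_eq' k).symm, ?_⟩⟩
  · rw [mul_assoc, hG.ringV_mul_ringW, mul_one, add_sub_cancel_right]
  · rw [mul_assoc, hG.ringV_mul_ringW, mul_one]
  · rw [mul_assoc, hG.ringVbar_mul_ringWbar, mul_one]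
  · rw [mul_assoc, hG.ringVbar_mul_ringWbar, mul_one, add_sub_cancel_right]

theorem IsTodaKernel.isTodaLax (hG : IsTodaKernel G) :
    IsTodaLax (ringL G) (ringLbar G) (ringLbarInv G) where
  L_lead s := by
    rw [ringL, coe_dmul, coe_dmul]
    change dmul (dmul (dressW (kernelTau G)) (dLambda 1)) (dressWInv G) 1 s = 1
    rw [dmul, finsum_eq_single _ 1, dmul_dLambda, sub_self, hG.dressW_zero,
      hG.dressWInv_zero, one_mul]
    intro k hk
    rw [dmul_dLambda]
    by_cases h : 1 < k
    · rw [dressW_of_pos _ _ (by omega), zero_mul]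
    · rw [dressWInv_of_pos _ _ (by omega), mul_zero]
  L_zero n s h := by
    rw [ringL, coe_dmul, coe_dmul]
    refine dmul_eq_zero (σ := 1) (N := 1) (M := 0) (fun n s h => ?_)
      (fun n s h => dressWInv_of_pos G s (by simpa using h)) s (by simpa using h)
    have h' : 1 < n := by simpa using h
    exact (dmul_dLambda _ _ _ _).trans (dressW_of_pos _ _ (by omega))
  Lbar_zero n s h := by
    rw [ringLbar, coe_dmul, coe_dmul]
    refine dmul_eq_zero (σ := -1) (N := -1) (M := 0) (fun n s h => ?_)
      (fun n s h => dressWbarInv_of_neg G s (by simpa using h)) s (by simpa using h)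
    have h' : n < 1 := by simpa using h
    exact (dmul_dLambda _ _ _ _).trans (dressWbar_of_neg _ _ (by omega))
  LbarInv_zero n s h := by
    rw [ringLbarInv, coe_dmul, coe_dmul]
    refine dmul_eq_zero (σ := -1) (N := 1) (M := 0) (fun n s h => ?_)
      (fun n s h => dressWbarInv_of_neg G s (by simpa using h)) s (by simp; omega)
    have h' : 1 < -n := by simpa using h
    exact (dmul_dLambda _ _ _ _).trans (dressWbar_of_neg _ _ (by omega))
  Lbar_mul_inv := by
    have h : ringLbar G * ringLbarInv G = 1 := by
      calc ringLbar G * ringLbarInv G = ringWbar G * shiftPow (-1) 1 * (ringVbar G * ringWbar G) *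
            shiftPow (-1) (-1) * ringVbar G := by rw [ringLbar, ringLbarInv]; simp only [mul_assoc]
        _ = 1 := by
          rw [hG.ringVbar_mul_ringWbar, mul_one, mul_assoc (ringWbar G), shiftPow_mul,
            add_neg_cancel, shiftPow_zero, mul_one, hG.ringWbar_mul_ringVbar]
    exact congrArg Subtype.val h
  inv_mul_Lbar := by
    have h : ringLbarInv G * ringLbar G = 1 := by
      calc ringLbarInv G * ringLbar G = ringWbar G * shiftPow (-1) (-1) *
            (ringVbar G * ringWbar G) * shiftPow (-1) 1 * ringVbar G := by
              rw [ringLbar, ringLbarInv]; simp only [mul_assoc]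
        _ = 1 := by
          rw [hG.ringVbar_mul_ringWbar, mul_one, mul_assoc (ringWbar G), shiftPow_mul,
            neg_add_cancel, shiftPow_zero, mul_one, hG.ringWbar_mul_ringVbar]
    exact congrArg Subtype.val h
  L_t k := by
    obtain ⟨b, hb, h⟩ := (hG.evolution k).1
    rw [← hb]
    exact congrArg Subtype.val (deriv_conj (timeDeriv 1 (Sum.inl k)) (timeDeriv_mul _)
      hG.ringW_mul_ringV hG.ringV_mul_ringW (timeDeriv_shiftPow _ 1)
      (by rw [shiftPow_mul, shiftPow_mul, add_comm]) h)
  L_tbar k := by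
    obtain ⟨b, hb, h⟩ := (hG.evolution k).2.1
    rw [← hb]
    exact congrArg Subtype.val (deriv_conj (timeDeriv 1 (Sum.inr k)) (timeDeriv_mul _)
      hG.ringW_mul_ringV hG.ringV_mul_ringW (timeDeriv_shiftPow _ 1) (c := 0)
      (by rw [zero_mul, mul_zero]) (by rw [mul_zero, sub_zero, h]))
  Lbar_t k := by
    obtain ⟨b, hb, h⟩ := (hG.evolution k).2.2.1
    rw [← hb]
    exact congrArg Subtype.val (deriv_conj (timeDeriv (-1) (Sum.inl k)) (timeDeriv_mul _)
      hG.ringWbar_mul_ringVbar hG.ringVbar_mul_ringWbar (timeDeriv_shiftPow _ 1) (c := 0)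
      (by rw [zero_mul, mul_zero]) (by rw [mul_zero, sub_zero, h]))
  Lbar_tbar k := by
    obtain ⟨b, hb, h⟩ := (hG.evolution k).2.2.2
    rw [← hb]
    exact congrArg Subtype.val (deriv_conj (timeDeriv (-1) (Sum.inr k)) (timeDeriv_mul _)
      hG.ringWbar_mul_ringVbar hG.ringVbar_mul_ringWbar (timeDeriv_shiftPow _ 1)
      (by rw [shiftPow_mul, shiftPow_mul, add_comm]) h)

theorem IsTodaKernel.isTodaTau (hG : IsTodaKernel G) : IsTodaTau (kernelTau G) := by
  refine ⟨hG.isUnit, dressWInv G, dressWbarInv G, fun n s => dressWInv_of_pos G s,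
    fun n s => dressWbarInv_of_neg G s, hG.dmul_dressWInv,
    congrArg Subtype.val hG.ringV_mul_ringW, hG.dmul_dressWbarInv,
    congrArg Subtype.val hG.ringVbar_mul_ringWbar, fun k => ?_, hG.isTodaLax⟩
  obtain ⟨⟨b₁, hb₁, h₁⟩, ⟨b₂, hb₂, h₂⟩, ⟨b₃, hb₃, h₃⟩, ⟨b₄, hb₄, h₄⟩⟩ := hG.evolution k
  refine ⟨?_, ?_, ?_, ?_⟩
  · change _ = dmul (opB (ringL G) k) _ - _
    rw [← hb₁]
    exact congrArg Subtype.val h₁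
  · change _ = dmul (opBbar (ringLbarInv G) k) _
    rw [← hb₂]
    exact congrArg Subtype.val h₂
  · change _ = dmul (opB (ringL G) k) _
    rw [← hb₃]
    exact congrArg Subtype.val h₃
  · change _ = dmul (opBbar (ringLbarInv G) k) _ - _
    rw [← hb₄]
    exact congrArg Subtype.val h₄

end Toda

end CubicHodge

end

theorem theorem3p4 (ħ τ c : ℂ) (hħ : 0 < ħ.im) (hτ : τ ≠ 0) :
    CubicHodge.IsTodaTau (fun s : ℤ => CubicHodge.tau ħ τ ((s : ℂ) + c)) ∧
    (∀ s : ℤ, CubicHodge.tau ħ τ (s : ℂ) =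
      CubicHodge.fermionicTau (CubicHodge.opH ħ τ) s) ∧
    (∀ s : ℤ, CubicHodge.tau ħ τ ((s : ℂ) + c) =
      CubicHodge.fermionicTau (CubicHodge.opHc ħ τ c) s) := by
  refine ⟨?_, fun s => ?_, CubicHodge.tau_eq_fermionicTau ħ τ c⟩
  · have h : (fun s : ℤ => CubicHodge.tau ħ τ ((s : ℂ) + c)) =
        CubicHodge.kernelTau (CubicHodge.todaMatrix (CubicHodge.opHc ħ τ c)) := funext fun s =>
      (CubicHodge.tau_eq_fermionicTau ħ τ c s).trans (CubicHodge.fermionicTau_eq_todaMatrix _ s)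
    rw [h]
    exact (CubicHodge.isTodaKernel_todaMatrix ħ τ c).isTodaTau
  · rw [CubicHodge.opH_eq, ← CubicHodge.tau_eq_fermionicTau, add_zero]
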